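/- Let $n\ge 1$ be an integer, let $\mathfrak g$ be a simple finite dimensional Lie algebra over $\mathbb C$ with Killing form $\kappa_{\mathfrak g}$, let $k\in\mathbb C$ and $\kappa=k\,\kappa_{\mathfrak g}$. **The ring $K_n$.** Put $A_n=\mathbb C[[a_1,\dots,a_n]]$, $\varphi_n=\prod_{i=1}^n(z-a_i)$, $R_n=A_n[[z]]$, $K_n=R_n[\varphi_n^{-1}]$, topologized by the neighbourhoods $\varphi_n^N R_n$ of $0$ ($N\ge 0$). Let $\partial_z$ be the $A_n$-linear derivation $d/dz$ of $K_n$, and let $\int:K_n\to A_n$ be the continuous $A_n$-linear residue which on $A_n[z][\varphi_n^{-1}]$ sends $f$ to the sum of the residues of $f\,dz$ at the points $a_1,\dots,a_n$. **The completed enveloping algebra.** Let $\hat{\mathfrak g}_{n,k}=(\mathfrak g\otimes_{\mathbb C} K_n)\oplus A_n\mathbf 1$ be the Lie algebra over $A_n$ with $\mathbf 1$ central and $[Xf,Yh]=[X,Y]fh+\kappa(X,Y)\big(\int h\,\partial_z f\big)\mathbf 1$. Let $U'_k=U_{A_n}(\hat{\mathfrak g}_{n,k})/(\mathbf 1-1)$,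 and let $\tilde U_k(\hat{\mathfrak g}_n)$ be its completion for the topology given by the left ideals generated by $\mathfrak g\otimes\varphi_n^N R_n$, $N\ge 0$. **Fields.** A $K_n$-field is a continuous $A_n$-linear map $K_n\to \tilde U_k(\hat{\mathfrak g}_n)$. Examples are $\hat X:f\mapsto Xf$ for $X\in\mathfrak g$, and $\mathbf 1: f\mapsto(\int f)\cdot 1$. Let $\widehat{K_n\otimes K_n}^{1}$ and $\widehat{K_n\otimes K_n}^{2}$ be the completions of $K_n\otimes_{A_n}K_n$ for the topologies given by the submodules $\varphi_n^NR_n\otimes K_n$, respectively $K_n\otimes\varphi_n^NR_n$; write $z=z\otimes 1$ and $w=1\otimes z$; the element $z-w$ is invertible in both. For fields $a,b$ and $m\in\mathbb Z$ define $\partial a=a\circ(-\partial_z)$ and $$(a_{(m)}b)(f)=(ab)\big((z-w)^m(1\otimes f)\big)-(ba\sigma)\big((z-w)^m(1\otimes f)\big),$$ where $ab$ and $ba\sigma$ are the continuous extensions of $f\otimes h\mapsto a(f)b(h)$ to $\widehat{K_n\otimes K_n}^2$ and of $f\otimes h\mapsto b(h)a(f)$ to $\widehat{K_n\otimes K_n}^1$.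 A $\mathbb C$-subspace of fields is closed if it is stable under $\partial$ and all products $(a,b)\mapsto a_{(m)}b$, $m\in\mathbb Z$. Let $\overline{\mathcal F}$ be the smallest closed subspace containing all $\hat X$, $X\in\mathfrak g$, and put $V^k_{K_n}(\mathfrak g)=\overline{\mathcal F}+\mathbb C\mathbf 1$. **The affine vertex algebra.** Let $V^k(\mathfrak g)$ be the vacuum module of level $k$, the quotient of $U(\mathfrak g((t))\oplus\mathbb C\mathbf 1)/(\mathbf 1-1)$ by the left ideal generated by $\mathfrak g[[t]]$, where $[Xf,Yh]=[X,Y]fh+\kappa(X,Y)\operatorname{Res}_{t=0}(h\,df)\,\mathbf 1$. Let $|0\rangle$ be the class of $1$ and $X_m=Xt^m$. **Proposition.** 1. If $k\neq0$ then $\mathbf 1\in\overline{\mathcal F}$, so that $V^k_{K_n}(\mathfrak g)=\overline{\mathcal F}$. 2. $V^k(\mathfrak g)$ has a vertex algebra structure with vacuum $|0\rangle$ and $Y(X_{-1}|0\rangle,x)=\sum_{m\in\mathbb Z}X_m x^{-m-1}$ for all $X\in\mathfrak g$. 3. $V^k_{K_n}(\mathfrak g)$ has a vertex algebra structure with vacuum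 $\mathbf 1$, translation operator $\partial$ and products $a_{(m)}b$. 4. For these structures there is an isomorphism of vertex algebras $Y_{\mathrm{can}}:V^k(\mathfrak g)\to V^k_{K_n}(\mathfrak g)$ with $Y_{\mathrm{can}}(X_{-1}|0\rangle)=\hat X$ for all $X\in\mathfrak g$. -/

import Mathlib

open scoped TensorProduct Polynomial PowerSeries
open Polynomial (X C)

noncomputable section

namespace KnFields

/-! ### Extending a derivation to a localization -/

section LocDer

variable {A R K : Type*} [CommRing A] [CommRing R] [CommRing K] [Algebra A R] [Algebra R K]

/-- The ring homomorphism `r ↦ r + (d r) ε` to the dual numbers over `K`. -/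
def derDual (d : Derivation A R R) : R →+* TrivSqZeroExt K K where
  toFun r := TrivSqZeroExt.inl (algebraMap R K r) + TrivSqZeroExt.inr (algebraMap R K (d r))
  map_one' := by ext <;> simp [Algebra.smul_def]
  map_zero' := by ext <;> simp [Algebra.smul_def]
  map_add' x y := by ext <;> simp [Algebra.smul_def]
  map_mul' x y := by
    ext
    · simp
    · simp only [TrivSqZeroExt.snd_add, TrivSqZeroExt.snd_inl, TrivSqZeroExt.snd_inr,
        TrivSqZeroExt.snd_mul, TrivSqZeroExt.fst_add, TrivSqZeroExt.fst_inl,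
        TrivSqZeroExt.fst_inr, Derivation.leibniz, smul_eq_mul, map_add, map_mul,
        MulOpposite.smul_eq_mul_unop, MulOpposite.unop_op, zero_add, add_zero]
      ring

lemma derDual_fst (d : Derivation A R R) (r : R) :
    (derDual (K := K) d r).fst = algebraMap R K r := by simp [derDual]

lemma derDual_snd (d : Derivation A R R) (r : R) :
    (derDual (K := K) d r).snd = algebraMap R K (d r) := by
  change (TrivSqZeroExt.inl (algebraMap R K r)
    + TrivSqZeroExt.inr (algebraMap R K (d r)) : TrivSqZeroExt K K).snd = _
  rw [TrivSqZeroExt.snd_add, TrivSqZeroExt.snd_inl, TrivSqZeroExt.snd_inr, zero_add]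

variable (M : Submonoid R) [IsLocalization M K]

lemma isUnit_derDual (d : Derivation A R R) (y : M) :
    IsUnit (derDual (K := K) d y) := by
  rw [TrivSqZeroExt.isUnit_iff_isUnit_fst]
  rw [derDual_fst]
  exact IsLocalization.map_units K y

def locDual (d : Derivation A R R) : K →+* TrivSqZeroExt K K :=
  IsLocalization.lift (M := M) (g := derDual d) (isUnit_derDual M d)

lemma locDual_algebraMap (d : Derivation A R R) (r : R) :
    locDual M d (algebraMap R K r) = derDual d r :=
  IsLocalization.lift_eq _ _

lemma fst_locDual (d : Derivation A R R) (f : K) : (locDual M d f).fst = f := by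
  have : ((TrivSqZeroExt.fstHom K K K).toRingHom.comp (locDual M d)) = RingHom.id K := by
    apply IsLocalization.ringHom_ext M
    ext r
    simp [locDual_algebraMap, derDual_fst]
  exact congrArg (fun h : K →+* K => h f) this

variable [Algebra A K] [IsScalarTower A R K]

/-- The unique extension of an `A`-derivation of `R` to a localization `K` of `R`. -/
def locDer (d : Derivation A R R) : Derivation A K K :=
  Derivation.mk'
    { toFun := fun f => (locDual M d f).snd
      map_add' := fun f g => by simp
      map_smul' := fun a f => by
        have h : (locDual M d (algebraMap A K a)).snd = 0 := by
          rw [IsScalarTower.algebraMap_apply A R K, locDual_algebraMap]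
          rw [derDual_snd]
          simp
        rw [Algebra.smul_def, map_mul, TrivSqZeroExt.snd_mul, h, fst_locDual]
        simp [Algebra.smul_def] }
    (fun f g => by
      change (locDual M d (f * g)).snd = f • (locDual M d g).snd + g • (locDual M d f).snd
      rw [map_mul, TrivSqZeroExt.snd_mul, fst_locDual, fst_locDual]
      simp [mul_comm])

lemma locDer_algebraMap (d : Derivation A R R) (r : R) :
    locDer M d (algebraMap R K r) = algebraMap R K (d r) := by
  change (locDual M d (algebraMap R K r)).snd = _
  rw [locDual_algebraMap, derDual_snd]

end LocDer

/-! ### The rings -/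

/-- `A_n = ℂ[[a_1, …, a_n]]`. -/
abbrev An (n : ℕ) : Type := MvPowerSeries (Fin n) ℂ

/-- `R_n = A_n[[z]]`. -/
abbrev Rn (n : ℕ) : Type := PowerSeries (An n)

/-- `φ_n = ∏ (z - a_i)`. -/
def phi (n : ℕ) : (An n)[X] := ∏ i : Fin n, (X - C (MvPowerSeries.X i))

/-- `K_n = A_n[[z]][φ_n⁻¹]`. -/
def Kn (n : ℕ) : Type := Localization.Away (phi n : Rn n)

namespace Kn
variable (n : ℕ)
instance : CommRing (Kn n) := inferInstanceAs (CommRing (Localization.Away (phi n : Rn n)))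
instance : Algebra (Rn n) (Kn n) :=
  inferInstanceAs (Algebra (Rn n) (Localization.Away (phi n : Rn n)))
instance : IsLocalization.Away (phi n : Rn n) (Kn n) :=
  inferInstanceAs (IsLocalization.Away (phi n : Rn n) (Localization.Away (phi n : Rn n)))
instance : Algebra (An n) (Kn n) :=
  inferInstanceAs (Algebra (An n) (Localization.Away (phi n : Rn n)))
instance : IsScalarTower (An n) (Rn n) (Kn n) :=
  inferInstanceAs (IsScalarTower (An n) (Rn n) (Localization.Away (phi n : Rn n)))
instance : Algebra ℂ (Kn n) :=
  inferInstanceAs (Algebra ℂ (Localization.Away (phi n : Rn n)))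
instance : IsScalarTower ℂ (An n) (Kn n) :=
  inferInstanceAs (IsScalarTower ℂ (An n) (Localization.Away (phi n : Rn n)))
end Kn

variable (n : ℕ)

/-- The coordinate `z`. -/
def zK : Kn n := algebraMap (Rn n) (Kn n) PowerSeries.X

/-- The image of `φ_n` in `K_n`. -/
def phiK : Kn n := algebraMap (Rn n) (Kn n) (phi n : Rn n)

/-- `∂_z` on `K_n`. -/
def dK : Derivation (An n) (Kn n) (Kn n) :=
  locDer (Submonoid.powers (phi n : Rn n)) (PowerSeries.derivative (An n))

/-! ### The residue -/

/-- The ideal `(a_1, …, a_n)` of `A_n`. -/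
def maxA : Ideal (An n) := Ideal.span (Set.range MvPowerSeries.X)

instance : IsAdicComplete (maxA n) (An n) :=
  inferInstanceAs (IsAdicComplete (Ideal.span (Set.range MvPowerSeries.X)) (MvPowerSeries _ ℂ))

lemma maxA_ne_top : maxA n ≠ ⊤ := by
  intro h
  have := h ▸ (inferInstance : IsAdicComplete (maxA n) (An n))
  exact not_subsingleton _ this.toIsHausdorff.subsingleton

lemma phi_monic : (phi n).Monic :=
  Polynomial.monic_prod_of_monic _ _ fun _ _ => Polynomial.monic_X_sub_C _

lemma phi_natDegree : (phi n).natDegree = n := by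
  rw [phi, Polynomial.natDegree_prod_of_monic _ _ fun _ _ => Polynomial.monic_X_sub_C _]
  simp

lemma phi_distinguished : (phi n).IsDistinguishedAt (maxA n) := by
  rw [phi]
  induction (Finset.univ : Finset (Fin n)) using Finset.induction_on with
  | empty =>
    rw [Finset.prod_empty]
    exact ⟨⟨fun {m} hm => by simp at hm⟩, Polynomial.monic_one⟩
  | insert i s hi ih =>
    rw [Finset.prod_insert hi]
    refine Polynomial.IsDistinguishedAt.mul ⟨⟨fun {m} hm => ?_⟩, Polynomial.monic_X_sub_C _⟩ ih
    rw [Polynomial.natDegree_X_sub_C, Nat.lt_one_iff] at hm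
    subst hm
    simp only [Polynomial.coeff_sub, Polynomial.coeff_X_zero, Polynomial.coeff_C_zero, zero_sub]
    exact (maxA n).neg_mem (Ideal.subset_span ⟨i, rfl⟩)

lemma phi_pow_distinguished (N : ℕ) : (phi n ^ N).IsDistinguishedAt (maxA n) := by
  induction N with
  | zero => exact ⟨⟨fun {m} hm => by simp at hm⟩, by simp⟩
  | succ N ih => rw [pow_succ]; exact ih.mul (phi_distinguished n)

lemma phi_pow_natDegree (N : ℕ) : (phi n ^ N).natDegree = N * n := by
  rw [(phi_monic n).natDegree_pow, phi_natDegree]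

lemma phi_weierstrass (N : ℕ) :
    ((phi n ^ N : (An n)[X]) : Rn n).IsWeierstrassDivisorAt (maxA n) :=
  (phi_pow_distinguished n N).isWeierstrassDivisorAt'

lemma phi_order (N : ℕ) : (((phi n ^ N : (An n)[X]) : Rn n).map
    (Ideal.Quotient.mk (maxA n))).order.toNat = N * n := by
  rw [← phi_pow_natDegree n N]
  have h := (phi_pow_distinguished n N).coe_natDegree_eq_order_map
    ((phi n ^ N : (An n)[X]) : Rn n) 1
    (by rw [map_one, ← Ideal.ne_top_iff_one]; exact maxA_ne_top n) (by simp)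
  rw [← h]; rfl

/-- The remainder, a polynomial of degree `< N n`, of the division of `r ∈ A_n[[z]]`
by `φ_n ^ N`. -/
def remPhi (N : ℕ) (r : Rn n) : (An n)[X] := (phi_weierstrass n N).mod r

lemma natDegree_lt_of_degree_lt {p : (An n)[X]} {m : ℕ} (hm : 0 < m)
    (h : p.degree < (m : ℕ)) : p.natDegree < m := by
  by_cases hp : p = 0
  · simpa [hp] using hm
  · exact (Polynomial.natDegree_lt_iff_degree_lt hp).2 h

lemma remPhi_degree (N : ℕ) (r : Rn n) : (remPhi n N r).degree < (N * n : ℕ) := by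
  have := ((phi_weierstrass n N).isWeierstrassDivisionAt_div_mod r).degree_lt
  rwa [phi_order] at this

lemma remPhi_spec (N : ℕ) (r : Rn n) :
    ∃ q : Rn n, r = (phi n : Rn n) ^ N * q + (remPhi n N r : Rn n) := by
  refine ⟨(phi_weierstrass n N).div r, ?_⟩
  rw [← Polynomial.coe_pow]
  exact ((phi_weierstrass n N).isWeierstrassDivisionAt_div_mod r).eq_mul_add

lemma remPhi_unique {N : ℕ} {r q : Rn n} {p : (An n)[X]} (hp : p.degree < (N * n : ℕ))
    (h : r = (phi n : Rn n) ^ N * q + p) : remPhi n N r = p := by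
  obtain ⟨q', hq'⟩ := remPhi_spec n N r
  refine ((phi_weierstrass n N).eq_of_mul_add_eq_mul_add (q := q') (q' := q) ?_ ?_ ?_).2
  · rw [phi_order]; exact remPhi_degree n N r
  · rw [phi_order]; exact hp
  · rw [Polynomial.coe_pow, ← h, ← hq']

/-- The coefficient of `z ^ (N n - 1)` in the remainder of `r` modulo `φ_n ^ N`, which is the
total residue of `r / φ_n ^ N`. -/
def resNum (N : ℕ) (r : Rn n) : An n := (remPhi n N r).coeff (N * n - 1)

lemma resNum_eq {N : ℕ} {r q : Rn n} {p : (An n)[X]} (hp : p.degree < (N * n : ℕ))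
    (h : r = (phi n : Rn n) ^ N * q + p) : resNum n N r = p.coeff (N * n - 1) := by
  rw [resNum, remPhi_unique n hp h]

lemma resNum_add (N : ℕ) (r s : Rn n) : resNum n N (r + s) = resNum n N r + resNum n N s := by
  obtain ⟨q, hq⟩ := remPhi_spec n N r
  obtain ⟨q', hq'⟩ := remPhi_spec n N s
  rw [resNum_eq n (q := q + q') (p := remPhi n N r + remPhi n N s)]
  · simp [resNum]
  · exact (Polynomial.degree_add_le _ _).trans_lt
      (max_lt (remPhi_degree n N r) (remPhi_degree n N s))
  · nth_rw 1 [hq, hq']; rw [Polynomial.coe_add]; ring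

lemma resNum_smul (N : ℕ) (a : An n) (r : Rn n) :
    resNum n N (a • r) = a * resNum n N r := by
  obtain ⟨q, hq⟩ := remPhi_spec n N r
  rw [resNum_eq n (q := a • q) (p := a • remPhi n N r)]
  · simp [resNum]
  · exact (Polynomial.degree_smul_le _ _).trans_lt (remPhi_degree n N r)
  · nth_rw 1 [hq]
    rw [smul_add, Polynomial.coe_smul, mul_smul_comm]

lemma resNum_phi_mul (N : ℕ) (r : Rn n) :
    resNum n (N + 1) ((phi n : Rn n) * r) = resNum n N r := by
  obtain ⟨q, hq⟩ := remPhi_spec n N r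
  have hd := remPhi_degree n N r
  rw [resNum_eq n (q := q) (p := phi n * remPhi n N r)]
  · rcases Nat.eq_zero_or_pos (N * n) with h0 | h0
    · have : remPhi n N r = 0 := by
        rw [← Polynomial.degree_eq_bot]
        rw [h0] at hd
        exact Nat.WithBot.lt_zero_iff.1 hd
      simp [resNum, this]
    · have e : (N + 1) * n - 1 = (phi n).natDegree + (N * n - 1) := by
        rw [phi_natDegree, add_mul]; omega
      rw [e, Polynomial.coeff_mul_add_eq_of_natDegree_le le_rfl, resNum]
      · rw [Polynomial.coeff_natDegree, (phi_monic n).leadingCoeff, one_mul]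
      · exact Nat.le_sub_one_of_lt (natDegree_lt_of_degree_lt n h0 hd)
  · rw [mul_comm, (phi_monic n).degree_mul, add_mul, one_mul, Nat.cast_add]
    refine WithBot.add_lt_add_of_lt_of_le ?_ hd ?_
    · rw [Polynomial.degree_eq_natDegree (phi_monic n).ne_zero]; exact WithBot.coe_ne_bot
    · rw [Polynomial.degree_eq_natDegree (phi_monic n).ne_zero, phi_natDegree]
  · nth_rw 1 [hq]
    rw [Polynomial.coe_mul]; ring

lemma resNum_phi_pow_mul (N M : ℕ) (r : Rn n) :
    resNum n (N + M) ((phi n : Rn n) ^ M * r) = resNum n N r := by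
  induction M with
  | zero => simp
  | succ M ih => rw [pow_succ', mul_assoc, ← add_assoc, resNum_phi_mul, ih]

lemma phi_coe_ne_zero : (phi n : Rn n) ≠ 0 := by
  rw [Ne, Polynomial.coe_eq_zero_iff]; exact (phi_monic n).ne_zero

lemma algebraMap_Kn_injective : Function.Injective (algebraMap (Rn n) (Kn n)) :=
  IsLocalization.injective (Kn n) (M := Submonoid.powers (phi n : Rn n))
    (powers_le_nonZeroDivisors_of_noZeroDivisors (phi_coe_ne_zero n))

lemma exists_num (f : Kn n) : ∃ (N : ℕ) (r : Rn n), f * phiK n ^ N = algebraMap _ _ r := by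
  obtain ⟨⟨r, y⟩, h⟩ := IsLocalization.surj (Submonoid.powers (phi n : Rn n)) f
  obtain ⟨N, hN⟩ := y.2
  refine ⟨N, r, ?_⟩
  rw [phiK, ← map_pow]
  rw [← hN] at h
  exact h

lemma isUnit_phiK : IsUnit (phiK n) :=
  IsLocalization.Away.algebraMap_isUnit (phi n : Rn n)

lemma resNum_wd {f : Kn n} {N M : ℕ} {r s : Rn n} (hr : f * phiK n ^ N = algebraMap _ _ r)
    (hs : f * phiK n ^ M = algebraMap _ _ s) : resNum n N r = resNum n M s := by
  have : (phi n : Rn n) ^ M * r = (phi n : Rn n) ^ N * s := by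
    apply algebraMap_Kn_injective n
    rw [map_mul, map_mul, ← hr, ← hs, map_pow, map_pow, phiK]; ring
  rw [← resNum_phi_pow_mul n N M r, ← resNum_phi_pow_mul n M N s, this, add_comm]

/-- The value of the residue on `f = r / φ_n ^ N`. -/
def resFun (f : Kn n) : An n := resNum n (exists_num n f).choose (exists_num n f).choose_spec.choose

lemma resFun_eq {f : Kn n} {N : ℕ} {r : Rn n} (h : f * phiK n ^ N = algebraMap _ _ r) :
    resFun n f = resNum n N r :=
  resNum_wd n (exists_num n f).choose_spec.choose_spec h

/-- The residue `∫ : K_n → A_n`, `f ↦ ∫ f dz`. It vanishes on `R_n` (`residue_Rn`), hence is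
continuous, and on `A_n[z][φ_n⁻¹]` it is the sum of the residues at the points `a_i`
(`residue_eq_sum`). -/
def residue : Kn n →ₗ[An n] An n where
  toFun := resFun n
  map_add' f g := by
    obtain ⟨N, r, hr⟩ := exists_num n f
    obtain ⟨M, s, hs⟩ := exists_num n g
    rw [resFun_eq n hr, resFun_eq n hs, ← resNum_phi_pow_mul n N M r,
      ← resNum_phi_pow_mul n M N s, add_comm M N, ← resNum_add]
    apply resFun_eq
    rw [map_add, map_mul, map_mul, ← hr, ← hs, map_pow, map_pow, phiK]; ring
  map_smul' a f := by
    obtain ⟨N, r, hr⟩ := exists_num n f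
    rw [resFun_eq n hr, RingHom.id_apply, smul_eq_mul, ← resNum_smul]
    apply resFun_eq
    rw [smul_mul_assoc, hr, Algebra.smul_def, Algebra.smul_def, map_mul,
      ← IsScalarTower.algebraMap_apply]

lemma residue_eq {f : Kn n} {N : ℕ} {r : Rn n} (h : f * phiK n ^ N = algebraMap _ _ r) :
    residue n f = resNum n N r := resFun_eq n h

lemma residue_Rn (r : Rn n) : residue n (algebraMap _ _ r) = 0 := by
  rw [residue_eq n (N := 0) (r := r) (by simp)]
  rw [resNum_eq n (q := r) (p := 0)] <;> simp

lemma dK_algebraMap (r : Rn n) :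
    dK n (algebraMap _ _ r) = algebraMap _ _ (PowerSeries.derivative (An n) r) :=
  locDer_algebraMap _ _ _

lemma residue_dK (f : Kn n) : residue n (dK n f) = 0 := by
  obtain ⟨N, r, hr⟩ := exists_num n f
  obtain ⟨q, hq⟩ := remPhi_spec n N r
  have hd := remPhi_degree n N r
  set p := remPhi n N r
  obtain ⟨g, hg⟩ : ∃ g : Kn n, g = f - algebraMap _ _ q := ⟨_, rfl⟩
  have hgp : g * phiK n ^ N = algebraMap (Rn n) _ p := by
    rw [hg, sub_mul, hr, hq, map_add, map_mul, map_pow, phiK]; ring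
  have hf : f = g + algebraMap _ _ q := by rw [hg]; ring
  rw [hf, map_add, map_add, dK_algebraMap, residue_Rn, add_zero]
  have key : dK n g * phiK n ^ (N + 1) = algebraMap (Rn n) _
      ((Polynomial.derivative p * phi n - (N : (An n)[X]) * p * Polynomial.derivative (phi n) :
        (An n)[X]) : Rn n) := by
    have h1 := congrArg (dK n) hgp
    have h2 : dK n (phiK n) = algebraMap (Rn n) _ (Polynomial.derivative (phi n) : (An n)[X]) := by
      rw [phiK, dK_algebraMap, PowerSeries.derivative_coe]
    rw [Derivation.leibniz, Derivation.leibniz_pow, dK_algebraMap, PowerSeries.derivative_coe,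
      h2] at h1
    simp only [smul_eq_mul, nsmul_eq_mul] at h1
    rw [Polynomial.coe_sub, Polynomial.coe_mul, Polynomial.coe_mul, Polynomial.coe_mul,
      map_sub, map_mul, map_mul, map_mul, ← h1, ← hgp]
    have hN : algebraMap (Rn n) (Kn n) ((N : (An n)[X]) : Rn n) = N := by
      rw [show (((N : (An n)[X]) : Rn n)) = (N : Rn n) from
        map_natCast (Polynomial.coeToPowerSeries.ringHom) N, map_natCast]
    rw [hN, show algebraMap (Rn n) (Kn n) (phi n) = phiK n from rfl]
    rcases N with _ | N
    · simp
    · simp only [Nat.add_sub_cancel]; ring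
  rw [residue_eq n key]
  have hdeg : (Polynomial.derivative p * phi n
      - (N : (An n)[X]) * p * Polynomial.derivative (phi n)).degree
        < (((N + 1) * n - 1 : ℕ) : WithBot ℕ) := by
    by_cases hp0 : p = 0
    · simp [hp0]
    have hpos : 0 < N * n := by
      by_contra h
      have : N * n = 0 := by omega
      rw [this] at hd
      exact hp0 (Polynomial.degree_eq_bot.1 (Nat.WithBot.lt_zero_iff.1 hd))
    have hn : 0 < n := Nat.pos_of_mul_pos_left hpos
    have e : (N + 1) * n - 1 = (N * n - 1) + n := by rw [add_mul]; omega
    have e' : (N + 1) * n - 1 = (N * n - 1) + 1 + (n - 1) := by rw [add_mul]; omega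
    have hd1 : p.natDegree ≤ N * n - 1 :=
      Nat.le_sub_one_of_lt (natDegree_lt_of_degree_lt n hpos hd)
    refine (Polynomial.degree_sub_le _ _).trans_lt (max_lt ?_ ?_)
    · rw [(phi_monic n).degree_mul, e, Nat.cast_add]
      refine WithBot.add_lt_add_of_lt_of_le ?_ ?_ ?_
      · rw [Polynomial.degree_eq_natDegree (phi_monic n).ne_zero]; exact WithBot.coe_ne_bot
      · exact (Polynomial.degree_derivative_lt hp0).trans_le
          (Polynomial.degree_le_of_natDegree_le hd1)
      · rw [Polynomial.degree_eq_natDegree (phi_monic n).ne_zero, phi_natDegree]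
    · have hc : ((N : (An n)[X]) * p * Polynomial.derivative (phi n)).degree
          ≤ p.degree + (Polynomial.derivative (phi n)).degree := by
        refine (Polynomial.degree_mul_le _ _).trans (add_le_add ?_ le_rfl)
        rw [← nsmul_eq_mul]
        exact Polynomial.degree_smul_le _ _
      refine hc.trans_lt ?_
      have h2 : (Polynomial.derivative (phi n)).degree < (n : WithBot ℕ) := by
        have := Polynomial.degree_derivative_lt (phi_monic n).ne_zero
        rwa [Polynomial.degree_eq_natDegree (phi_monic n).ne_zero, phi_natDegree] at this
      rw [e, Nat.cast_add]
      refine WithBot.add_lt_add_of_le_of_lt ?_ (Polynomial.degree_le_of_natDegree_le hd1) h2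
      rw [Polynomial.degree_eq_natDegree hp0]; exact WithBot.coe_ne_bot
  rw [resNum_eq n (q := 0) (p := (Polynomial.derivative p * phi n
      - (N : (An n)[X]) * p * Polynomial.derivative (phi n)))]
  · exact Polynomial.coeff_eq_zero_of_degree_lt hdeg
  · exact hdeg.trans_le (by exact_mod_cast Nat.sub_le _ _)
  · simp

section SumOfResidues

variable {F : Type*} [Field F]

/-- The Laurent expansion of a polynomial at the point `a`, in the local parameter `z - a`. -/
def laurentAt (a : F) : F[X] →+* LaurentSeries F :=
  ((HahnSeries.ofPowerSeries ℤ F).comp (Polynomial.coeToPowerSeries.ringHom)).comp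
    (Polynomial.taylorAlgHom a).toRingHom

/-- The residue at the point `a` of the meromorphic form `(p / q) dz` on the affine line. -/
def resAt (a : F) (p q : F[X]) : F := (laurentAt a p / laurentAt a q).coeff (-1)

lemma laurentAt_eq (a : F) (p : F[X]) : laurentAt a p =
    HahnSeries.ofPowerSeries ℤ F ((Polynomial.taylor a p : F[X]) : PowerSeries F) := rfl

lemma laurentAt_ne_zero (a : F) {p : F[X]} (hp : p ≠ 0) : laurentAt a p ≠ 0 := by
  rw [laurentAt_eq]
  intro h
  rw [map_eq_zero_iff _ HahnSeries.ofPowerSeries_injective, Polynomial.coe_eq_zero_iff,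
    Polynomial.taylor_eq_zero] at h
  exact hp h

lemma resAt_add (a : F) (p p' q : F[X]) : resAt a (p + p') q = resAt a p q + resAt a p' q := by
  simp [resAt, add_div]

lemma ofPowerSeries_coeff_neg_one (f : PowerSeries F) :
    (HahnSeries.ofPowerSeries ℤ F f).coeff (-1) = 0 := by
  rw [HahnSeries.ofPowerSeries_apply]
  apply HahnSeries.embDomain_of_notMem_range
  rintro ⟨m, hm⟩
  simp at hm

lemma resAt_eq_zero {a : F} (p : F[X]) {q : F[X]} (hq : q.eval a ≠ 0) : resAt a p q = 0 := by
  set Q : PowerSeries F := ((Polynomial.taylor a q : F[X]) : PowerSeries F) with hQ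
  have hu : PowerSeries.constantCoeff Q ≠ 0 := by
    rw [hQ, Polynomial.constantCoeff_coe, Polynomial.taylor_coeff_zero]; exact hq
  have h1 : Q * Q⁻¹ = 1 := PowerSeries.mul_inv_cancel _ hu
  have h2 : laurentAt a q * HahnSeries.ofPowerSeries ℤ F Q⁻¹ = 1 := by
    rw [laurentAt_eq, ← hQ, ← map_mul, h1, map_one]
  rw [resAt, div_eq_mul_inv, ← eq_inv_of_mul_eq_one_right h2, laurentAt_eq, ← map_mul,
    ofPowerSeries_coeff_neg_one]

lemma resAt_mul_cancel (a : F) (p q : F[X]) {r : F[X]} (hr : r ≠ 0) :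
    resAt a (r * p) (r * q) = resAt a p q := by
  rw [resAt, map_mul, map_mul, mul_div_mul_left _ _ (laurentAt_ne_zero a hr), resAt]

lemma resAt_C_pow_self (a c : F) (m : ℕ) :
    resAt a (C c) ((X - C a) ^ m) = if m = 1 then c else 0 := by
  have h1 : laurentAt a (X - C a) = HahnSeries.single 1 1 := by
    rw [laurentAt_eq]; simp [Polynomial.taylor_X, Polynomial.taylor_C]
  have h2 : laurentAt a (C c) = HahnSeries.C c := by
    rw [laurentAt_eq]; simp [Polynomial.taylor_C]
  rw [resAt, map_pow, h1, h2, HahnSeries.single_pow, one_pow, div_eq_mul_inv,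
    HahnSeries.inv_single, inv_one, HahnSeries.C_mul_eq_smul, HahnSeries.coeff_smul,
    HahnSeries.coeff_single]
  by_cases h : m = 1
  · simp [h]
  · have : (-1 : ℤ) ≠ -(m • (1 : ℤ)) := by
      simp; omega
    rw [if_neg this, if_neg h, smul_zero]

/-- The sum of the residues of `p / q` at the roots of `q`, when `deg p < deg q`. -/
lemma sum_resAt {ι : Type*} [DecidableEq ι] (s : Finset ι) (b : ι → F) (hb : Set.InjOn b s)
    (D : ℕ) : ∀ (m : ι → ℕ) (p : F[X]), ∑ i ∈ s, m i = D → p.degree < (D : ℕ) →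
    ∑ i ∈ s, resAt (b i) p (∏ j ∈ s, (X - C (b j)) ^ m j) = p.coeff (D - 1) := by
  induction D with
  | zero =>
    intro m p _ hp
    have : p = 0 := Polynomial.degree_eq_bot.1 (Nat.WithBot.lt_zero_iff.1 hp)
    simp [this, resAt]
  | succ D ih =>
    intro m p hm hp
    obtain ⟨i₀, hi₀, hpos⟩ : ∃ i ∈ s, 0 < m i := by
      by_contra h
      push Not at h
      rw [Finset.sum_eq_zero (fun i hi => Nat.le_zero.1 (h i hi))] at hm
      omega
    set Q₀ : F[X] := ∏ j ∈ s.erase i₀, (X - C (b j)) ^ m j with hQ₀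
    set ℓ : F[X] := X - C (b i₀) with hℓ
    have hℓ0 : ℓ ≠ 0 := Polynomial.X_sub_C_ne_zero _
    have hQm : Q₀.Monic := Polynomial.monic_prod_of_monic _ _
      fun _ _ => (Polynomial.monic_X_sub_C _).pow _
    have hq : ∏ j ∈ s, (X - C (b j)) ^ m j = ℓ ^ m i₀ * Q₀ := by
      rw [hQ₀, hℓ, Finset.mul_prod_erase s (fun j => (X - C (b j)) ^ m j) hi₀]
    have hQe : Q₀.eval (b i₀) ≠ 0 := by
      rw [hQ₀, Polynomial.eval_prod, Finset.prod_ne_zero_iff]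
      intro j hj
      simp only [Polynomial.eval_pow, Polynomial.eval_sub, Polynomial.eval_X, Polynomial.eval_C]
      refine pow_ne_zero _ (sub_ne_zero.2 fun h => ?_)
      exact (Finset.mem_erase.1 hj).1 (hb hi₀ (Finset.mem_erase.1 hj).2 h).symm
    have hQd : Q₀.natDegree = D + 1 - m i₀ := by
      rw [hQ₀, Polynomial.natDegree_prod_of_monic _ _
        fun _ _ => (Polynomial.monic_X_sub_C _).pow _]
      simp only [Polynomial.natDegree_pow, Polynomial.natDegree_X_sub_C, mul_one]
      rw [← hm, ← Finset.add_sum_erase s m hi₀]; omega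
    have hle : m i₀ ≤ D + 1 := hm ▸ Finset.single_le_sum (fun _ _ => Nat.zero_le _) hi₀
    set c : F := p.eval (b i₀) / Q₀.eval (b i₀) with hc
    obtain ⟨p₁, hp₁⟩ : ℓ ∣ p - C c * Q₀ := by
      rw [hℓ, Polynomial.dvd_iff_isRoot]
      simp [hc, hQe]
    have hpe : p = C c * Q₀ + ℓ * p₁ := by rw [← hp₁]; ring
    have hcQ : (C c * Q₀).degree < ((D + 1 : ℕ) : WithBot ℕ) := by
      rw [← Polynomial.smul_eq_C_mul]
      refine (Polynomial.degree_smul_le _ _).trans_lt ?_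
      rw [Polynomial.degree_eq_natDegree hQm.ne_zero, hQd]
      exact_mod_cast (by omega)
    have hd₁ : p₁.degree < (D : WithBot ℕ) := by
      have h : (ℓ * p₁).degree < ((D + 1 : ℕ) : WithBot ℕ) := by
        rw [← hp₁]
        exact (Polynomial.degree_sub_le _ _).trans_lt (max_lt hp hcQ)
      by_cases h0 : p₁ = 0
      · rw [h0, Polynomial.degree_zero]; exact WithBot.bot_lt_coe _
      rw [Polynomial.degree_mul, hℓ, Polynomial.degree_X_sub_C,
        Polynomial.degree_eq_natDegree h0] at h
      rw [Polynomial.degree_eq_natDegree h0]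
      have h' : ((1 + p₁.natDegree : ℕ) : WithBot ℕ) < ((D + 1 : ℕ) : WithBot ℕ) := by
        exact_mod_cast h
      have := WithBot.coe_lt_coe.1 h'
      simp only [Nat.cast_id] at this
      exact_mod_cast (by omega : p₁.natDegree < D)
    set m' : ι → ℕ := Function.update m i₀ (m i₀ - 1) with hm'
    have hq' : ∏ j ∈ s, (X - C (b j)) ^ m j = ℓ * ∏ j ∈ s, (X - C (b j)) ^ m' j := by
      rw [hq, ← Finset.mul_prod_erase s (fun j => (X - C (b j)) ^ m' j) hi₀,
        Finset.prod_congr rfl (g := fun j => (X - C (b j)) ^ m j)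
          (fun j hj => by simp [hm', Function.update_of_ne (Finset.mem_erase.1 hj).1])]
      rw [hm', Function.update_self, ← hQ₀, ← mul_assoc, ← hℓ, ← pow_succ',
        Nat.sub_add_cancel hpos]
    have hs' : ∑ i ∈ s, m' i = D := by
      rw [← Finset.add_sum_erase s m' hi₀, Finset.sum_congr rfl (g := m)
          (fun j hj => by simp [hm', Function.update_of_ne (Finset.mem_erase.1 hj).1])]
      have h := (Finset.add_sum_erase s m hi₀).trans hm
      rw [hm', Function.update_self]
      change m i₀ - 1 + ∑ x ∈ s.erase i₀, m x = D
      omega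
    have e1 : ∀ i ∈ s, resAt (b i) p (∏ j ∈ s, (X - C (b j)) ^ m j)
        = (if i = i₀ then (if m i₀ = 1 then c else 0) else 0)
          + resAt (b i) p₁ (∏ j ∈ s, (X - C (b j)) ^ m' j) := by
      intro i hi
      nth_rw 1 [hpe]
      rw [resAt_add]
      congr 1
      · rw [hq, mul_comm (C c), mul_comm (ℓ ^ _), resAt_mul_cancel _ _ _ hQm.ne_zero]
        split_ifs with h h1
        · rw [h, hℓ, resAt_C_pow_self, if_pos h1]
        · rw [h, hℓ, resAt_C_pow_self, if_neg h1]
        · apply resAt_eq_zero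
          rw [hℓ]
          simp only [Polynomial.eval_pow, Polynomial.eval_sub, Polynomial.eval_X,
            Polynomial.eval_C]
          exact pow_ne_zero _ (sub_ne_zero.2 fun h' => h (hb hi hi₀ h'))
      · rw [hq', resAt_mul_cancel _ _ _ hℓ0]
    rw [Finset.sum_congr rfl e1, Finset.sum_add_distrib, ih m' p₁ hs' hd₁,
      Finset.sum_ite_eq' s i₀, if_pos hi₀]
    conv_rhs => rw [hpe]
    rw [Nat.add_sub_cancel, Polynomial.coeff_add, Polynomial.coeff_C_mul]
    congr 1
    · split_ifs with h1
      · have : D = Q₀.natDegree := by omega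
        rw [this, Polynomial.coeff_natDegree, hQm.leadingCoeff, mul_one]
      · rw [Polynomial.coeff_eq_zero_of_natDegree_lt (by omega), mul_zero]
    · rw [hℓ, sub_mul, Polynomial.coeff_sub, Polynomial.coeff_C_mul,
        Polynomial.coeff_eq_zero_of_degree_lt hd₁, mul_zero, sub_zero]
      rcases D with _ | D
      · have : p₁ = 0 := Polynomial.degree_eq_bot.1 (Nat.WithBot.lt_zero_iff.1 hd₁)
        simp [this]
      · rw [Nat.add_sub_cancel, Polynomial.coeff_X_mul]

end SumOfResidues

/-- On `A_n[z][φ_n⁻¹]` the map `residue` is the sum of the residues at the points `a_i`, computed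
over the fraction field of `A_n`. -/
theorem residue_eq_sum (p : (An n)[X]) (N : ℕ) (f : Kn n)
    (hf : f * phiK n ^ N = algebraMap (Rn n) (Kn n) p) :
    algebraMap (An n) (FractionRing (An n)) (residue n f) =
      ∑ i : Fin n, resAt (algebraMap (An n) (FractionRing (An n)) (MvPowerSeries.X i))
        (p.map (algebraMap _ _)) ((phi n ^ N).map (algebraMap _ _)) := by
  classical
  set α := algebraMap (An n) (FractionRing (An n)) with hα
  set b : Fin n → FractionRing (An n) := fun i => α (MvPowerSeries.X i)
  have hb : Function.Injective b := by
    intro i j h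
    exact MvPowerSeries.X_inj.1 (IsFractionRing.injective (An n) _ h)
  have hmap : (phi n ^ N).map α = ∏ j : Fin n, (X - C (b j)) ^ N := by
    rw [phi, Polynomial.map_pow, Polynomial.map_prod, Finset.prod_pow]
    simp [b]
  have hmon : (phi n ^ N).Monic := (phi_monic n).pow N
  have hdeg : (p %ₘ (phi n ^ N)).degree < (N * n : ℕ) := by
    have := Polynomial.degree_modByMonic_lt p hmon
    rwa [Polynomial.degree_eq_natDegree hmon.ne_zero, phi_pow_natDegree] at this
  have hp := (Polynomial.modByMonic_add_div p (phi n ^ N)).symm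
  rw [residue_eq n hf, resNum_eq n (q := ((p /ₘ (phi n ^ N) : (An n)[X]) : Rn n)) hdeg
    (by nth_rw 1 [hp]; rw [Polynomial.coe_add, Polynomial.coe_mul, Polynomial.coe_pow, add_comm])]
  have key := sum_resAt Finset.univ b hb.injOn (N * n) (fun _ => N)
    ((p %ₘ (phi n ^ N)).map α) (by simp [mul_comm])
    ((Polynomial.degree_map_le).trans_lt hdeg)
  rw [Polynomial.coeff_map] at key
  rw [← key, hmap]
  refine Finset.sum_congr rfl fun i _ => ?_
  nth_rw 2 [hp]
  rw [Polynomial.map_add, resAt_add, Polynomial.map_mul, hmap]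
  have hne : ∏ j : Fin n, (X - C (b j)) ^ N ≠ 0 := by
    rw [← hmap]; exact (hmon.map α).ne_zero
  have h0 : resAt (b i) ((∏ j : Fin n, (X - C (b j)) ^ N) * (p /ₘ (phi n ^ N)).map α)
      (∏ j : Fin n, (X - C (b j)) ^ N) = 0 := by
    nth_rw 2 [← mul_one (∏ j : Fin n, (X - C (b j)) ^ N)]
    rw [resAt_mul_cancel _ _ _ hne]
    exact resAt_eq_zero _ (by simp)
  rw [h0, add_zero]

/-- A derivation `d` of the `A`-algebra `K`, together with an `A`-linear functional
`res : K → A`, `f ↦ ∫ f dz`, that vanishes on derivatives. -/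
structure ResidueData (A K : Type*) [CommRing A] [CommRing K] [Algebra A K] where
  d : Derivation A K K
  res : K →ₗ[A] A
  res_d : ∀ f, res (d f) = 0

lemma res_antisymm {A K : Type*} [CommRing A] [CommRing K] [Algebra A K] (D : ResidueData A K)
    (f h : K) : D.res (h * D.d f) = - D.res (f * D.d h) := by
  have := D.res_d (f * h)
  rw [Derivation.leibniz, map_add, smul_eq_mul, smul_eq_mul] at this
  linear_combination this

/-- `∂_z` and the residue on `K_n`. -/
def dataKn : ResidueData (An n) (Kn n) := ⟨dK n, residue n, residue_dK n⟩

/-- `ℂ((t))`. -/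
def Lt : Type := LaurentSeries ℂ

namespace Lt
instance : CommRing Lt := inferInstanceAs (CommRing (LaurentSeries ℂ))
instance : Algebra (PowerSeries ℂ) Lt := inferInstanceAs (Algebra (PowerSeries ℂ) (LaurentSeries ℂ))
instance : Algebra ℂ Lt := inferInstanceAs (Algebra ℂ (LaurentSeries ℂ))
instance : IsScalarTower ℂ (PowerSeries ℂ) Lt := IsScalarTower.of_algebraMap_eq fun _ => rfl
instance : IsLocalization (Submonoid.powers (PowerSeries.X : PowerSeries ℂ)) Lt :=
  inferInstanceAs (IsLocalization (Submonoid.powers (PowerSeries.X : PowerSeries ℂ))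
    (LaurentSeries ℂ))

/-- The identity, from Mathlib's Laurent series. -/
def of : LaurentSeries ℂ ≃+* Lt := RingEquiv.refl _

/-- `t ^ m`. -/
def tpow (m : ℤ) : Lt := of (HahnSeries.single m 1)

/-- The coefficient of `t ^ m`. -/
def coeff (m : ℤ) (f : Lt) : ℂ := (of.symm f).coeff m

lemma coeff_smul (m : ℤ) (c : ℂ) (f : Lt) : coeff m (c • f) = c * coeff m f := by
  have h : algebraMap ℂ Lt c = of (HahnSeries.C c) := by
    rw [IsScalarTower.algebraMap_apply ℂ (PowerSeries ℂ) Lt]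
    exact HahnSeries.ofPowerSeries_C c
  rw [Algebra.smul_def, h, coeff, map_mul, RingEquiv.symm_apply_apply, HahnSeries.C_mul_eq_smul,
    HahnSeries.coeff_smul, smul_eq_mul, coeff]

lemma coeff_mul_tpow (m j : ℤ) (f : Lt) : coeff (m + j) (f * tpow j) = coeff m f := by
  rw [coeff, map_mul, tpow, RingEquiv.symm_apply_apply, HahnSeries.coeff_mul_single_add, mul_one,
    coeff]

lemma coeff_add (m : ℤ) (f h : Lt) : coeff m (f + h) = coeff m f + coeff m h := rfl

lemma coeff_algebraMap (m : ℕ) (r : PowerSeries ℂ) :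
    coeff m (algebraMap (PowerSeries ℂ) Lt r) = PowerSeries.coeff m r :=
  LaurentSeries.coeff_coe_powerSeries r m

lemma tpow_natCast (m : ℕ) : tpow m = algebraMap (PowerSeries ℂ) Lt (PowerSeries.X ^ m) :=
  (HahnSeries.ofPowerSeries_X_pow m).symm

end Lt

/-- `∂_t` on `ℂ((t))`. -/
def dLaurent : Derivation ℂ Lt Lt :=
  locDer (Submonoid.powers (PowerSeries.X : PowerSeries ℂ)) (PowerSeries.derivative ℂ)

/-- The coefficient of `t⁻¹`. -/
def resLaurent : Lt →ₗ[ℂ] ℂ where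
  toFun f := Lt.coeff (-1) f
  map_add' := Lt.coeff_add (-1)
  map_smul' := Lt.coeff_smul (-1)

lemma resLaurent_apply (f : Lt) : resLaurent f = Lt.coeff (-1) f := rfl

lemma resLaurent_dLaurent (f : Lt) : resLaurent (dLaurent f) = 0 := by
  obtain ⟨⟨r, y⟩, h⟩ := IsLocalization.surj (Submonoid.powers (PowerSeries.X : PowerSeries ℂ)) f
  obtain ⟨N, hN⟩ := y.2
  simp only at h hN
  rw [← hN] at h
  have h1 := congrArg dLaurent h
  have hd : ∀ s : PowerSeries ℂ, dLaurent (algebraMap _ _ s) =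
      algebraMap _ _ (PowerSeries.derivative ℂ s) := fun s => locDer_algebraMap _ _ _
  rw [Derivation.leibniz, hd, hd, Derivation.leibniz_pow, PowerSeries.derivative_X] at h1
  have key : dLaurent f * Lt.tpow ((N + 1 : ℕ) : ℤ) = algebraMap (PowerSeries ℂ) Lt
      (PowerSeries.derivative ℂ r * PowerSeries.X - (N : PowerSeries ℂ) * r) := by
    rw [Lt.tpow_natCast, map_sub, map_mul, ← h1, map_mul, ← h]
    rcases N with _ | N
    · simp
    · simp only [smul_eq_mul, nsmul_eq_mul, mul_one, map_mul, map_pow, Nat.add_sub_cancel,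
        map_natCast]
      ring
  rw [resLaurent_apply, ← Lt.coeff_mul_tpow (-1) ((N + 1 : ℕ) : ℤ), key,
    show (-1 : ℤ) + ((N + 1 : ℕ) : ℤ) = (N : ℕ) by push_cast; ring, Lt.coeff_algebraMap, map_sub,
    ← nsmul_eq_mul, map_nsmul]
  rcases N with _ | N
  · simp
  · rw [PowerSeries.coeff_succ_mul_X, PowerSeries.coeff_derivative]
    simp; ring

/-- `∂_t` and the residue on `ℂ((t))`. -/
def dataLaurent : ResidueData ℂ Lt := ⟨dLaurent, resLaurent, resLaurent_dLaurent⟩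

section Affine

attribute [local instance 100] LieRing.ofAssociativeRing

variable {A K : Type*} [CommRing A] [CommRing K] [Algebra A K] [Algebra ℂ A] [Algebra ℂ K]
  [IsScalarTower ℂ A K] (D : ResidueData A K)
  (g : Type*) [LieRing g] [LieAlgebra ℂ g] (k : ℂ)

/-- The pairing `(f, h) ↦ ∫ h df`. -/
def ResidueData.pairing : K →ₗ[ℂ] K →ₗ[ℂ] A :=
  LinearMap.mk₂ ℂ (fun f h => D.res (h * D.d f))
    (fun f f' h => by simp [mul_add]) (fun c f h => by
      rw [← algebraMap_smul A c f, Derivation.map_smul, mul_smul_comm, map_smul,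
        algebraMap_smul])
    (fun f h h' => by simp [add_mul]) (fun c f h => by
      rw [← algebraMap_smul A c h, smul_mul_assoc, map_smul, algebraMap_smul])

/-- The form `κ = k κ_g`, a multiple of the Killing form. -/
def levelForm : LinearMap.BilinForm ℂ g := k • killingForm ℂ g

/-- The cocycle `(f ⊗ X, h ⊗ Y) ↦ κ(X, Y) ∫ h df` on `K ⊗ g`. -/
def cocycle : (K ⊗[ℂ] g) →ₗ[ℂ] (K ⊗[ℂ] g) →ₗ[ℂ] A :=
  (TensorProduct.map₂ D.pairing (levelForm g k)).compr₂ (TensorProduct.rid ℂ A).toLinearMap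

@[simp] lemma cocycle_tmul (f h : K) (x y : g) :
    cocycle D g k (f ⊗ₜ x) (h ⊗ₜ y) = levelForm g k x y • D.res (h * D.d f) := by
  simp [cocycle, ResidueData.pairing]

lemma levelForm_symm (x y : g) : levelForm g k x y = levelForm g k y x := by
  simp [levelForm, LieModule.traceForm_comm ℂ g g x y, killingForm]

lemma levelForm_inv (x y z : g) : levelForm g k ⁅x, y⁆ z = levelForm g k x ⁅y, z⁆ := by
  simp [levelForm, killingForm, LieModule.traceForm_apply_lie_apply]

lemma cocycle_antisymm (u v : K ⊗[ℂ] g) : cocycle D g k u v = - cocycle D g k v u := by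
  induction u with
  | zero => simp
  | add u u' hu hu' => simp [hu, hu']; abel
  | tmul f x =>
    induction v with
    | zero => simp
    | add v v' hv hv' => simp [hv, hv']; abel
    | tmul h y => rw [cocycle_tmul, cocycle_tmul, res_antisymm, levelForm_symm, smul_neg]

lemma cocycle_self (u : K ⊗[ℂ] g) : cocycle D g k u u = 0 := by
  have h := cocycle_antisymm D g k u u
  have h2 : (2 : ℂ) • cocycle D g k u u = 0 := by
    rw [two_smul]; nth_rw 1 [h]; simp
  have := congrArg (fun a => (2⁻¹ : ℂ) • a) h2
  simpa [smul_smul] using this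

lemma cocycle_jacobi (u v w : K ⊗[ℂ] g) : cocycle D g k u ⁅v, w⁆ =
    cocycle D g k ⁅u, v⁆ w + cocycle D g k v ⁅u, w⁆ := by
  induction u with
  | zero => simp
  | add u u' hu hu' => simp only [map_add, LinearMap.add_apply, add_lie, hu, hu']; abel
  | tmul f x =>
    induction v with
    | zero => simp
    | add v v' hv hv' => simp only [map_add, LinearMap.add_apply, add_lie, lie_add, hv, hv']; abel
    | tmul h y =>
      induction w with
      | zero => simp
      | add w w' hw hw' => simp only [map_add, lie_add, hw, hw']; abel
      | tmul p z =>
        have hk : levelForm g k y ⁅x, z⁆ = - levelForm g k x ⁅y, z⁆ := by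
          rw [levelForm_symm, levelForm_inv, ← lie_skew y z, map_neg, neg_neg]
        rw [LieAlgebra.ExtendScalars.bracket_tmul, LieAlgebra.ExtendScalars.bracket_tmul,
          LieAlgebra.ExtendScalars.bracket_tmul, cocycle_tmul, cocycle_tmul, cocycle_tmul,
          levelForm_inv, hk, neg_smul, ← sub_eq_add_neg, ← smul_sub]
        congr 1
        have e : p * D.d (f * h) - f * p * D.d h = h * p * D.d f := by
          rw [Derivation.leibniz]; simp only [smul_eq_mul]; ring
        rw [← map_sub, e]

lemma cocycle_smul_right (a : A) (u v : K ⊗[ℂ] g) :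
    cocycle D g k u (a • v) = a • cocycle D g k u v := by
  induction u with
  | zero => simp
  | add u u' hu hu' => simp only [map_add, LinearMap.add_apply, smul_add, hu, hu']
  | tmul f x =>
    induction v with
    | zero => simp
    | add v v' hv hv' => simp only [smul_add, map_add, hv, hv']
    | tmul h y =>
      rw [TensorProduct.smul_tmul', cocycle_tmul, cocycle_tmul, smul_mul_assoc, map_smul,
        smul_comm]

lemma lie_smul_current (a : A) (u v : K ⊗[ℂ] g) : ⁅u, a • v⁆ = a • ⁅u, v⁆ := by
  rw [← algebraMap_smul K a v, lie_smul, algebraMap_smul]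

/-- The affine Lie algebra `(K ⊗ g) ⊕ A 𝟏` of level `k` attached to `(K, ∫)`. -/
def AffLie (_D : ResidueData A K) (g : Type*) [LieRing g] [LieAlgebra ℂ g] (_k : ℂ) : Type _ :=
  (K ⊗[ℂ] g) × A

instance : AddCommGroup (AffLie D g k) := inferInstanceAs (AddCommGroup ((K ⊗[ℂ] g) × A))
instance : Module A (AffLie D g k) := inferInstanceAs (Module A ((K ⊗[ℂ] g) × A))

/-- The bracket `[f X, h Y] = f h [X, Y] + κ(X, Y) (∫ h df) 𝟏`, with `𝟏` central. -/
instance : LieRing (AffLie D g k) where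
  bracket u v := (⁅u.1, v.1⁆, cocycle D g k u.1 v.1)
  add_lie u v w := Prod.ext (add_lie u.1 v.1 w.1)
    (by change cocycle D g k (u.1 + v.1) w.1 = _; rw [map_add]; rfl)
  lie_add u v w := Prod.ext (lie_add u.1 v.1 w.1)
    (by change cocycle D g k u.1 (v.1 + w.1) = _; rw [map_add]; rfl)
  lie_self u := Prod.ext (lie_self u.1) (cocycle_self D g k u.1)
  leibniz_lie u v w := Prod.ext (leibniz_lie u.1 v.1 w.1) (cocycle_jacobi D g k u.1 v.1 w.1)

instance : LieAlgebra A (AffLie D g k) where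
  lie_smul a u v := Prod.ext (lie_smul_current g a u.1 v.1)
    (cocycle_smul_right D g k a u.1 v.1)

/-- The element `X f` of the affine Lie algebra. -/
def cur (x : g) (f : K) : AffLie D g k := (f ⊗ₜ[ℂ] x, 0)

/-- The central element `𝟏`. -/
def centralOne : AffLie D g k := (0, 1)

/-- The relation `𝟏 = 1` in the enveloping algebra. -/
inductive OneRel : UniversalEnvelopingAlgebra A (AffLie D g k) →
    UniversalEnvelopingAlgebra A (AffLie D g k) → Prop
  | one : OneRel (UniversalEnvelopingAlgebra.ι A (centralOne D g k)) 1

/-- `U'_k = U(ĝ) / (𝟏 - 1)`, the enveloping algebra being taken over `A`. -/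
def UPrime : Type _ := RingQuot (OneRel D g k)

instance : Ring (UPrime D g k) := inferInstanceAs (Ring (RingQuot (OneRel D g k)))
instance : Algebra A (UPrime D g k) := inferInstanceAs (Algebra A (RingQuot (OneRel D g k)))

/-- The canonical `A`-linear map `ĝ → U'_k`. -/
def toU : AffLie D g k →ₗ[A] UPrime D g k :=
  (RingQuot.mkAlgHom A (OneRel D g k)).toLinearMap ∘ₗ
    (UniversalEnvelopingAlgebra.ι A : AffLie D g k →ₗ⁅A⁆ _).toLinearMap

/-- The image of `X f` in `U'_k`. -/
def curU (x : g) (f : K) : UPrime D g k := toU D g k (cur D g k x f)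

lemma toU_lie (u v : AffLie D g k) :
    toU D g k ⁅u, v⁆ = toU D g k u * toU D g k v - toU D g k v * toU D g k u := by
  change RingQuot.mkAlgHom A (OneRel D g k) (UniversalEnvelopingAlgebra.ι A ⁅u, v⁆) = _
  rw [LieHom.map_lie, LieRing.of_associative_ring_bracket, map_sub, map_mul, map_mul]
  rfl

lemma toU_centralOne : toU D g k (centralOne D g k) = 1 := by
  change RingQuot.mkAlgHom A (OneRel D g k) (UniversalEnvelopingAlgebra.ι A (centralOne D g k)) = 1
  rw [RingQuot.mkAlgHom_rel A OneRel.one, map_one]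

lemma curU_mul_curU (x y : g) (f h : K) :
    curU D g k x f * curU D g k y h = curU D g k y h * curU D g k x f + curU D g k ⁅x, y⁆ (f * h)
      + algebraMap A _ (levelForm g k x y • D.res (h * D.d f)) := by
  have h1 := toU_lie D g k (cur D g k x f) (cur D g k y h)
  have h2 : ⁅cur D g k x f, cur D g k y h⁆ = cur D g k ⁅x, y⁆ (f * h) +
      (levelForm g k x y • D.res (h * D.d f)) • centralOne D g k := by
    refine Prod.ext ?_ ?_
    · change ⁅f ⊗ₜ[ℂ] x, h ⊗ₜ[ℂ] y⁆ = (f * h) ⊗ₜ[ℂ] ⁅x, y⁆ + _ • (0 : K ⊗[ℂ] g)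
      simp
    · change cocycle D g k (f ⊗ₜ[ℂ] x) (h ⊗ₜ[ℂ] y) = 0 + (levelForm g k x y • D.res (h * D.d f)) • (1 : A)
      simp
  rw [h2, map_add, map_smul, toU_centralOne, ← Algebra.algebraMap_eq_smul_one] at h1
  change curU D g k ⁅x, y⁆ (f * h) + _ = curU D g k x f * curU D g k y h
    - curU D g k y h * curU D g k x f at h1
  rw [add_assoc, h1]; abel

/-- Induction principle: `U'_k` is generated by the `X f` over `A`. -/
lemma UPrime.induction {P : UPrime D g k → Prop} (hC : ∀ a : A, P (algebraMap A _ a))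
    (hcur : ∀ x f, P (curU D g k x f)) (hadd : ∀ u v, P u → P v → P (u + v))
    (hmul : ∀ u v, P u → P v → P (u * v)) (u : UPrime D g k) : P u := by
  obtain ⟨u, rfl⟩ := RingQuot.mkAlgHom_surjective A (OneRel D g k) u
  obtain ⟨u, rfl⟩ : ∃ t, UniversalEnvelopingAlgebra.mkAlgHom A (AffLie D g k) t = u :=
    RingCon.mkₐ_surjective _ _
  induction u using TensorAlgebra.induction with
  | algebraMap a =>
    rw [AlgHom.commutes, AlgHom.commutes]; exact hC a
  | ι u =>
    change P (toU D g k u)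
    have hu : u = (show AffLie D g k from (u.1, 0)) + u.2 • centralOne D g k := by
      refine Prod.ext ?_ ?_
      · change u.1 = u.1 + u.2 • (0 : K ⊗[ℂ] g); simp
      · change u.2 = 0 + u.2 • (1 : A); simp
    rw [hu, map_add, map_smul, toU_centralOne, ← Algebra.algebraMap_eq_smul_one]
    refine hadd _ _ ?_ (hC _)
    generalize u.1 = t
    induction t with
    | zero =>
      have := hC 0
      rw [map_zero] at this
      have e : toU D g k (show AffLie D g k from (0, 0)) = 0 := map_zero (toU D g k)
      rw [e]; exact this
    | tmul f x => exact hcur x f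
    | add s t hs ht =>
      have e : (show AffLie D g k from (s + t, 0)) =
          (show AffLie D g k from (s, 0)) + (show AffLie D g k from (t, 0)) := by
        refine Prod.ext rfl ?_
        change (0 : A) = 0 + 0; simp
      rw [e, map_add]; exact hadd _ _ hs ht
  | mul a b ha hb => rw [map_mul, map_mul]; exact hmul _ _ ha hb
  | add a b ha hb => rw [map_add, map_add]; exact hadd _ _ ha hb

end Affine

/-! ### The topology of `K_n` -/

/-- The neighbourhood `φ_n ^ N R_n` of `0` in `K_n`. -/
def Jn (N : ℕ) : Submodule (An n) (Kn n) where
  carrier := {f | ∃ r : Rn n, f = phiK n ^ N * algebraMap (Rn n) (Kn n) r}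
  add_mem' := by
    rintro _ _ ⟨r, rfl⟩ ⟨s, rfl⟩
    exact ⟨r + s, by rw [map_add, mul_add]⟩
  zero_mem' := ⟨0, by simp⟩
  smul_mem' := by
    rintro a _ ⟨r, rfl⟩
    refine ⟨a • r, ?_⟩
    rw [Algebra.smul_def a r, map_mul, ← IsScalarTower.algebraMap_apply, Algebra.smul_def]
    ring

lemma mem_Jn {N : ℕ} {f : Kn n} :
    f ∈ Jn n N ↔ ∃ r : Rn n, f = phiK n ^ N * algebraMap (Rn n) (Kn n) r := Iff.rfl

lemma Jn_anti {N M : ℕ} (h : N ≤ M) : Jn n M ≤ Jn n N := by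
  rintro _ ⟨r, rfl⟩
  refine ⟨(phi n : Rn n) ^ (M - N) * r, ?_⟩
  rw [map_mul, map_pow, ← mul_assoc]
  change _ = phiK n ^ N * phiK n ^ (M - N) * _
  rw [← pow_add, Nat.add_sub_cancel' h]

lemma Jn_mul {N : ℕ} {f h : Kn n} (hf : f ∈ Jn n N) (hh : h ∈ Jn n N) : f * h ∈ Jn n N := by
  obtain ⟨r, rfl⟩ := hf
  obtain ⟨s, rfl⟩ := hh
  refine ⟨r * (phi n : Rn n) ^ N * s, ?_⟩
  rw [map_mul, map_mul, map_pow, phiK]; ring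

lemma Jn_left (f : Kn n) (N : ℕ) : ∃ M, ∀ h ∈ Jn n M, f * h ∈ Jn n N := by
  obtain ⟨m, r, hr⟩ := exists_num n f
  refine ⟨N + m, ?_⟩
  rintro _ ⟨s, rfl⟩
  refine ⟨r * s, ?_⟩
  rw [map_mul, ← hr, pow_add]; ring

lemma Jn_dK {N : ℕ} {f : Kn n} (hf : f ∈ Jn n (N + 1)) : dK n f ∈ Jn n N := by
  obtain ⟨r, rfl⟩ := hf
  refine ⟨((N + 1 : ℕ) : Rn n) * PowerSeries.derivative (An n) (phi n : Rn n) * r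
    + (phi n : Rn n) * PowerSeries.derivative (An n) r, ?_⟩
  rw [phiK, ← map_pow, ← map_mul, dK_algebraMap, Derivation.leibniz, Derivation.leibniz_pow,
    ← map_pow, ← map_mul]
  congr 1
  simp only [smul_eq_mul, nsmul_eq_mul, Nat.add_sub_cancel]
  ring

lemma Jn_basis : RingSubgroupsBasis fun N => (Jn n N).toAddSubgroup :=
  RingSubgroupsBasis.of_comm _
    (fun i j => ⟨max i j, le_inf (Jn_anti n (le_max_left _ _)) (Jn_anti n (le_max_right _ _))⟩)
    (fun i => ⟨i, by rintro _ ⟨f, hf, h, hh, rfl⟩; exact Jn_mul n hf hh⟩)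
    (fun f i => (Jn_left n f i).imp fun M hM h hh => hM h hh)

instance : TopologicalSpace (Kn n) := (Jn_basis n).topology
instance : IsTopologicalRing (Kn n) := (Jn_basis n).toRingFilterBasis.isTopologicalRing

lemma Kn_nhds : (nhds (0 : Kn n)).HasBasis (fun _ : ℕ => True) fun N => (Jn n N : Set (Kn n)) :=
  (Jn_basis n).hasBasis_nhds_zero

/-! ### Completed tensor products -/

/-- `K_n ⊗ K_n` (over `A_n`), to be endowed with the `1`-topology (`i = 0`) or the `2`-topology
(`i = 1`). -/
def KK (_i : Fin 2) : Type := Kn n ⊗[An n] Kn n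

variable (i : Fin 2)

instance : CommRing (KK n i) := inferInstanceAs (CommRing (Kn n ⊗[An n] Kn n))
instance : Algebra (An n) (KK n i) := inferInstanceAs (Algebra (An n) (Kn n ⊗[An n] Kn n))

/-- The element `f ⊗ h`. -/
def KK.tmul (f h : Kn n) : KK n i := (f ⊗ₜ[An n] h : Kn n ⊗[An n] Kn n)

/-- The neighbourhood `φ_n ^ N R_n ⊗ K_n` (`i = 0`) or `K_n ⊗ φ_n ^ N R_n` (`i = 1`) of `0`. -/
def KKnhd (N : ℕ) : Submodule (An n) (KK n i) :=
  Submodule.span (An n) {x | ∃ f : Fin 2 → Kn n, f i ∈ Jn n N ∧ x = KK.tmul n i (f 0) (f 1)}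

lemma KKnhd_anti {N M : ℕ} (h : N ≤ M) : KKnhd n i M ≤ KKnhd n i N :=
  Submodule.span_mono fun _ ⟨f, hf, e⟩ => ⟨f, Jn_anti n h hf, e⟩

lemma KK_tmul_mul (a b c d : Kn n) :
    KK.tmul n i a b * KK.tmul n i c d = KK.tmul n i (a * c) (b * d) :=
  Algebra.TensorProduct.tmul_mul_tmul _ _ _ _

lemma KK.induction {P : KK n i → Prop} (h0 : P 0) (ht : ∀ a b, P (KK.tmul n i a b))
    (ha : ∀ x y, P x → P y → P (x + y)) (x : KK n i) : P x :=
  TensorProduct.induction_on (motive := P) x h0 ht ha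

lemma KKnhd_mul {N : ℕ} {x y : KK n i} (hx : x ∈ KKnhd n i N) (hy : y ∈ KKnhd n i N) :
    x * y ∈ KKnhd n i N := by
  induction hx using Submodule.span_induction with
  | zero => rw [zero_mul]; exact zero_mem _
  | add x x' _ _ h h' => rw [add_mul]; exact add_mem h h'
  | smul a x _ h => rw [smul_mul_assoc]; exact Submodule.smul_mem _ _ h
  | mem x hx =>
    obtain ⟨f, hf, rfl⟩ := hx
    induction hy using Submodule.span_induction with
    | zero => rw [mul_zero]; exact zero_mem _
    | add x x' _ _ h h' => rw [mul_add]; exact add_mem h h'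
    | smul a x _ h => rw [mul_smul_comm]; exact Submodule.smul_mem _ _ h
    | mem y hy =>
      obtain ⟨h, hh, rfl⟩ := hy
      rw [KK_tmul_mul]
      exact Submodule.subset_span ⟨f * h, Jn_mul n hf hh, rfl⟩

lemma KKnhd_left (x : KK n i) (N : ℕ) : ∃ M, ∀ y ∈ KKnhd n i M, x * y ∈ KKnhd n i N := by
  induction x using KK.induction with
  | h0 =>
    refine ⟨0, fun y _ => ?_⟩
    rw [zero_mul]; exact zero_mem _
  | ha x x' h h' =>
    obtain ⟨M, hM⟩ := h
    obtain ⟨M', hM'⟩ := h'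
    refine ⟨max M M', fun y hy => ?_⟩
    rw [add_mul]
    exact add_mem (hM y (KKnhd_anti n i (le_max_left _ _) hy))
      (hM' y (KKnhd_anti n i (le_max_right _ _) hy))
  | ht a b =>
    obtain ⟨M, hM⟩ := Jn_left n ((![a, b] : Fin 2 → Kn n) i) N
    refine ⟨M, fun y hy => ?_⟩
    induction hy using Submodule.span_induction with
    | zero => rw [mul_zero]; exact zero_mem _
    | add x x' _ _ h h' => rw [mul_add]; exact add_mem h h'
    | smul a x _ h => rw [mul_smul_comm]; exact Submodule.smul_mem _ _ h
    | mem y hy =>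
      obtain ⟨f, hf, rfl⟩ := hy
      rw [KK_tmul_mul]
      exact Submodule.subset_span ⟨![a, b] * f, hM _ hf, rfl⟩

lemma KK_basis : RingSubgroupsBasis fun N => (KKnhd n i N).toAddSubgroup :=
  RingSubgroupsBasis.of_comm _
    (fun a b => ⟨max a b, le_inf (KKnhd_anti n i (le_max_left _ _))
      (KKnhd_anti n i (le_max_right _ _))⟩)
    (fun N => ⟨N, by rintro _ ⟨f, hf, h, hh, rfl⟩; exact KKnhd_mul n i hf hh⟩)
    (fun f N => (KKnhd_left n i f N).imp fun M hM h hh => hM h hh)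

instance : TopologicalSpace (KK n i) := (KK_basis n i).topology
instance : IsTopologicalRing (KK n i) := (KK_basis n i).toRingFilterBasis.isTopologicalRing
instance : UniformSpace (KK n i) := IsTopologicalAddGroup.rightUniformSpace _
instance : IsUniformAddGroup (KK n i) := isUniformAddGroup_of_addCommGroup

/-- The completion of `K_n ⊗ K_n` for the `1`-topology (`i = 0`) or the `2`-topology (`i = 1`). -/
abbrev KKhat : Type := UniformSpace.Completion (KK n i)

/-- The image of `f ⊗ h` in the completion. -/
def tmulHat (f h : Kn n) : KKhat n i := (KK.tmul n i f h : KK n i)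

/-- `z - w = z ⊗ 1 - 1 ⊗ z`. -/
def zwHat : KKhat n i := tmulHat n i (zK n) 1 - tmulHat n i 1 (zK n)

/-- `(z - w) ^ m` for `m : ℤ`, in the completion, where `z - w` is invertible. -/
def zwPow : ℤ → KKhat n i
  | Int.ofNat m => zwHat n i ^ m
  | Int.negSucc m => Ring.inverse (zwHat n i) ^ (m + 1)

/-! ### Fields -/

lemma continuous_residue_smul (U : Type*) [Ring U] [TopologicalSpace U] [IsTopologicalRing U]
    [Algebra (An n) U] : Continuous (fun f : Kn n => algebraMap (An n) U (residue n f)) := by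
  have h : Continuous ((((Algebra.linearMap (An n) U) ∘ₗ residue n).toAddMonoidHom :
      Kn n →+ U)) := by
    refine continuous_of_continuousAt_zero _ ?_
    rw [ContinuousAt, map_zero]
    refine tendsto_const_nhds.congr' ?_
    filter_upwards [(Kn_nhds n).mem_of_mem (i := 0) trivial] with f hf
    obtain ⟨r, rfl⟩ := hf
    have : residue n (phiK n ^ 0 * algebraMap (Rn n) (Kn n) r) = 0 := by
      rw [pow_zero, one_mul, residue_Rn]
    exact (show algebraMap (An n) U (residue n _) = 0 by rw [this, map_zero]).symm
  exact h

section Fields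

variable (U : Type*) [Ring U] [UniformSpace U] [IsUniformAddGroup U] [IsTopologicalRing U]
  [Algebra (An n) U] [ContinuousConstSMul (An n) U]

/-- The space of `K_n`-fields with values in `U`: continuous `A_n`-linear maps `K_n → U`. -/
def KField : Type _ := Kn n →L[An n] U

instance : AddCommGroup (KField n U) := inferInstanceAs (AddCommGroup (Kn n →L[An n] U))
instance : Module (An n) (KField n U) := inferInstanceAs (Module (An n) (Kn n →L[An n] U))
instance : Module ℂ (KField n U) := Module.compHom _ (algebraMap ℂ (An n))
instance : FunLike (KField n U) (Kn n) U := inferInstanceAs (FunLike (Kn n →L[An n] U) (Kn n) U)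

variable {U} {n}

/-- The underlying `A_n`-linear map of a field. -/
def KField.lin (a : KField n U) : Kn n →ₗ[An n] U := ContinuousLinearMap.toLinearMap a

lemma continuous_neg_dK : Continuous (fun f : Kn n => - dK n f) := by
  have h : Continuous (-(dK n : Kn n →ₗ[An n] Kn n).toAddMonoidHom : Kn n →+ Kn n) := by
    refine continuous_of_continuousAt_zero _ ?_
    rw [ContinuousAt, map_zero, (Kn_nhds n).tendsto_iff (Kn_nhds n)]
    exact fun N _ => ⟨N + 1, trivial, fun f hf => (Jn n N).neg_mem (Jn_dK n hf)⟩
  exact h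

/-- The derivative `∂a : f ↦ a (-∂_z f)` of a field. -/
def KField.deriv (a : KField n U) : KField n U :=
  ContinuousLinearMap.comp (a : Kn n →L[An n] U) ⟨-(dK n : Kn n →ₗ[An n] Kn n), continuous_neg_dK⟩

/-- The linear map `f ⊗ h ↦ a(f) b(h)` on `K_n ⊗ K_n`. -/
def mulMap (a b : KField n U) : Kn n ⊗[An n] Kn n →ₗ[An n] U :=
  LinearMap.mul' (An n) U ∘ₗ TensorProduct.map a.lin b.lin

/-- The continuous extension of `ab : f ⊗ h ↦ a(f) b(h)` to the completion for the
`2`-topology. -/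
def mulExt (a b : KField n U) : KKhat n 1 → U :=
  UniformSpace.Completion.extension (fun x : KK n 1 => mulMap a b x)

/-- The continuous extension of `ba ∘ σ : f ⊗ h ↦ b(h) a(f)` to the completion for the
`1`-topology. -/
def mulSwapExt (a b : KField n U) : KKhat n 0 → U :=
  UniformSpace.Completion.extension
    (fun x : KK n 0 => mulMap b a (TensorProduct.comm (An n) (Kn n) (Kn n) x))

/-- The value of the `m`-th product `a_(m) b` at `f`. -/
def nProdVal (m : ℤ) (a b : KField n U) (f : Kn n) : U :=
  mulExt a b (zwPow n 1 m * tmulHat n 1 1 f) - mulSwapExt a b (zwPow n 0 m * tmulHat n 0 1 f)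

/-- `c` is the `m`-th product `a_(m) b`. -/
def IsNProd (m : ℤ) (a b c : KField n U) : Prop := ∀ f, c f = nProdVal m a b f

/-- Closed subspaces of fields. -/
structure IsClosedSpace (F : Submodule ℂ (KField n U)) : Prop where
  nProd : ∀ a ∈ F, ∀ b ∈ F, ∀ m c, IsNProd m a b c → c ∈ F
  deriv : ∀ a ∈ F, a.deriv ∈ F

/-- The smallest closed subspace that contains `F`. -/
def fieldClosure (F : Submodule ℂ (KField n U)) : Submodule ℂ (KField n U) :=
  sInf {G | F ≤ G ∧ IsClosedSpace G}

variable (n U)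

/-- The field `𝟏 : f ↦ (∫ f dz) 1_U`. -/
def oneField : KField n U :=
  (⟨Algebra.linearMap (An n) U ∘ₗ residue n, continuous_residue_smul n U⟩ : Kn n →L[An n] U)

end Fields

/-! ### The completed enveloping algebra -/

section Completed

variable (g : Type*) [LieRing g] [LieAlgebra ℂ g] (k : ℂ)

/-- The left ideal of `U'_k(ĝ_n)` generated by `g ⊗ φ_n ^ N R_n`. -/
def leftIdeal (N : ℕ) : Ideal (UPrime (dataKn n) g k) :=
  Ideal.span {u | ∃ x : g, ∃ f ∈ Jn n N, u = curU (dataKn n) g k x f}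

lemma leftIdeal_anti {N M : ℕ} (h : N ≤ M) : leftIdeal n g k M ≤ leftIdeal n g k N :=
  Ideal.span_mono fun _ ⟨x, f, hf, e⟩ => ⟨x, f, Jn_anti n h hf, e⟩

lemma curU_add {A K : Type*} [CommRing A] [CommRing K] [Algebra A K] [Algebra ℂ A] [Algebra ℂ K]
    [IsScalarTower ℂ A K] (D : ResidueData A K) (x : g) (f h : K) :
    curU D g k x (f + h) = curU D g k x f + curU D g k x h := by
  rw [curU, curU, curU, ← map_add]
  congr 1
  refine Prod.ext (TensorProduct.add_tmul f h x) ?_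
  change (0 : A) = 0 + 0
  simp

lemma curU_smul {A K : Type*} [CommRing A] [CommRing K] [Algebra A K] [Algebra ℂ A] [Algebra ℂ K]
    [IsScalarTower ℂ A K] (D : ResidueData A K) (x : g) (a : A) (f : K) :
    curU D g k x (a • f) = a • curU D g k x f := by
  rw [curU, curU, ← map_smul]
  congr 1
  refine Prod.ext (TensorProduct.smul_tmul' a f x).symm ?_
  change (0 : A) = a • 0
  simp

lemma leftIdeal_right (u : UPrime (dataKn n) g k) :
    ∀ N, ∃ M, ∀ v ∈ leftIdeal n g k M, v * u ∈ leftIdeal n g k N := by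
  induction u using UPrime.induction with
  | hC a =>
    intro N
    refine ⟨N, fun v hv => ?_⟩
    rw [← Algebra.commutes]
    exact (leftIdeal n g k N).mul_mem_left _ hv
  | hadd u u' h h' =>
    intro N
    obtain ⟨M, hM⟩ := h N
    obtain ⟨M', hM'⟩ := h' N
    refine ⟨max M M', fun v hv => ?_⟩
    rw [mul_add]
    exact add_mem (hM v (leftIdeal_anti n g k (le_max_left _ _) hv))
      (hM' v (leftIdeal_anti n g k (le_max_right _ _) hv))
  | hmul u u' h h' =>
    intro N
    obtain ⟨M, hM⟩ := h' N
    obtain ⟨M', hM'⟩ := h M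
    refine ⟨M', fun v hv => ?_⟩
    rw [← mul_assoc]
    exact hM _ (hM' v hv)
  | hcur y h =>
    intro N
    obtain ⟨M, hM⟩ := Jn_left n h N
    obtain ⟨M', hM'⟩ := Jn_left n h 0
    refine ⟨max (max M N) (M' + 1), fun v hv => ?_⟩
    induction hv using Submodule.span_induction with
    | zero => rw [zero_mul]; exact zero_mem _
    | add x x' _ _ h h' => rw [add_mul]; exact add_mem h h'
    | smul a x _ h => rw [smul_eq_mul, mul_assoc]; exact Ideal.mul_mem_left _ _ h
    | mem v hv =>
      obtain ⟨x, f, hf, rfl⟩ := hv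
      rw [curU_mul_curU]
      have h0 : (dataKn n).res (h * (dataKn n).d f) = 0 := by
        have hd := Jn_dK n (Jn_anti n (le_max_right _ _) hf)
        obtain ⟨r, hr⟩ := hM' _ hd
        change residue n (h * dK n f) = 0
        rw [hr, pow_zero, one_mul, residue_Rn]
      rw [h0, smul_zero, map_zero, add_zero]
      refine add_mem (Ideal.mul_mem_left _ _ (Ideal.subset_span ⟨x, f, ?_, rfl⟩))
        (Ideal.subset_span ⟨_, _, ?_, rfl⟩)
      · exact Jn_anti n ((le_max_right _ _).trans (le_max_left _ _)) hf
      · rw [mul_comm]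
        exact hM _ (Jn_anti n ((le_max_left _ _).trans (le_max_left _ _)) hf)

lemma leftIdeal_basis : RingSubgroupsBasis fun N => (leftIdeal n g k N).toAddSubgroup where
  inter N M := ⟨max N M, le_inf (leftIdeal_anti n g k (le_max_left _ _))
    (leftIdeal_anti n g k (le_max_right _ _))⟩
  mul N := ⟨N, by rintro _ ⟨u, hu, v, hv, rfl⟩; exact (leftIdeal n g k N).mul_mem_left u hv⟩
  leftMul u N := ⟨N, fun v hv => (leftIdeal n g k N).mul_mem_left u hv⟩
  rightMul u N := (leftIdeal_right n g k u N).imp fun M hM v hv => hM v hv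

instance : TopologicalSpace (UPrime (dataKn n) g k) := (leftIdeal_basis n g k).topology
instance : IsTopologicalRing (UPrime (dataKn n) g k) :=
  (leftIdeal_basis n g k).toRingFilterBasis.isTopologicalRing
instance : UniformSpace (UPrime (dataKn n) g k) := IsTopologicalAddGroup.rightUniformSpace _
instance : IsUniformAddGroup (UPrime (dataKn n) g k) := isUniformAddGroup_of_addCommGroup
instance : ContinuousConstSMul (An n) (UPrime (dataKn n) g k) where
  continuous_const_smul a := by
    simp only [Algebra.smul_def]
    exact continuous_const_mul _
instance : UniformContinuousConstSMul (An n) (UPrime (dataKn n) g k) :=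
  uniformContinuousConstSMul_of_continuousConstSMul _ _

/-- The completed enveloping algebra `Ũ_k(ĝ_n)`. -/
abbrev UTilde : Type _ := UniformSpace.Completion (UPrime (dataKn n) g k)

lemma continuous_curU (x : g) : Continuous (curU (dataKn n) g k x) := by
  let T : Kn n →+ UPrime (dataKn n) g k :=
    AddMonoidHom.mk' (curU (dataKn n) g k x) (curU_add g k (dataKn n) x)
  have h : Continuous T := by
    refine continuous_of_continuousAt_zero _ ?_
    rw [ContinuousAt, map_zero, (Kn_nhds n).tendsto_iff (leftIdeal_basis n g k).hasBasis_nhds_zero]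
    exact fun N _ => ⟨N, trivial, fun f hf => Ideal.subset_span ⟨x, f, hf, rfl⟩⟩
  exact h

/-- The field `X̂ : f ↦ X f`. -/
def hatField (x : g) : KField n (UTilde n g k) :=
  ({ toFun := fun f => (curU (dataKn n) g k x f : UTilde n g k)
     map_add' := fun f h => by rw [curU_add, UniformSpace.Completion.coe_add]
     map_smul' := fun a f => by rw [curU_smul, UniformSpace.Completion.coe_smul, RingHom.id_apply]
     cont := (UniformSpace.Completion.continuous_coe _).comp (continuous_curU n g k x) } :
    Kn n →L[An n] UTilde n g k)

/-- The closure, under derivatives and all products, of the span of the fields `X̂`. -/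
def hatClosure : Submodule ℂ (KField n (UTilde n g k)) :=
  fieldClosure (Submodule.span ℂ (Set.range (hatField n g k)))

/-- `V^k_{K_n}(g)`: the space spanned by `𝟏` and by the closure of the fields `X̂`. -/
def VKn : Submodule ℂ (KField n (UTilde n g k)) :=
  hatClosure n g k ⊔ Submodule.span ℂ {oneField n (UTilde n g k)}

end Completed

/-! ### Vertex algebras -/

/-- A vertex algebra structure on the complex vector space `V`: vacuum, translation operator and
state-field correspondence, subject to the vacuum, translation and locality axioms. Here
`(Y a).ncoeff m b` is the product `a_(m) b`. -/
structure VertexAlgebra (V : Type*) [AddCommGroup V] [Module ℂ V] where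
  vac : V
  T : V →ₗ[ℂ] V
  Y : V →ₗ[ℂ] VertexOperator ℂ V
  vac_mode : ∀ m b, (Y vac).ncoeff m b = if m = -1 then b else 0
  mode_vac_nonneg : ∀ a, ∀ m : ℤ, 0 ≤ m → (Y a).ncoeff m vac = 0
  mode_vac_neg_one : ∀ a, (Y a).ncoeff (-1) vac = a
  T_vac : T vac = 0
  translation : ∀ a m b,
    T ((Y a).ncoeff m b) - (Y a).ncoeff m (T b) = -(m : ℂ) • (Y a).ncoeff (m - 1) b
  /-- `(z - w) ^ N [Y(a, z), Y(b, w)] = 0`. -/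
  locality : ∀ a b, ∃ N : ℕ, ∀ (p q : ℤ) (c : V),
    ∑ j ∈ Finset.range (N + 1), ((-1 : ℂ) ^ j * (N.choose j : ℂ)) •
      ((Y a).ncoeff (p + N - j) ((Y b).ncoeff (q + j) c)
        - (Y b).ncoeff (q + j) ((Y a).ncoeff (p + N - j) c)) = 0

/-- An isomorphism of vertex algebras. -/
structure VertexAlgebra.Iso {V W : Type*} [AddCommGroup V] [Module ℂ V] [AddCommGroup W]
    [Module ℂ W] (S : VertexAlgebra V) (S' : VertexAlgebra W) extends V ≃ₗ[ℂ] W where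
  map_vac : toFun S.vac = S'.vac
  map_T : ∀ a, toFun (S.T a) = S'.T (toFun a)
  map_mode : ∀ a m b,
    toFun ((S.Y a).ncoeff m b) = (S'.Y (toFun a)).ncoeff m (toFun b)

section Affine

variable (g : Type*) [LieRing g] [LieAlgebra ℂ g] (k : ℂ)

/-- The left ideal of `U'_k(ĝ)`, `ĝ = g((t)) ⊕ ℂ𝟏`, generated by `g[[t]]`. -/
def vacIdeal : Ideal (UPrime dataLaurent g k) :=
  Ideal.span {u | ∃ x : g, ∃ r : PowerSeries ℂ,
    u = curU dataLaurent g k x (algebraMap (PowerSeries ℂ) Lt r)}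

/-- The vacuum module `V^k(g) = U(ĝ) ⊗_{U(g[[t]] ⊕ ℂ𝟏)} ℂ`, where `g[[t]]` acts on `ℂ` by `0`
and `𝟏` by `1`. -/
abbrev Vac : Type _ := UPrime dataLaurent g k ⧸ vacIdeal g k

/-- The vector `|0⟩`. -/
def vacVec : Vac g k := Submodule.Quotient.mk 1

/-- The action of `X_m = X t ^ m` on `V^k(g)`. -/
def act (x : g) (m : ℤ) (v : Vac g k) : Vac g k := curU dataLaurent g k x (Lt.tpow m) • v

/-- `S` is the vertex algebra structure of `V^k(g)`: the vacuum is `|0⟩`, and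
`Y(X_{-1}|0⟩, z) = ∑ X_m z ^ (-m - 1)` for `X ∈ g`. -/
structure IsAffineStructure (S : VertexAlgebra (Vac g k)) : Prop where
  vac : S.vac = vacVec g k
  mode : ∀ x m v, (S.Y (act g k x (-1) (vacVec g k))).ncoeff m v = act g k x m v

/-- `W` is the vertex algebra structure of `V^k_{K_n}(g)`: the vacuum is `𝟏`, the translation
operator is the derivative, and the products are the products of fields. -/
structure IsFieldStructure (W : VertexAlgebra (VKn n g k)) : Prop where
  vac : (W.vac : KField n (UTilde n g k)) = oneField n (UTilde n g k)
  T : ∀ a : VKn n g k, (W.T a : KField n (UTilde n g k)) = (a : KField n (UTilde n g k)).deriv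
  mode : ∀ (a b : VKn n g k) (m : ℤ), IsNProd m (a : KField n (UTilde n g k)) b
    ((W.Y a).ncoeff m b : VKn n g k)

end Affine

end KnFields

end

open KnFields

/-!
The products of fields are studied modulo the left ideals that define the topology of the completed
enveloping algebra. Modulo such an ideal, a product of `s` fields is an `A_n`-multilinear functional
of `s` test functions (`prodMod`) which is continuous in each variable, in a way that depends only
on the factors to its right. On functionals that are small in one of the variables `z_i`, `z_j`,
multiplication by `z_i - z_j` is bijective: `z_i - z_j` divides `φ(z_i) - φ(z_j)`, which is inverted
by a geometric series. This gives the expanded powers `zPow i j s m` of `z_i - z_j`, where `s` is the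
small variable. They are characterized by their recursion in `m` (`zPow_unique`), and the product
`a_(m) b` is the difference of the two expansions of `(z - w) ^ m`, applied to `a(z) b(w)` and
`b(w) a(z)` (`red_nProd`). All identities between products thus become statements about functionals
of two or three variables.

*Fields form a vertex algebra.* Dong's lemma (`IsLocal.nProd_left`) and a double commutant argument
show that all fields in `V^k_{K_n}(g)` are mutually local. Locality gives the truncation of the
products and, through a binomial expansion of `(z_0 - z_1) ^ M`, the locality axiom
(`IsLocalOfOrder.sum_commutator`). The vacuum axioms are residue computations for the expansion of
`(z - w)⁻¹` (`expansion_residue`). Together with translation covariance this is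
`fieldVertexAlgebra`.

*The canonical map.* The commutation relations of the currents yield `[X̂_(p), Ŷ_(q)] = Z_(p + q) +
p κ(X, Y) δ_{p + q, 0}`, `Z` the field of `[X, Y]`, (`AffineRel.commutator`), so that
`V^k_{K_n}(g)` is a smooth representation of level `k` of the affine Lie algebra in which all
`X̂_(m)` with `m ≥ 0` kill `𝟏`. The universal property of the vacuum module gives `canMap`. Its
image is closed under all products (`ncoeff_mem_range`), by locality and truncation, hence `canMap`
is surjective. For injectivity, a field is evaluated at the test function `z ^ (n - 1) / φ_n`, the
result is taken modulo the left ideal generated by `g ⊗ R_n`, and the parameters are specialized to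
`a = 0`, where `K_n` maps to `ℂ((t))` and the test function to `t⁻¹`. This is a left inverse of
`canMap` (`evalVac_canMap`).

*Conclusion.* The vertex algebra structure on `V^k(g)` is transported from the one on fields
(`isAffineStructure_comap`), and any two structures with the prescribed currents are intertwined by
`canMap` (`map_ncoeff`). For `k ≠ 0` the field `𝟏` lies in the closure of the fields `X̂` because
`X̂_(1) Ŷ = κ(X, Y) 𝟏` (`nProd_one_hatField`) and the Killing form does not vanish.
-/

noncomputable section

set_option linter.unusedSectionVars false

namespace KnFields

/-! ### Multilinear functionals and expansions of powers of `z_i - z_j` -/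

section Functionals

variable {n : ℕ} {ι : Type*} [dec : DecidableEq ι] {P Q : Type*} [AddCommGroup P] [Module (An n) P]
  [AddCommGroup Q] [Module (An n) Q]

/-- The `A_n`-multilinear functionals of a family, indexed by `ι`, of test functions in `K_n`. -/
abbrev Func (n : ℕ) (ι : Type*) (P : Type*) [AddCommGroup P] [Module (An n) P] : Type _ :=
  MultilinearMap (An n) (fun _ : ι => Kn n) P

/-- Precomposition of the variable `i` of a functional with an endomorphism of `K_n`. -/
def slotMap (i : ι) (T : Module.End (An n) (Kn n)) : Module.End (An n) (Func n ι P) where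
  toFun F := F.compLinearMap (Function.update (fun _ => LinearMap.id) i T)
  map_add' _ _ := rfl
  map_smul' _ _ := rfl

lemma slotMap_apply (i : ι) (T : Module.End (An n) (Kn n)) (F : Func n ι P) (x : ι → Kn n) :
    slotMap i T F x = F (Function.update x i (T (x i))) := by
  change F _ = F _
  congr 1
  ext k
  by_cases h : k = i
  · subst h; simp
  · simp [h]

/-- Multiplication of a functional by the function `f` of the variable `i`. -/
def mulSlot (i : ι) (f : Kn n) : Module.End (An n) (Func n ι P) :=
  slotMap i (LinearMap.mulLeft (An n) f)

lemma mulSlot_apply (i : ι) (f : Kn n) (F : Func n ι P) (x : ι → Kn n) :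
    mulSlot i f F x = F (Function.update x i (f * x i)) := slotMap_apply _ _ _ _

lemma slotMap_comm {i j : ι} (h : i ≠ j) (T T' : Module.End (An n) (Kn n)) (F : Func n ι P) :
    slotMap i T (slotMap j T' F) = slotMap j T' (slotMap i T F) := by
  ext x
  simp only [slotMap_apply, Function.update_of_ne h, Function.update_of_ne h.symm]
  rw [Function.update_comm h]

lemma mulSlot_mulSlot (i : ι) (f h : Kn n) (F : Func n ι P) :
    mulSlot i f (mulSlot i h F) = mulSlot i (f * h) F := by
  ext x
  simp only [mulSlot_apply, Function.update_self, Function.update_idem]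
  congr 2; ring

lemma mulSlot_comm (i j : ι) (f h : Kn n) (F : Func n ι P) :
    mulSlot i f (mulSlot j h F) = mulSlot j h (mulSlot i f F) := by
  by_cases e : i = j
  · subst e; rw [mulSlot_mulSlot, mulSlot_mulSlot, mul_comm]
  · exact slotMap_comm e _ _ F

lemma mulSlot_one (i : ι) (F : Func n ι P) : mulSlot i 1 F = F := by
  ext x; simp [mulSlot_apply]

lemma mulSlot_add (i : ι) (f h : Kn n) (F : Func n ι P) :
    mulSlot i (f + h) F = mulSlot i f F + mulSlot i h F := by
  ext x
  simp only [mulSlot_apply, add_apply, add_mul, MultilinearMap.map_update_add]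

lemma mulSlot_smul (i : ι) (a : An n) (f : Kn n) (F : Func n ι P) :
    mulSlot i (a • f) F = a • mulSlot i f F := by
  ext x
  simp only [mulSlot_apply, smul_apply, smul_mul_assoc,
    MultilinearMap.map_update_smul]

/-- Multiplication by `z_i - z_j`. -/
def zDiff (i j : ι) : Module.End (An n) (Func n ι P) := mulSlot i (zK n) - mulSlot j (zK n)

lemma zDiff_apply (i j : ι) (F : Func n ι P) :
    zDiff i j F = mulSlot i (zK n) F - mulSlot j (zK n) F := rfl

lemma zDiff_mulSlot (i j k : ι) (f : Kn n) (F : Func n ι P) :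
    zDiff i j (mulSlot k f F) = mulSlot k f (zDiff i j F) := by
  rw [zDiff_apply, zDiff_apply, map_sub, mulSlot_comm i k, mulSlot_comm j k]

lemma zDiff_comm (i j k l : ι) (F : Func n ι P) :
    zDiff i j (zDiff k l F) = zDiff k l (zDiff i j F) := by
  rw [zDiff_apply k l F, map_sub, zDiff_mulSlot, zDiff_mulSlot]; rfl

lemma zDiff_swap (i j : ι) (F : Func n ι P) : zDiff i j F = - zDiff j i F := by
  rw [zDiff_apply, zDiff_apply, neg_sub]

/-- The functionals that vanish as soon as the variable `l` lies in a neighbourhood `J_M` of `0`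
that depends only on the variables in `s`. -/
def vanish (l : ι) (s : Set ι) : Submodule (An n) (Func n ι P) where
  carrier := {F | ∀ y : ι → Kn n, ∃ M, ∀ x : ι → Kn n, (∀ k ∈ s, x k = y k) → x l ∈ Jn n M →
    F x = 0}
  add_mem' {F G} hF hG y := by
    obtain ⟨M, hM⟩ := hF y
    obtain ⟨M', hM'⟩ := hG y
    refine ⟨max M M', fun x hx hl => ?_⟩
    rw [add_apply, hM x hx (Jn_anti n (le_max_left _ _) hl),
      hM' x hx (Jn_anti n (le_max_right _ _) hl), add_zero]
  zero_mem' _ := ⟨0, fun _ _ _ => rfl⟩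
  smul_mem' a F hF y := by
    obtain ⟨M, hM⟩ := hF y
    exact ⟨M, fun x hx hl => by rw [smul_apply, hM x hx hl, smul_zero]⟩

lemma vanish_mono {l : ι} {s t : Set ι} (h : s ⊆ t) {F : Func n ι P} (hF : F ∈ vanish l s) :
    F ∈ vanish l t := fun y => (hF y).imp fun _ hM x hx => hM x fun k hk => hx k (h hk)

lemma slotMap_mem_vanish {l : ι} {s : Set ι} (i : ι) {T : Module.End (An n) (Kn n)}
    (hT : ∀ M, ∃ M', ∀ h ∈ Jn n M', T h ∈ Jn n M) {F : Func n ι P} (hF : F ∈ vanish l s) :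
    slotMap i T F ∈ vanish l s := by
  intro y
  obtain ⟨M, hM⟩ := hF (Function.update y i (T (y i)))
  obtain ⟨M', hM'⟩ := hT M
  refine ⟨max M M', fun x hx hl => ?_⟩
  rw [slotMap_apply]
  apply hM
  · intro k hk
    by_cases h : k = i
    · subst h; simp [hx k hk]
    · simp [h, hx k hk]
  · by_cases h : l = i
    · subst h
      rw [Function.update_self]
      exact hM' _ (Jn_anti n (le_max_right _ _) hl)
    · rw [Function.update_of_ne h]
      exact Jn_anti n (le_max_left _ _) hl

lemma mulSlot_mem_vanish {l : ι} {s : Set ι} (i : ι) (f : Kn n) {F : Func n ι P}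
    (hF : F ∈ vanish l s) : mulSlot i f F ∈ vanish l s :=
  slotMap_mem_vanish i (Jn_left n f) hF

lemma zDiff_mem_vanish {l : ι} {s : Set ι} (i j : ι) {F : Func n ι P}
    (hF : F ∈ vanish l s) : zDiff i j F ∈ vanish l s :=
  sub_mem (mulSlot_mem_vanish i _ hF) (mulSlot_mem_vanish j _ hF)

/-- The inverse of `φ_n` in `K_n`. -/
def phiInv (n : ℕ) : Kn n := Ring.inverse (phiK n)

lemma phiK_mul_phiInv : phiK n * phiInv n = 1 := Ring.mul_inverse_cancel _ (isUnit_phiK n)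

lemma phiInv_pow_mul (k : ℕ) (f : Kn n) : phiInv n ^ k * (phiK n ^ k * f) = f := by
  rw [← mul_assoc, ← mul_pow, mul_comm (phiInv n), phiK_mul_phiInv, one_pow, one_mul]

/-- Every element of `K_n` lies in all neighbourhoods of `0` after multiplication by a high power
of `φ_n`. -/
lemma phiK_pow_mul_mem (f : Kn n) (M : ℕ) : ∃ N, ∀ k, N ≤ k → phiK n ^ k * f ∈ Jn n M := by
  obtain ⟨N, r, hr⟩ := exists_num n f
  refine ⟨N + M, fun k hk => Jn_anti n (show M ≤ k - N by omega) ⟨r, ?_⟩⟩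
  rw [← hr, mul_comm f, ← mul_assoc, ← pow_add, Nat.sub_add_cancel (by omega)]

lemma phiK_pow_mul_mem_of_mem {f : Kn n} {M : ℕ} (hf : f ∈ Jn n M) (k : ℕ) :
    phiK n ^ k * f ∈ Jn n M := by
  obtain ⟨r, rfl⟩ := hf
  exact ⟨(phi n : Rn n) ^ k * r, by rw [map_mul, map_pow, phiK]; ring⟩

/-- The `k`-th term `φ(z_i) ^ (-k - 1) φ(z_j) ^ k F` of the geometric series for
`(φ(z_i) - φ(z_j))⁻¹ F`. -/
def geomTerm (i j : ι) (F : Func n ι P) (k : ℕ) : Func n ι P :=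
  mulSlot i (phiInv n ^ (k + 1)) (mulSlot j (phiK n ^ k) F)

lemma geomTerm_apply {i j : ι} (hij : i ≠ j) (F : Func n ι P) (k : ℕ) (x : ι → Kn n) :
    geomTerm i j F k x = F (Function.update (Function.update x i (phiInv n ^ (k + 1) * x i)) j
      (phiK n ^ k * x j)) := by
  rw [geomTerm, mulSlot_apply, mulSlot_apply, Function.update_of_ne hij.symm]

/-- If `F` vanishes for `z_j`-test functions near `0`, the geometric series for
`(φ(z_i) - φ(z_j))⁻¹ F` has only finitely many nonzero terms at each point. -/
lemma geomTerm_eventually {i j : ι} (hij : i ≠ j) {s : Set ι} (hi : i ∉ s) (hj : j ∉ s)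
    {F : Func n ι P} (hF : F ∈ vanish j s) (y : ι → Kn n) :
    ∃ N, ∀ x : ι → Kn n, (∀ k ∈ s, x k = y k) → x j = y j → ∀ k, N ≤ k →
      geomTerm i j F k x = 0 := by
  obtain ⟨M, hM⟩ := hF y
  obtain ⟨N, hN⟩ := phiK_pow_mul_mem (y j) M
  refine ⟨N, fun x hx hxj k hk => ?_⟩
  rw [geomTerm_apply hij]
  apply hM
  · intro l hl
    rw [Function.update_of_ne (by rintro rfl; exact hj hl),
      Function.update_of_ne (by rintro rfl; exact hi hl), hx l hl]
  · rw [Function.update_self, hxj]; exact hN k hk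

lemma finsum_eq_sum_range {f : ℕ → P} {N : ℕ} (h : ∀ k, N ≤ k → f k = 0) :
    ∑ᶠ k, f k = ∑ k ∈ Finset.range N, f k :=
  finsum_eq_sum_of_support_subset _ fun k hk => by
    simp only [Finset.coe_range, Set.mem_Iio]
    by_contra h'
    exact hk (h k (not_lt.1 h'))

lemma geomTerm_finite {i j : ι} (hij : i ≠ j) {F : Func n ι P}
    (hF : F ∈ vanish j ({i, j}ᶜ : Set ι)) (x : ι → Kn n) :
    Function.HasFiniteSupport fun k => geomTerm i j F k x := by
  obtain ⟨N, hN⟩ := geomTerm_eventually hij (by simp) (by simp) hF x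
  refine (Finset.range N).finite_toSet.subset fun k hk => ?_
  simp only [Finset.coe_range, Set.mem_Iio]
  by_contra h'
  exact hk (hN x (fun _ _ => rfl) rfl k (not_lt.1 h'))

/-- The geometric series for `(φ(z_i) - φ(z_j))⁻¹ F`, expanded for `|z_i| > |z_j|`. -/
def geomSum {i j : ι} (hij : i ≠ j) (F : Func n ι P) (hF : F ∈ vanish j ({i, j}ᶜ : Set ι)) :
    Func n ι P where
  toFun x := ∑ᶠ k, geomTerm i j F k x
  map_update_add' {d} x l f h := by
    obtain rfl := Subsingleton.elim dec d
    simp only [MultilinearMap.map_update_add]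
    exact finsum_add_distrib (geomTerm_finite hij hF _) (geomTerm_finite hij hF _)
  map_update_smul' {d} x l a f := by
    obtain rfl := Subsingleton.elim dec d
    simp only [MultilinearMap.map_update_smul]
    exact (smul_finsum' a (geomTerm_finite hij hF _)).symm

lemma geomSum_apply {i j : ι} (hij : i ≠ j) {F : Func n ι P}
    (hF : F ∈ vanish j ({i, j}ᶜ : Set ι)) {x : ι → Kn n} {N : ℕ}
    (h : ∀ k, N ≤ k → geomTerm i j F k x = 0) :
    geomSum hij F hF x = (∑ k ∈ Finset.range N, geomTerm i j F k) x := by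
  rw [sum_apply]
  exact finsum_eq_sum_range h

/-- The geometric series telescopes: it inverts multiplication by `φ(z_i) - φ(z_j)`. -/
lemma geomSum_spec {i j : ι} (hij : i ≠ j) {F : Func n ι P}
    (hF : F ∈ vanish j ({i, j}ᶜ : Set ι)) :
    mulSlot i (phiK n) (geomSum hij F hF) - mulSlot j (phiK n) (geomSum hij F hF) = F := by
  ext x
  obtain ⟨N, hN⟩ := geomTerm_eventually hij (by simp) (by simp) hF
    (Function.update x i (phiK n * x i))
  obtain ⟨N', hN'⟩ := geomTerm_eventually hij (by simp) (by simp) hF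
    (Function.update x j (phiK n * x j))
  have h1 := geomSum_apply hij hF (x := Function.update x i (phiK n * x i))
    (N := max N N' + 1) (fun k hk => hN _ (fun _ _ => rfl) rfl k (by omega))
  have h2 := geomSum_apply hij hF (x := Function.update x j (phiK n * x j))
    (N := max N N') (fun k hk => hN' _ (fun _ _ => rfl) rfl k (by omega))
  rw [sub_apply, mulSlot_apply, mulSlot_apply, h1, h2, sum_apply,
    sum_apply, Finset.sum_range_succ']
  have e : ∀ k, geomTerm i j F (k + 1) (Function.update x i (phiK n * x i)) =
      geomTerm i j F k (Function.update x j (phiK n * x j)) := by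
    intro k
    rw [geomTerm_apply hij, geomTerm_apply hij]
    have e1 : phiInv n ^ (k + 1 + 1) * (phiK n * x i) = phiInv n ^ (k + 1) * x i := by
      rw [pow_succ, mul_assoc, ← mul_assoc (phiInv n), mul_comm (phiInv n), phiK_mul_phiInv,
        one_mul]
    have e2 : phiK n ^ (k + 1) * x j = phiK n ^ k * (phiK n * x j) := by rw [pow_succ, mul_assoc]
    rw [Function.update_self, Function.update_of_ne hij.symm, Function.update_idem, e1, e2,
      Function.update_self, Function.update_of_ne hij,
      Function.update_comm (β := fun _ => Kn n) hij.symm (phiK n * x j)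
        (phiInv n ^ (k + 1) * x i) x, Function.update_idem]
  have e0 : geomTerm i j F 0 (Function.update x i (phiK n * x i)) = F x := by
    rw [geomTerm_apply hij]
    simp only [Function.update_self, Function.update_of_ne hij.symm, Function.update_idem,
      zero_add, pow_one, pow_zero, one_mul]
    rw [← mul_assoc, mul_comm (phiInv n), phiK_mul_phiInv, one_mul, Function.update_eq_self,
      Function.update_eq_self]
  rw [Finset.sum_congr rfl fun k _ => e k, e0]
  abel

/-- The geometric series inherits a vanishing condition whose bound on the variable `l` does not
depend on `z_i` and `z_j`: the same bound works for all terms at once. -/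
lemma geomSum_mem_vanish_of_uniform {i j : ι} (hij : i ≠ j) {F : Func n ι P}
    (hF : F ∈ vanish j ({i, j}ᶜ : Set ι)) {l : ι} {s : Set ι} (hl : l ≠ i) (hi : i ∉ s)
    (hj : j ∉ s) (h : F ∈ vanish l s) : geomSum hij F hF ∈ vanish l s := by
  intro y
  obtain ⟨M, hM⟩ := h y
  refine ⟨M, fun x hx hxl => ?_⟩
  rw [geomSum_apply hij hF (N := 0), Finset.range_zero, Finset.sum_empty,
    zero_apply]
  intro k _
  rw [geomTerm_apply hij]
  apply hM
  · intro k hk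
    rw [Function.update_of_ne (by rintro rfl; exact hj hk),
      Function.update_of_ne (by rintro rfl; exact hi hk), hx k hk]
  · by_cases hlj : l = j
    · subst hlj
      rw [Function.update_self]
      exact phiK_pow_mul_mem_of_mem hxl k
    · rw [Function.update_of_ne hlj, Function.update_of_ne hl]; exact hxl

/-- The geometric series inherits a vanishing condition whose bound may depend on `z_j`: for fixed
`z_j` only finitely many terms contribute. -/
lemma geomSum_mem_vanish {i j : ι} (hij : i ≠ j) {F : Func n ι P}
    (hF : F ∈ vanish j ({i, j}ᶜ : Set ι)) {l : ι} {s t : Set ι} (ht : F ∈ vanish j t)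
    (hti : i ∉ t) (htj : j ∉ t) (hts : t ⊆ s) (hjs : j ∈ s) (h : F ∈ vanish l s) :
    geomSum hij F hF ∈ vanish l s := by
  intro y
  obtain ⟨N, hN⟩ := geomTerm_eventually hij hti htj ht y
  have hmem : ∑ k ∈ Finset.range N, geomTerm i j F k ∈ vanish l s :=
    sum_mem fun k _ => mulSlot_mem_vanish _ _ (mulSlot_mem_vanish _ _ h)
  obtain ⟨M, hM⟩ := hmem y
  refine ⟨M, fun x hx hxl => ?_⟩
  rw [geomSum_apply hij hF (hN x (fun k hk => hx k (hts hk)) (hx j hjs)), hM x hx hxl]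

/-- A vanishing condition on the variable `z_j` passes to the geometric series. -/
lemma geomSum_eq_zero {i j : ι} (hij : i ≠ j) {F : Func n ι P}
    (hF : F ∈ vanish j ({i, j}ᶜ : Set ι)) {M : ℕ} (h : ∀ x, x j ∈ Jn n M → F x = 0)
    (x : ι → Kn n) (hx : x j ∈ Jn n M) : geomSum hij F hF x = 0 := by
  rw [geomSum_apply hij hF (N := 0), Finset.range_zero, Finset.sum_empty,
    zero_apply]
  intro k _
  rw [geomTerm_apply hij]
  apply h
  rw [Function.update_self]
  exact phiK_pow_mul_mem_of_mem hx k

lemma aeval_zK (p : (An n)[X]) :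
    Polynomial.aeval (zK n) p = algebraMap (Rn n) (Kn n) (p : Rn n) := by
  induction p using Polynomial.induction_on' with
  | add p q hp hq => rw [map_add, hp, hq, Polynomial.coe_add, map_add]
  | monomial k a =>
    rw [Polynomial.aeval_monomial, ← Polynomial.C_mul_X_pow_eq_monomial, Polynomial.coe_mul,
      Polynomial.coe_pow, Polynomial.coe_X, Polynomial.coe_C, map_mul, map_pow, zK,
      IsScalarTower.algebraMap_apply (An n) (Rn n) (Kn n)]
    rfl

/-- `p(z_i) - p(z_j)` is divisible by `z_i - z_j`, with a quotient that is a combination of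
products of multiplications by polynomials in `z_i` and in `z_j`. -/
lemma exists_zDiff_quotient (i j : ι) (p : (An n)[X]) :
    ∃ g : Module.End (An n) (Func n ι P),
      (∀ W : Submodule (An n) (Func n ι P),
        (∀ k (r : Rn n), ∀ F ∈ W, mulSlot k (algebraMap (Rn n) (Kn n) r) F ∈ W) →
        ∀ F ∈ W, g F ∈ W) ∧
      ∀ F, zDiff i j (g F) = mulSlot i (Polynomial.aeval (zK n) p) F
        - mulSlot j (Polynomial.aeval (zK n) p) F := by
  induction p using Polynomial.induction_on' with
  | add p q hp hq =>
    obtain ⟨g, h1, h2⟩ := hp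
    obtain ⟨g', h1', h2'⟩ := hq
    refine ⟨g + g', fun W hW F hF => add_mem (h1 W hW F hF) (h1' W hW F hF), fun F => ?_⟩
    rw [LinearMap.add_apply, map_add, h2, h2', map_add, mulSlot_add, mulSlot_add]; abel
  | monomial k a =>
    induction k with
    | zero =>
      refine ⟨0, fun W _ F _ => W.zero_mem, fun F => ?_⟩
      rw [LinearMap.zero_apply, map_zero, Polynomial.aeval_monomial, pow_zero, mul_one,
        Algebra.algebraMap_eq_smul_one, mulSlot_smul, mulSlot_smul, mulSlot_one, mulSlot_one,
        sub_self]
    | succ k ih =>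
      obtain ⟨g, h1, h2⟩ := ih
      have e : Polynomial.aeval (zK n) (Polynomial.monomial (k + 1) a) =
          zK n * Polynomial.aeval (zK n) (Polynomial.monomial k a) := by
        rw [Polynomial.aeval_monomial, Polynomial.aeval_monomial, pow_succ]; ring
      have hq := aeval_zK (Polynomial.monomial k a)
      set q := Polynomial.aeval (zK n) (Polynomial.monomial k a)
      refine ⟨mulSlot i q + mulSlot j (zK n) * g,
        fun W hW F hF => add_mem (hq ▸ hW _ _ _ hF) (hW _ _ _ (h1 W hW F hF)), fun F => ?_⟩
      rw [LinearMap.add_apply, Module.End.mul_apply, map_add, zDiff_mulSlot, zDiff_mulSlot, h2,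
        e, zDiff_apply, map_sub, map_sub, mulSlot_mulSlot, mulSlot_mulSlot, mul_comm q,
        mulSlot_comm i j]
      abel

lemma aeval_phi : Polynomial.aeval (zK n) (phi n) = phiK n := aeval_zK _

/-- The functionals on which the powers of `z_i - z_j` act, expanded in the domain where the
variable `s ∈ {i, j}` is the small one. -/
def expDom (i j s : ι) : Submodule (An n) (Func n ι P) := vanish s ({i, j}ᶜ : Set ι)

lemma mulSlot_pow_phi {i j : ι} {F : Func n ι P}
    (h : mulSlot i (phiK n) F = mulSlot j (phiK n) F) (N : ℕ) :
    mulSlot i (phiK n ^ N) F = mulSlot j (phiK n ^ N) F := by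
  induction N with
  | zero => rw [pow_zero, mulSlot_one, mulSlot_one]
  | succ N ih =>
    rw [pow_succ, ← mulSlot_mulSlot, h, mulSlot_comm, ih, mulSlot_mulSlot, mul_comm]

/-- Multiplication by `z_i - z_j` is injective on the functionals that are small in `z_j`: if
`z_i F = z_j F`, then `φ(z_i) ^ N F = φ(z_j) ^ N F`, and the right-hand side vanishes for large `N`
at any given point. -/
lemma zDiff_injOn_aux {i j : ι} (hij : i ≠ j) {F : Func n ι P}
    (hF : F ∈ vanish j ({i, j}ᶜ : Set ι)) (h : zDiff i j F = 0) : F = 0 := by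
  have h1 : mulSlot i (phiK n) F = mulSlot j (phiK n) F := by
    have hz' : mulSlot i (zK n) F = mulSlot j (zK n) F := sub_eq_zero.1 h
    -- the two actions of `z` agree on `F`, hence so do the two actions of every polynomial in `z`
    have key : ∀ p : (An n)[X], mulSlot i (Polynomial.aeval (zK n) p) F =
        mulSlot j (Polynomial.aeval (zK n) p) F := by
      intro p
      induction p using Polynomial.induction_on' with
      | add p q hp hq => rw [map_add, mulSlot_add, mulSlot_add, hp, hq]
      | monomial k a =>
        rw [Polynomial.aeval_monomial, ← Algebra.smul_def, mulSlot_smul, mulSlot_smul]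
        congr 1
        induction k with
        | zero => rw [pow_zero, mulSlot_one, mulSlot_one]
        | succ k ih =>
          rw [pow_succ, ← mulSlot_mulSlot, hz', mulSlot_comm, ih, mulSlot_mulSlot, mul_comm]
    rw [← aeval_phi]; exact key _
  ext x
  obtain ⟨M, hM⟩ := hF x
  obtain ⟨N, hN⟩ := phiK_pow_mul_mem (x j) M
  have h2 := congrArg (fun G : Func n ι P => G (Function.update x i (phiInv n ^ N * x i)))
    (mulSlot_pow_phi h1 N)
  simp only [mulSlot_apply, Function.update_self, Function.update_idem,
    Function.update_of_ne hij.symm] at h2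
  rw [← mul_assoc, ← mul_pow, phiK_mul_phiInv, one_pow, one_mul, Function.update_eq_self] at h2
  rw [h2]
  apply hM
  · intro k hk
    simp only [Set.mem_compl_iff, Set.mem_insert_iff, Set.mem_singleton_iff, not_or] at hk
    rw [Function.update_of_ne hk.2, Function.update_of_ne hk.1]
  · rw [Function.update_self]; exact hN N le_rfl

lemma zDiff_injOn {i j s : ι} (hij : i ≠ j) (hs : s = i ∨ s = j) {F : Func n ι P}
    (hF : F ∈ expDom i j s) (h : zDiff i j F = 0) : F = 0 := by
  rcases hs with rfl | rfl
  · rw [expDom, Set.pair_comm] at hF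
    exact zDiff_injOn_aux hij.symm hF (by rw [zDiff_swap, h, neg_zero])
  · exact zDiff_injOn_aux hij hF h

/-- The functionals that vanish as soon as the variable `l` lies in `J_M`. -/
def vanishAt (l : ι) (M : ℕ) : Submodule (An n) (Func n ι P) where
  carrier := {F | ∀ x : ι → Kn n, x l ∈ Jn n M → F x = 0}
  add_mem' {F G} hF hG x hx := by rw [add_apply, hF x hx, hG x hx, add_zero]
  zero_mem' _ _ := rfl
  smul_mem' a F hF x hx := by rw [smul_apply, hF x hx, smul_zero]

lemma mulSlot_mem_vanishAt {l : ι} {M : ℕ} (k : ι) (r : Rn n) {F : Func n ι P}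
    (hF : F ∈ vanishAt l M) : mulSlot k (algebraMap (Rn n) (Kn n) r) F ∈ vanishAt l M := by
  intro x hx
  rw [mulSlot_apply]
  apply hF
  by_cases h : l = k
  · subst h
    rw [Function.update_self]
    obtain ⟨q, hq⟩ := hx
    exact ⟨r * q, by rw [hq, map_mul]; ring⟩
  · rw [Function.update_of_ne h]; exact hx

/-- The functionals adapted to an ordering of the variables, given by the ranks `r`: they vanish
when one variable is near `0`, in a neighbourhood that depends on the variables of higher rank
only. They are the functionals to be expanded in the domain where `|z_i| > |z_j|` for
`r i < r j`. -/
def ordered (r : ι → ℕ) : Submodule (An n) (Func n ι P) := ⨅ l, vanish l {k | r l < r k}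

lemma mem_ordered {r : ι → ℕ} {F : Func n ι P} :
    F ∈ ordered r ↔ ∀ l, F ∈ vanish l {k | r l < r k} := Submodule.mem_iInf _

lemma ordered_le_expDom {r : ι → ℕ} {i j s : ι} (hi : r i ≤ r s) (hj : r j ≤ r s) :
    ordered (n := n) (P := P) r ≤ expDom i j s := fun F hF =>
  vanish_mono (by
    rintro k hk hk'
    simp only [Set.mem_ofPred_eq] at hk
    rcases hk' with rfl | rfl <;> omega) (mem_ordered.1 hF s)

/-- The inverse of `z_i - z_j` is the product of `(φ(z_i) - φ(z_j)) / (z_i - z_j)` and the geometric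
series for `(φ(z_i) - φ(z_j))⁻¹`, and it preserves the vanishing conditions. -/
lemma zDiff_surj_aux {i j : ι} (hij : i ≠ j) {F : Func n ι P}
    (hF : F ∈ vanish j ({i, j}ᶜ : Set ι)) :
    ∃ G ∈ vanish j ({i, j}ᶜ : Set ι), zDiff i j G = F ∧
      (∀ M, F ∈ vanishAt j M → G ∈ vanishAt j M) ∧
      ∀ r : ι → ℕ, Function.Injective r → r i < r j → F ∈ ordered r → G ∈ ordered r := by
  obtain ⟨g, hg1, hg2⟩ := exists_zDiff_quotient (P := P) i j (phi n)
  refine ⟨g (geomSum hij F hF), ?_, ?_, fun M h => ?_, fun r hr hlt h => ?_⟩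
  · refine hg1 _ (fun k f G hG => mulSlot_mem_vanish k _ hG) _ ?_
    exact geomSum_mem_vanish_of_uniform hij hF hij.symm (by simp) (by simp) hF
  · rw [hg2, aeval_phi, geomSum_spec hij hF]
  · exact hg1 _ (fun k f G hG => mulSlot_mem_vanishAt k _ hG) _ (geomSum_eq_zero hij hF h)
  · refine hg1 _ (fun k f G hG =>
      mem_ordered.2 fun l => mulSlot_mem_vanish k _ (mem_ordered.1 hG l)) _ ?_
    rw [mem_ordered] at h ⊢
    intro l
    rcases lt_or_ge (r l) (r j) with hl | hl
    · exact geomSum_mem_vanish hij hF (h j) (by simp; omega) (by simp)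
        (fun k hk => hl.trans hk) hl (h l)
    · exact geomSum_mem_vanish_of_uniform hij hF (by rintro rfl; omega) (by simp; omega)
        (by simp; omega) (h l)

/-- The element `z_i - z_j` is invertible on each domain of expansion, and its inverse preserves
the functionals adapted to a compatible ordering of the variables. -/
lemma zDiff_surj {i j s : ι} (hij : i ≠ j) (hs : s = i ∨ s = j) {F : Func n ι P}
    (hF : F ∈ expDom i j s) :
    ∃ G ∈ expDom i j s, zDiff i j G = F ∧
      (∀ M, F ∈ vanishAt s M → G ∈ vanishAt s M) ∧
      ∀ r : ι → ℕ, Function.Injective r → r i ≤ r s → r j ≤ r s → F ∈ ordered r →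
        G ∈ ordered r := by
  rcases hs with rfl | rfl
  · have hF' := hF
    rw [expDom, Set.pair_comm] at hF'
    obtain ⟨G, h1, h2, h3, h4⟩ := zDiff_surj_aux hij.symm hF'
    refine ⟨-G, ?_, ?_, fun M h => neg_mem (h3 M h), fun r hr _ h h' => neg_mem (h4 r hr ?_ h')⟩
    · rw [expDom, Set.pair_comm]; exact neg_mem h1
    · rw [zDiff_swap, map_neg, neg_neg, h2]
    · exact lt_of_le_of_ne h fun e => hij (hr e).symm
  · obtain ⟨G, h1, h2, h3, h4⟩ := zDiff_surj_aux hij hF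
    exact ⟨G, h1, h2, h3, fun r hr h _ h' =>
      h4 r hr (lt_of_le_of_ne h fun e => hij (hr e)) h'⟩

/-- Multiplication by `z_i - z_j` on a domain of expansion. -/
def zDiffOn (i j s : ι) : Module.End (An n) (expDom (n := n) (P := P) i j s) :=
  (zDiff i j).restrict fun _ hF => zDiff_mem_vanish i j hF

lemma zDiffOn_bijective {i j s : ι} (hij : i ≠ j) (hs : s = i ∨ s = j) :
    Function.Bijective (zDiffOn (n := n) (P := P) i j s) := by
  refine ⟨(injective_iff_map_eq_zero _).2 fun F h => Subtype.ext ?_, fun F => ?_⟩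
  · exact zDiff_injOn hij hs F.2 (congrArg Subtype.val h)
  · obtain ⟨G, h1, h2, -⟩ := zDiff_surj hij hs F.2
    exact ⟨⟨G, h1⟩, Subtype.ext h2⟩

open Classical in
/-- Multiplication by `z_i - z_j` as an automorphism of a domain of expansion, when it is one. -/
def zDiffEquiv (i j s : ι) :
    expDom (n := n) (P := P) i j s ≃ₗ[An n] expDom (n := n) (P := P) i j s :=
  if h : Function.Bijective (zDiffOn (n := n) (P := P) i j s) then LinearEquiv.ofBijective _ h
  else LinearEquiv.refl _ _

lemma zDiffEquiv_apply {i j s : ι} (hij : i ≠ j) (hs : s = i ∨ s = j)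
    (F : expDom (n := n) (P := P) i j s) : (zDiffEquiv i j s F : Func n ι P) = zDiff i j F := by
  rw [zDiffEquiv, dif_pos (zDiffOn_bijective hij hs)]; rfl

open Classical in
/-- Multiplication by `(z_i - z_j) ^ m`, expanded in the domain where the variable `s ∈ {i, j}` is
the small one. It is extended by `0` to the functionals outside of the domain of expansion. -/
def zPow (i j s : ι) (m : ℤ) (F : Func n ι P) : Func n ι P :=
  if h : F ∈ expDom i j s then ((zDiffEquiv i j s ^ m) ⟨F, h⟩ : expDom i j s) else 0

lemma zPow_eq {i j s : ι} (m : ℤ) {F : Func n ι P} (h : F ∈ expDom i j s) :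
    zPow i j s m F = ((zDiffEquiv i j s ^ m) ⟨F, h⟩ : expDom i j s) := dif_pos h

lemma zPow_mem {i j s : ι} (m : ℤ) {F : Func n ι P} (h : F ∈ expDom i j s) :
    zPow i j s m F ∈ expDom i j s := by
  rw [zPow_eq m h]; exact Subtype.property _

lemma zPow_zero {i j s : ι} {F : Func n ι P} (h : F ∈ expDom i j s) : zPow i j s 0 F = F := by
  rw [zPow_eq _ h, zpow_zero]; rfl

lemma zPow_zPow {i j s : ι} (m l : ℤ) {F : Func n ι P} (h : F ∈ expDom i j s) :
    zPow i j s m (zPow i j s l F) = zPow i j s (m + l) F := by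
  have e : (⟨zPow i j s l F, zPow_mem l h⟩ : expDom i j s) = (zDiffEquiv i j s ^ l) ⟨F, h⟩ :=
    Subtype.ext (zPow_eq l h)
  rw [zPow_eq m (zPow_mem l h), zPow_eq (m + l) h, zpow_add, LinearEquiv.mul_apply, e]

lemma zPow_one {i j s : ι} (hij : i ≠ j) (hs : s = i ∨ s = j) {F : Func n ι P}
    (h : F ∈ expDom i j s) : zPow i j s 1 F = zDiff i j F := by
  rw [zPow_eq _ h, zpow_one, zDiffEquiv_apply hij hs]

lemma zDiff_zPow {i j s : ι} (hij : i ≠ j) (hs : s = i ∨ s = j) (m : ℤ) {F : Func n ι P}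
    (h : F ∈ expDom i j s) : zDiff i j (zPow i j s m F) = zPow i j s (m + 1) F := by
  rw [← zPow_one hij hs (zPow_mem m h), zPow_zPow _ _ h, add_comm]

lemma zPow_zDiff {i j s : ι} (hij : i ≠ j) (hs : s = i ∨ s = j) (m : ℤ) {F : Func n ι P}
    (h : F ∈ expDom i j s) : zPow i j s m (zDiff i j F) = zPow i j s (m + 1) F := by
  rw [← zPow_one hij hs h, zPow_zPow _ _ h]

lemma zDiff_pow_zPow {i j s : ι} (hij : i ≠ j) (hs : s = i ∨ s = j) (m : ℤ) (N : ℕ)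
    {F : Func n ι P} (h : F ∈ expDom i j s) :
    (zDiff i j ^ N) (zPow i j s m F) = zPow i j s (m + N) F := by
  induction N with
  | zero => simp
  | succ N ih =>
    rw [pow_succ', Module.End.mul_apply, ih, zDiff_zPow hij hs _ h, Nat.cast_succ, add_assoc]

lemma zPow_natCast {i j s : ι} (hij : i ≠ j) (hs : s = i ∨ s = j) (N : ℕ) {F : Func n ι P}
    (h : F ∈ expDom i j s) : zPow i j s N F = (zDiff i j ^ N) F := by
  have := zDiff_pow_zPow hij hs 0 N h
  rw [zPow_zero h, zero_add] at this
  exact this.symm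

lemma zPow_add {i j s : ι} (m : ℤ) {F G : Func n ι P} (hF : F ∈ expDom i j s)
    (hG : G ∈ expDom i j s) : zPow i j s m (F + G) = zPow i j s m F + zPow i j s m G := by
  rw [zPow_eq m hF, zPow_eq m hG, zPow_eq m (add_mem hF hG), ← Submodule.coe_add, ← map_add]
  rfl

lemma zPow_smul {i j s : ι} (m : ℤ) (a : An n) {F : Func n ι P} (hF : F ∈ expDom i j s) :
    zPow i j s m (a • F) = a • zPow i j s m F := by
  rw [zPow_eq m hF, zPow_eq m (Submodule.smul_mem _ a hF), ← Submodule.coe_smul, ← map_smul]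
  rfl

lemma zPow_neg {i j s : ι} (m : ℤ) {F : Func n ι P} (hF : F ∈ expDom i j s) :
    zPow i j s m (-F) = - zPow i j s m F := by
  rw [← neg_one_smul (An n), zPow_smul m _ hF, neg_one_smul]

lemma zPow_sub {i j s : ι} (m : ℤ) {F G : Func n ι P} (hF : F ∈ expDom i j s)
    (hG : G ∈ expDom i j s) : zPow i j s m (F - G) = zPow i j s m F - zPow i j s m G := by
  rw [sub_eq_add_neg, zPow_add m hF (neg_mem hG), zPow_neg m hG, sub_eq_add_neg]

/-- Two families of functionals that satisfy the same recursion under `z_i - z_j` and agree for one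
exponent agree for all exponents. -/
lemma zPow_unique {i j s : ι} (hij : i ≠ j) (hs : s = i ∨ s = j) (B : ℤ → Func n ι P)
    (hB : ∀ m, B m ∈ expDom i j s) (h : ∀ m, zDiff i j (B m) = B (m + 1)) (m : ℤ) :
    zPow i j s m (B 0) = B m := by
  induction m using Int.induction_on with
  | zero => exact zPow_zero (hB 0)
  | succ m ih => rw [← zDiff_zPow hij hs _ (hB 0), ih, h]
  | pred m ih =>
    have h1 := zDiff_zPow hij hs (-m - 1) (hB 0)
    rw [sub_add_cancel, ih] at h1
    have h2 := h (-m - 1)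
    rw [sub_add_cancel, ← h1, ← sub_eq_zero, ← map_sub] at h2
    exact (sub_eq_zero.1 (zDiff_injOn hij hs (sub_mem (hB _) (zPow_mem _ (hB 0))) h2)).symm

/-- An additive map that commutes with multiplication by the difference of two coordinates commutes
with all the expanded powers of this difference. -/
lemma map_zPow {κ : Type*} [DecidableEq κ] {i j s : ι} {i' j' s' : κ} (hij : i ≠ j)
    (hs : s = i ∨ s = j) (hij' : i' ≠ j') (hs' : s' = i' ∨ s' = j')
    (T : Func n ι P →+ Func n κ Q) (hT : ∀ F ∈ expDom i j s, T F ∈ expDom i' j' s')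
    (hc : ∀ F, T (zDiff i j F) = zDiff i' j' (T F)) (m : ℤ) {F : Func n ι P}
    (hF : F ∈ expDom i j s) : T (zPow i j s m F) = zPow i' j' s' m (T F) := by
  have := zPow_unique hij' hs' (fun m => T (zPow i j s m F)) (fun m => hT _ (zPow_mem m hF))
    (fun m => by rw [← hc, zDiff_zPow hij hs _ hF]) m
  rw [← this, zPow_zero hF]

/-- A submodule on which `z_i - z_j` acts invertibly is stable under all the powers of `z_i - z_j`.
-/
lemma zPow_mem_of_zDiff {i j s : ι} (hij : i ≠ j) (hs : s = i ∨ s = j)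
    (W : Submodule (An n) (Func n ι P)) (h1 : ∀ F ∈ W, zDiff i j F ∈ W)
    (h2 : ∀ F ∈ expDom i j s, F ∈ W → ∃ G ∈ expDom i j s, G ∈ W ∧ zDiff i j G = F) (m : ℤ)
    {F : Func n ι P} (hF : F ∈ expDom i j s) (hW : F ∈ W) : zPow i j s m F ∈ W := by
  induction m using Int.induction_on with
  | zero => rwa [zPow_zero hF]
  | succ m ih => rw [← zDiff_zPow hij hs _ hF]; exact h1 _ ih
  | pred m ih =>
    obtain ⟨G, hG, hGW, e⟩ := h2 _ (zPow_mem _ hF) ih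
    have h3 := zDiff_zPow hij hs (-m - 1) hF
    rw [sub_add_cancel, ← e, ← sub_eq_zero, ← map_sub] at h3
    rwa [sub_eq_zero.1 (zDiff_injOn hij hs (sub_mem (zPow_mem _ hF) hG) h3)]

lemma zPow_mem_ordered {i j s : ι} (hij : i ≠ j) (hs : s = i ∨ s = j) {r : ι → ℕ}
    (hr : Function.Injective r) (hi : r i ≤ r s) (hj : r j ≤ r s) (m : ℤ) {F : Func n ι P}
    (hF : F ∈ ordered r) : zPow i j s m F ∈ ordered r := by
  refine zPow_mem_of_zDiff hij hs _ (fun G hG => mem_ordered.2 fun l =>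
    zDiff_mem_vanish _ _ (mem_ordered.1 hG l)) (fun G hG h => ?_) m
    (ordered_le_expDom hi hj hF) hF
  obtain ⟨G', h1, h2, -, h4⟩ := zDiff_surj hij hs hG
  exact ⟨G', h1, h4 r hr hi hj h, h2⟩

lemma zPow_mem_vanishAt {i j s : ι} (hij : i ≠ j) (hs : s = i ∨ s = j) (m : ℤ) {M : ℕ}
    {F : Func n ι P} (hF : F ∈ vanishAt s M) : zPow i j s m F ∈ vanishAt s M := by
  refine zPow_mem_of_zDiff hij hs _ (fun G hG => sub_mem (mulSlot_mem_vanishAt _ _ hG)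
    (mulSlot_mem_vanishAt _ _ hG)) (fun G hG h => ?_) m
    (fun y => ⟨M, fun x _ => hF x⟩) hF
  obtain ⟨G', h1, h2, h3, -⟩ := zDiff_surj hij hs hG
  exact ⟨G', h1, h3 M h, h2⟩

/-- On the functionals adapted to an ordering of the variables, the expanded powers of the
differences `z_i - z_j` commute. -/
lemma zPow_comm {i j s k l t : ι} (hij : i ≠ j) (hs : s = i ∨ s = j) (hkl : k ≠ l)
    (ht : t = k ∨ t = l) {r : ι → ℕ} (hr : Function.Injective r) (hi : r i ≤ r s)
    (hj : r j ≤ r s) (hk : r k ≤ r t) (hl : r l ≤ r t) (m p : ℤ) {F : Func n ι P}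
    (hF : F ∈ ordered r) :
    zPow i j s m (zPow k l t p F) = zPow k l t p (zPow i j s m F) := by
  have hd := ordered_le_expDom (n := n) (P := P) hi hj
  have hd' := ordered_le_expDom (n := n) (P := P) hk hl
  have hm : ∀ m, zPow i j s m F ∈ ordered r := fun m => zPow_mem_ordered hij hs hr hi hj m hF
  have hm' : ∀ m, zPow k l t p (zPow i j s m F) ∈ ordered r := fun m =>
    zPow_mem_ordered hkl ht hr hk hl p (hm m)
  have key := zPow_unique hij hs (fun m => zPow k l t p (zPow i j s m F)) (fun m => hd (hm' m))
    (fun m => ?_) m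
  · rw [← key, zPow_zero (hd hF)]
  · have e : zPow k l t p (zDiff i j (zPow i j s m F)) =
        zDiff i j (zPow k l t p (zPow i j s m F)) := by
      have hz : ∀ q, zDiff i j (zPow k l t q (zPow i j s m F)) ∈ expDom k l t := fun q =>
        zDiff_mem_vanish _ _ (zPow_mem q (hd' (hm m)))
      have := zPow_unique hkl ht (fun q => zDiff i j (zPow k l t q (zPow i j s m F))) hz
        (fun q => by rw [zDiff_comm, zDiff_zPow hkl ht _ (hd' (hm m))]) p
      rw [← this, zPow_zero (hd' (hm m))]
    rw [← e, zDiff_zPow hij hs _ (hd hF)]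

lemma slotMap_dK_mem_vanish {l : ι} {s : Set ι} (j : ι) {F : Func n ι P} (hF : F ∈ vanish l s) :
    slotMap j (dK n : Module.End (An n) (Kn n)) F ∈ vanish l s :=
  slotMap_mem_vanish j (fun M => ⟨M + 1, fun _ hh => Jn_dK n hh⟩) hF

lemma dK_zK : dK n (zK n) = 1 := by
  rw [zK, dK_algebraMap, PowerSeries.derivative_X, map_one]

/-- The Leibniz rule for the powers of `z_i - z_j` and the derivative with respect to `z_j`. -/
lemma zPow_slotMap_dK {i j s : ι} (hij : i ≠ j) (hs : s = i ∨ s = j) (m : ℤ) {F : Func n ι P}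
    (hF : F ∈ expDom i j s) :
    zPow i j s m (slotMap j (dK n : Module.End (An n) (Kn n)) F) =
      slotMap j (dK n : Module.End (An n) (Kn n)) (zPow i j s m F)
        - (m : An n) • zPow i j s (m - 1) F := by
  have hc : ∀ G : Func n ι P, zDiff i j (slotMap j (dK n : Module.End (An n) (Kn n)) G) =
      slotMap j (dK n : Module.End (An n) (Kn n)) (zDiff i j G) - G := by
    intro G
    ext x
    simp only [zDiff_apply, sub_apply, mulSlot_apply, slotMap_apply, Function.update_self,
      Function.update_idem, Function.update_of_ne hij, Function.update_of_ne hij.symm,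
      Derivation.coeFn_coe, Derivation.leibniz, dK_zK, smul_eq_mul, mul_one,
      MultilinearMap.map_update_add, Function.update_eq_self]
    rw [Function.update_comm hij]
    abel
  -- both sides satisfy the same recursion in `m` and agree for `m = 0`
  have := zPow_unique hij hs (fun m => slotMap j (dK n : Module.End (An n) (Kn n))
    (zPow i j s m F) - (m : An n) • zPow i j s (m - 1) F)
    (fun m => sub_mem (slotMap_dK_mem_vanish j (zPow_mem m hF))
      (Submodule.smul_mem _ _ (zPow_mem _ hF))) (fun m => ?_) m
  · rw [← this, zPow_zero hF, Int.cast_zero, zero_smul, sub_zero]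
  · rw [map_sub, map_smul, hc, zDiff_zPow hij hs _ hF, zDiff_zPow hij hs _ hF, sub_add_cancel,
      add_sub_cancel_right, Int.cast_add, add_smul, Int.cast_one, one_smul]
    abel

lemma compMultilinearMap_zPow {i j s : ι} (hij : i ≠ j) (hs : s = i ∨ s = j) (T : P →ₗ[An n] Q)
    (m : ℤ) {F : Func n ι P} (hF : F ∈ expDom i j s) :
    T.compMultilinearMap (zPow i j s m F) = zPow i j s m (T.compMultilinearMap F) := by
  refine map_zPow hij hs hij hs (AddMonoidHom.mk' (fun G => T.compMultilinearMap G)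
    fun G G' => ?_) (fun G hG y => ?_) (fun G => ?_) m hF
  · ext x; simp
  · obtain ⟨M, hM⟩ := hG y
    refine ⟨M, fun x hx hl => ?_⟩
    change T (G x) = 0
    rw [hM x hx hl, map_zero]
  · ext x
    change T _ = T _ - T _
    rw [← map_sub]; rfl

/-- The functional of two variables obtained by freezing all the variables but `i` and `j`. -/
def slice (i j : ι) (hij : i ≠ j) (x : ι → Kn n) : Func n ι P →ₗ[An n] Func n (Fin 2) P where
  toFun F :=
    { toFun := fun y => F (Function.update (Function.update x i (y 0)) j (y 1))
      map_update_add' := by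
        intro d y k f h
        obtain rfl := Subsingleton.elim (instDecidableEqFin 2) d
        fin_cases k
        · simp [Function.update_comm hij]
        · simp
      map_update_smul' := by
        intro d y k a f
        obtain rfl := Subsingleton.elim (instDecidableEqFin 2) d
        fin_cases k
        · simp [Function.update_comm hij]
        · simp }
  map_add' _ _ := rfl
  map_smul' _ _ := rfl

lemma slice_apply {i j : ι} (hij : i ≠ j) (x : ι → Kn n) (F : Func n ι P) (y : Fin 2 → Kn n) :
    slice i j hij x F y = F (Function.update (Function.update x i (y 0)) j (y 1)) := rfl

lemma slice_zDiff {i j : ι} (hij : i ≠ j) (x : ι → Kn n) (F : Func n ι P) :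
    slice i j hij x (zDiff i j F) = zDiff 0 1 (slice i j hij x F) := by
  ext y
  simp only [slice_apply, zDiff_apply, sub_apply, mulSlot_apply, Function.update_self,
    Function.update_idem, Function.update_of_ne hij, ne_eq, zero_ne_one, one_ne_zero,
    not_false_eq_true, Function.update_of_ne]
  rw [Function.update_comm (β := fun _ => Kn n) hij.symm (y 1) (zK n * y 0), Function.update_idem]

lemma slice_mem_expDom {i j s : ι} {s' : Fin 2} (hij : i ≠ j)
    (hs : s = i ∧ s' = 0 ∨ s = j ∧ s' = 1) (x : ι → Kn n) {F : Func n ι P}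
    (hF : F ∈ expDom i j s) : slice i j hij x F ∈ expDom 0 1 s' := by
  intro y
  obtain ⟨M, hM⟩ := hF x
  refine ⟨M, fun y _ hy => ?_⟩
  rw [slice_apply]
  apply hM
  · intro k hk
    simp only [Set.mem_compl_iff, Set.mem_insert_iff, Set.mem_singleton_iff, not_or] at hk
    rw [Function.update_of_ne hk.2, Function.update_of_ne hk.1]
  · rcases hs with ⟨rfl, rfl⟩ | ⟨rfl, rfl⟩
    · rw [Function.update_of_ne hij, Function.update_self]; exact hy
    · rw [Function.update_self]; exact hy

lemma slice_zPow {i j s : ι} {s' : Fin 2} (hij : i ≠ j)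
    (hs : s = i ∧ s' = 0 ∨ s = j ∧ s' = 1) (x : ι → Kn n) (m : ℤ) {F : Func n ι P}
    (hF : F ∈ expDom i j s) :
    slice i j hij x (zPow i j s m F) = zPow 0 1 s' m (slice i j hij x F) :=
  map_zPow hij (hs.imp And.left And.left) (by decide) (hs.imp And.right And.right)
    (slice i j hij x).toAddMonoidHom (fun _ hG => slice_mem_expDom hij hs x hG)
    (slice_zDiff hij x) m hF

end Functionals

/-! ### The products of fields and expanded powers of `z - w` -/

section ZW

variable (n : ℕ) (i : Fin 2)

lemma KK_hasBasis : (nhds (0 : KK n i)).HasBasis (fun _ : ℕ => True)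
    fun N => (KKnhd n i N : Set (KK n i)) := (KK_basis n i).hasBasis_nhds_zero

lemma tmul_pow (f h : Kn n) (N : ℕ) :
    KK.tmul n i f h ^ N = KK.tmul n i (f ^ N) (h ^ N) := by
  induction N with
  | zero => simp only [pow_zero]; rfl
  | succ N ih => rw [pow_succ, ih, KK_tmul_mul, pow_succ, pow_succ]

/-- In the completion of `K_n ⊗ K_n`, `1 - τ` is invertible when `τ ^ N` lies in the `N`-th
neighbourhood of `0`. -/
lemma isUnit_one_sub {τ : KK n i} (hτ : ∀ N, τ ^ N ∈ KKnhd n i N) :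
    IsUnit (1 - (τ : KKhat n i)) := by
  set s : ℕ → KK n i := fun N => ∑ k ∈ Finset.range N, τ ^ k
  have hC : CauchySeq s := by
    rw [(KK_hasBasis n i).uniformity_of_nhds_zero.cauchySeq_iff]
    have key : ∀ N m l, N ≤ m → m ≤ l → s l - s m ∈ KKnhd n i N := by
      intro N m l hm hl
      rw [← Finset.sum_Ico_eq_sub _ hl]
      exact sum_mem fun k hk => KKnhd_anti n i (hm.trans (Finset.mem_Ico.1 hk).1) (hτ k)
    intro N _
    refine ⟨N, fun m hm l hl => ?_⟩
    rcases le_total m l with h | h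
    · exact key N m l hm h
    · have := (KKnhd n i N).neg_mem (key N l m hl h)
      rwa [neg_sub] at this
  obtain ⟨S, hS⟩ := cauchySeq_tendsto_of_complete
    ((UniformSpace.Completion.uniformContinuous_coe (KK n i)).comp_cauchySeq hC)
  have h1 : Filter.Tendsto (fun N => (1 - (τ : KKhat n i)) * (s N : KKhat n i)) Filter.atTop
      (nhds ((1 - (τ : KKhat n i)) * S)) := hS.const_mul _
  have h2 : Filter.Tendsto (fun N => (τ ^ N : KK n i)) Filter.atTop (nhds 0) :=
    ((KK_hasBasis n i).tendsto_right_iff).2 fun N _ =>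
      Filter.eventually_atTop.2 ⟨N, fun m hm => KKnhd_anti n i hm (hτ m)⟩
  have h3 : Filter.Tendsto (fun N => ((1 - τ ^ N : KK n i) : KKhat n i)) Filter.atTop
      (nhds ((1 - 0 : KK n i) : KKhat n i)) :=
    ((UniformSpace.Completion.continuous_coe _).tendsto _).comp (tendsto_const_nhds.sub h2)
  have e : (fun N => (1 - (τ : KKhat n i)) * (s N : KKhat n i)) =
      fun N => ((1 - τ ^ N : KK n i) : KKhat n i) := by
    funext N
    rw [← UniformSpace.Completion.coe_one, ← UniformSpace.Completion.coe_sub,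
      ← UniformSpace.Completion.coe_mul, mul_neg_geom_sum]
  rw [e] at h1
  refine IsUnit.of_mul_eq_one S ?_
  rw [tendsto_nhds_unique h1 h3, sub_zero, UniformSpace.Completion.coe_one]

/-- In either completion, `φ(z) - φ(w)` is invertible by a geometric series in the quotient of
`φ(z)` and `φ(w)` that is topologically nilpotent there. -/
lemma isUnit_phi_sub : IsUnit (tmulHat n i (phiK n) 1 - tmulHat n i 1 (phiK n)) := by
  have hinv : ∀ f : KK n i, ∀ g, f * g = 1 → IsUnit (f : KKhat n i) := fun f g h =>
    IsUnit.of_mul_eq_one (g : KKhat n i) (by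
      rw [← UniformSpace.Completion.coe_mul, h, UniformSpace.Completion.coe_one])
  have h1 : KK.tmul n i (phiK n) 1 * KK.tmul n i (phiInv n) 1 = 1 := by
    rw [KK_tmul_mul, phiK_mul_phiInv, one_mul]; rfl
  have h2 : KK.tmul n i 1 (phiK n) * KK.tmul n i 1 (phiInv n) = 1 := by
    rw [KK_tmul_mul, phiK_mul_phiInv, one_mul]; rfl
  have hphi : ∀ N, phiK n ^ N ∈ Jn n N := fun N => ⟨1, by rw [map_one, mul_one]⟩
  by_cases hi : i = 0
  · subst hi
    have e : tmulHat n 0 (phiK n) 1 - tmulHat n 0 1 (phiK n) =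
        -(tmulHat n 0 1 (phiK n) * (1 - (KK.tmul n 0 (phiK n) (phiInv n) : KKhat n 0))) := by
      rw [mul_sub, mul_one, neg_sub, tmulHat, tmulHat, ← UniformSpace.Completion.coe_mul,
        KK_tmul_mul, phiK_mul_phiInv, one_mul]
    rw [e]
    refine ((hinv _ _ h2).mul (isUnit_one_sub n 0 fun N => ?_)).neg
    rw [tmul_pow]
    exact Submodule.subset_span ⟨![_, _], hphi N, rfl⟩
  · have hi : i = 1 := by omega
    subst hi
    have e : tmulHat n 1 (phiK n) 1 - tmulHat n 1 1 (phiK n) =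
        tmulHat n 1 (phiK n) 1 * (1 - (KK.tmul n 1 (phiInv n) (phiK n) : KKhat n 1)) := by
      rw [mul_sub, mul_one, tmulHat, tmulHat, ← UniformSpace.Completion.coe_mul,
        KK_tmul_mul, phiK_mul_phiInv, one_mul]
    rw [e]
    refine (hinv _ _ h1).mul (isUnit_one_sub n 1 fun N => ?_)
    rw [tmul_pow]
    exact Submodule.subset_span ⟨![_, _], hphi N, rfl⟩

/-- The element `z - w` is invertible in both completions of `K_n ⊗ K_n`. -/
lemma isUnit_zwHat : IsUnit (zwHat n i) := by
  -- `z - w` divides `φ(z) - φ(w)`, which is invertible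
  have hdvd : KK.tmul n i (zK n) 1 - KK.tmul n i 1 (zK n) ∣
      KK.tmul n i (phiK n) 1 - KK.tmul n i 1 (phiK n) := by
    have h := Polynomial.sub_dvd_eval_sub (KK.tmul n i (zK n) 1) (KK.tmul n i 1 (zK n))
      ((phi n).map (algebraMap (An n) (KK n i)))
    have e1 : Polynomial.aeval (KK.tmul n i (zK n) 1) (phi n) = KK.tmul n i (phiK n) 1 := by
      have := Polynomial.aeval_algHom_apply
        (Algebra.TensorProduct.includeLeft : Kn n →ₐ[An n] Kn n ⊗[An n] Kn n) (zK n) (phi n)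
      rw [aeval_phi] at this
      exact this
    have e2 : Polynomial.aeval (KK.tmul n i 1 (zK n)) (phi n) = KK.tmul n i 1 (phiK n) := by
      have := Polynomial.aeval_algHom_apply
        (Algebra.TensorProduct.includeRight : Kn n →ₐ[An n] Kn n ⊗[An n] Kn n) (zK n) (phi n)
      rw [aeval_phi] at this
      exact this
    rwa [Polynomial.eval_map_algebraMap, Polynomial.eval_map_algebraMap, e1, e2] at h
  obtain ⟨g, hg⟩ := hdvd
  have e : tmulHat n i (phiK n) 1 - tmulHat n i 1 (phiK n) = zwHat n i * (g : KKhat n i) := by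
    rw [zwHat, tmulHat, tmulHat, tmulHat, tmulHat, ← UniformSpace.Completion.coe_sub,
      ← UniformSpace.Completion.coe_sub, ← UniformSpace.Completion.coe_mul, hg]
  exact isUnit_of_mul_isUnit_left (e ▸ isUnit_phi_sub n i)

lemma zwHat_mul_zwPow (m : ℤ) : zwHat n i * zwPow n i m = zwPow n i (m + 1) := by
  have h := Ring.mul_inverse_cancel _ (isUnit_zwHat n i)
  match m with
  | Int.ofNat m => exact (pow_succ' (zwHat n i) m).symm
  | Int.negSucc 0 =>
    change zwHat n i * Ring.inverse (zwHat n i) ^ (0 + 1) = zwHat n i ^ 0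
    rw [zero_add, pow_one, h, pow_zero]
  | Int.negSucc (m + 1) =>
    change zwHat n i * Ring.inverse (zwHat n i) ^ (m + 1 + 1) =
      Ring.inverse (zwHat n i) ^ (m + 1)
    rw [pow_succ', ← mul_assoc, h, one_mul]

lemma zwPow_zero : zwPow n i 0 = 1 := pow_zero _

lemma tmulHat_mul (a b c d : Kn n) :
    tmulHat n i a b * tmulHat n i c d = tmulHat n i (a * c) (b * d) := by
  rw [tmulHat, tmulHat, ← UniformSpace.Completion.coe_mul, KK_tmul_mul]; rfl

lemma tmulHat_add_left (a b c : Kn n) :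
    tmulHat n i (a + b) c = tmulHat n i a c + tmulHat n i b c := by
  rw [tmulHat, tmulHat, tmulHat, ← UniformSpace.Completion.coe_add]
  exact congrArg _ (TensorProduct.add_tmul a b c)

lemma tmulHat_add_right (a b c : Kn n) :
    tmulHat n i a (b + c) = tmulHat n i a b + tmulHat n i a c := by
  rw [tmulHat, tmulHat, tmulHat, ← UniformSpace.Completion.coe_add]
  exact congrArg _ (TensorProduct.tmul_add a b c)

lemma tmulHat_smul_left (a : An n) (f h : Kn n) :
    tmulHat n i (a • f) h = (algebraMap (An n) (KK n i) a : KKhat n i) * tmulHat n i f h := by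
  rw [tmulHat, tmulHat, ← UniformSpace.Completion.coe_mul, ← Algebra.smul_def]; rfl

lemma tmulHat_smul_right (a : An n) (f h : Kn n) :
    tmulHat n i f (a • h) = (algebraMap (An n) (KK n i) a : KKhat n i) * tmulHat n i f h := by
  rw [tmulHat, tmulHat, ← UniformSpace.Completion.coe_mul, ← Algebra.smul_def]
  exact congrArg _ (TensorProduct.tmul_smul a f h)

end ZW

/-- A topology on a ring with a basis of neighbourhoods of `0` made of a sequence of left
ideals. -/
class LeftLinear (U : Type*) [Ring U] [TopologicalSpace U] where
  nhd : ℕ → Ideal U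
  hasBasis : (nhds (0 : U)).HasBasis (fun _ : ℕ => True) fun N => (nhd N : Set U)

section Products

variable {n : ℕ} {U : Type*} [Ring U] [UniformSpace U] [IsUniformAddGroup U]
  [IsTopologicalRing U] [Algebra (An n) U] [ContinuousConstSMul (An n) U]

@[ext] lemma KField.ext {a b : KField n U} (h : ∀ f, a f = b f) : a = b := DFunLike.ext _ _ h

lemma KField.map_add (a : KField n U) (f h : Kn n) : a (f + h) = a f + a h := a.lin.map_add f h
lemma KField.map_neg (a : KField n U) (f : Kn n) : a (-f) = -a f := a.lin.map_neg f
lemma KField.add_apply (a b : KField n U) (f : Kn n) : (a + b) f = a f + b f := rfl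
lemma KField.zero_apply (f : Kn n) : (0 : KField n U) f = 0 := rfl
lemma KField.sub_apply (a b : KField n U) (f : Kn n) : (a - b) f = a f - b f := rfl
lemma KField.smul_apply (c : An n) (a : KField n U) (f : Kn n) : (c • a) f = c • a f := rfl
lemma KField.complex_smul_eq (c : ℂ) (a : KField n U) : c • a = algebraMap ℂ (An n) c • a := rfl
lemma KField.deriv_apply (a : KField n U) (f : Kn n) : a.deriv f = a (-dK n f) := rfl
lemma oneField_apply (f : Kn n) : oneField n U f = algebraMap (An n) U (residue n f) := rfl

lemma KField.continuous (a : KField n U) : Continuous a :=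
  ContinuousLinearMap.continuous (show Kn n →L[An n] U from a)

variable [L : LeftLinear U]

lemma KField.exists_mem_nhd (a : KField n U) (N : ℕ) :
    ∃ M, ∀ f ∈ Jn n M, a f ∈ L.nhd N := by
  have h := a.continuous.tendsto 0
  rw [show a 0 = 0 from a.lin.map_zero, (Kn_nhds n).tendsto_iff L.hasBasis] at h
  obtain ⟨M, -, hM⟩ := h N trivial
  exact ⟨M, hM⟩

/-- A linear map from `K_n` that is small near `0` is a field. -/
def KField.mk' (a : Kn n →ₗ[An n] U) (h : ∀ N, ∃ M, ∀ f ∈ Jn n M, a f ∈ L.nhd N) : KField n U :=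
  (⟨a, by
    change Continuous a.toAddMonoidHom
    refine continuous_of_continuousAt_zero _ ?_
    rw [ContinuousAt, _root_.map_zero, (Kn_nhds n).tendsto_iff L.hasBasis]
    exact fun N _ => (h N).imp fun M hM => ⟨trivial, hM⟩⟩ : Kn n →L[An n] U)

lemma exists_mul_mem_nhd (u : U) (N : ℕ) : ∃ M, ∀ v ∈ L.nhd M, v * u ∈ L.nhd N := by
  have h : Filter.Tendsto (fun v => v * u) (nhds 0) (nhds 0) := by
    have := (continuous_mul_const u).tendsto 0
    rwa [zero_mul] at this
  obtain ⟨M, -, hM⟩ := (L.hasBasis.tendsto_iff L.hasBasis).1 h N trivial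
  exact ⟨M, hM⟩

variable (n) in
/-- Reduction modulo the `N`-th left ideal. -/
def red (N : ℕ) : U →ₗ[An n] U ⧸ L.nhd N := (L.nhd N).mkQ.restrictScalars (An n)

lemma red_eq_zero {N : ℕ} {u : U} : red n N u = 0 ↔ u ∈ L.nhd N :=
  Submodule.Quotient.mk_eq_zero _

lemma eq_of_red [T0Space U] {u v : U} (h : ∀ N, red n N u = red n N v) : u = v := by
  have : u - v = 0 := by
    by_contra hne
    obtain ⟨V, hV, hn⟩ := (t1Space_iff_exists_open.1 inferInstance) (Ne.symm hne)
    obtain ⟨N, -, hN⟩ := L.hasBasis.mem_iff.1 (hV.mem_nhds hn.1)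
    exact hn.2 (hN (red_eq_zero (n := n).1 (by rw [map_sub, h N, sub_self])))
  exact sub_eq_zero.1 this

lemma nhd_smul_mem {N : ℕ} (c : An n) {u : U} (hu : u ∈ L.nhd N) : c • u ∈ L.nhd N := by
  rw [Algebra.smul_def]; exact (L.nhd N).mul_mem_left _ hu

variable (n) in
/-- Left multiplication by `u` on the quotient by a left ideal. -/
def leftMul (N : ℕ) (u : U) : (U ⧸ L.nhd N) →ₗ[An n] U ⧸ L.nhd N where
  toFun q := u • q
  map_add' := smul_add u
  map_smul' c q := by
    rw [RingHom.id_apply, ← algebraMap_smul U c q, ← algebraMap_smul U c (u • q), smul_smul,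
      smul_smul, Algebra.commutes]

lemma leftMul_red (N : ℕ) (u v : U) : leftMul n N u (red n N v) = red n N (u * v) := rfl

variable (n) in
/-- Right multiplication by `u` between the quotients by two left ideals. -/
def rightMul {M N : ℕ} {u : U} (h : ∀ v ∈ L.nhd M, v * u ∈ L.nhd N) :
    (U ⧸ L.nhd M) →ₗ[An n] U ⧸ L.nhd N :=
  ((L.nhd M).mapQ (L.nhd N) (LinearMap.toSpanSingleton U U u) h).restrictScalars (An n)

lemma rightMul_red {M N : ℕ} {u : U} (h : ∀ v ∈ L.nhd M, v * u ∈ L.nhd N) (v : U) :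
    rightMul n h (red n M v) = red n N (v * u) := rfl

/-- The product of the fields `c 0 (z_0), …, c (s - 1) (z_{s - 1})`, taken in the order
`π 0, …, π (s - 1)`. -/
def prodFunc {s : ℕ} (c : Fin s → KField n U) (π : Equiv.Perm (Fin s)) : Func n (Fin s) U :=
  ((MultilinearMap.mkPiAlgebraFin (An n) s U).compLinearMap fun k => (c (π k)).lin).domDomCongr π

lemma prodFunc_apply {s : ℕ} (c : Fin s → KField n U) (π : Equiv.Perm (Fin s))
    (x : Fin s → Kn n) :
    prodFunc c π x = (List.ofFn fun k => c (π k) (x (π k))).prod := rfl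

/-- The reduction of `prodFunc` modulo the `N`-th left ideal. -/
def prodMod {s : ℕ} (N : ℕ) (c : Fin s → KField n U) (π : Equiv.Perm (Fin s)) :
    Func n (Fin s) (U ⧸ L.nhd N) := (red n N).compMultilinearMap (prodFunc c π)

lemma prodMod_apply {s : ℕ} (N : ℕ) (c : Fin s → KField n U) (π : Equiv.Perm (Fin s))
    (x : Fin s → Kn n) : prodMod N c π x = red n N (prodFunc c π x) := rfl

/-- A product is small as soon as one factor is, depending on the factors to its right. -/
lemma exists_prod_mem_nhd {s : ℕ} (k : Fin s) (y : Fin s → U) (N : ℕ) :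
    ∃ M, ∀ u : Fin s → U, (∀ l, k < l → u l = y l) → u k ∈ L.nhd M →
      (List.ofFn u).prod ∈ L.nhd N := by
  induction s with
  | zero => exact k.elim0
  | succ s ih =>
    refine Fin.cases ?_ (fun k => ?_) k
    · obtain ⟨M, hM⟩ := exists_mul_mem_nhd (List.ofFn fun l : Fin s => y l.succ).prod N
      refine ⟨M, fun u hu h0 => ?_⟩
      have e : (fun l : Fin s => u l.succ) = fun l => y l.succ :=
        funext fun l => hu _ (Fin.succ_pos l)
      rw [List.ofFn_succ, List.prod_cons, e]
      exact hM _ h0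
    · obtain ⟨M, hM⟩ := ih k (fun l => y l.succ)
      refine ⟨M, fun u hu h0 => ?_⟩
      rw [List.ofFn_succ, List.prod_cons]
      exact (L.nhd N).mul_mem_left _ (hM _ (fun l hl => hu _ (Fin.succ_lt_succ_iff.2 hl)) h0)

/-- Modulo a left ideal, a product of fields is continuous in each factor, in a way that depends
only on the factors to its right. -/
lemma prodMod_mem_ordered {s : ℕ} (N : ℕ) (c : Fin s → KField n U) (π : Equiv.Perm (Fin s)) :
    prodMod N c π ∈ ordered (n := n) fun i => (π⁻¹ i : ℕ) := by
  rw [mem_ordered]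
  intro l y
  obtain ⟨M, hM⟩ := exists_prod_mem_nhd (π⁻¹ l) (fun k => c (π k) (y (π k))) N
  obtain ⟨M', hM'⟩ := (c l).exists_mem_nhd M
  refine ⟨M', fun x hx hl => ?_⟩
  rw [prodMod_apply, red_eq_zero, prodFunc_apply]
  apply hM
  · intro k hk
    rw [hx (π k) (by simpa using hk)]
  · simpa using hM' _ hl

section Extension

variable {i : Fin 2} (E : KKhat n i →+ U) (hc : Continuous E)
  (hE : ∀ (a : An n) t, E ((algebraMap (An n) (KK n i) a : KK n i) * t) = a • E t)

/-- The functional `(f, h) ↦ E (t * (f ⊗ h))` attached to an additive map `E` on the completed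
tensor product. -/
def extFunc (t : KKhat n i) : Func n (Fin 2) U where
  toFun x := E (t * tmulHat n i (x 0) (x 1))
  map_update_add' := by
    intro d x k f h
    obtain rfl := Subsingleton.elim (instDecidableEqFin 2) d
    fin_cases k <;> simp [tmulHat_add_left, tmulHat_add_right, mul_add]
  map_update_smul' := by
    intro d x k a f
    obtain rfl := Subsingleton.elim (instDecidableEqFin 2) d
    fin_cases k <;> simp [tmulHat_smul_left, tmulHat_smul_right, mul_left_comm t, hE]

lemma zDiff_extFunc (t : KKhat n i) :
    zDiff 0 1 (extFunc E hE t) = extFunc E hE (zwHat n i * t) := by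
  ext x
  rw [zDiff_apply, sub_apply, mulSlot_apply, mulSlot_apply]
  change E (t * tmulHat n i (zK n * x 0) (x 1)) - E (t * tmulHat n i (x 0) (zK n * x 1)) =
    E (zwHat n i * t * tmulHat n i (x 0) (x 1))
  rw [← map_sub, ← mul_sub, mul_comm (zwHat n i), mul_assoc, zwHat, sub_mul, tmulHat_mul,
    tmulHat_mul, one_mul, one_mul]

include hc in
lemma red_extFunc_mem (N : ℕ) (t : KKhat n i) :
    (red n N).compMultilinearMap (extFunc E hE t) ∈ expDom 0 1 i := by
  have h : Filter.Tendsto (fun x : KK n i => E (t * (x : KKhat n i))) (nhds 0) (nhds 0) := by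
    have : Continuous (fun x : KK n i => E (t * (x : KKhat n i))) :=
      hc.comp (continuous_const.mul (UniformSpace.Completion.continuous_coe _))
    have h0 := this.tendsto 0
    rwa [UniformSpace.Completion.coe_zero, mul_zero, map_zero] at h0
  obtain ⟨M, -, hM⟩ := ((KK_hasBasis n i).tendsto_iff L.hasBasis).1 h N trivial
  refine fun _ => ⟨M, fun x _ hx => (red_eq_zero (n := n)).2 (hM _ ?_)⟩
  exact Submodule.subset_span ⟨x, hx, rfl⟩

include hc in
/-- Multiplication by `(z - w) ^ m` in the completed tensor product corresponds to the expanded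
power of `z_0 - z_1` on functionals. Both are determined by the recursion in `m`. -/
lemma zPow_red_extFunc (N : ℕ) (m : ℤ) :
    zPow 0 1 i m ((red n N).compMultilinearMap (extFunc E hE 1)) =
      (red n N).compMultilinearMap (extFunc E hE (zwPow n i m)) := by
  rw [← zwPow_zero n i]
  refine zPow_unique (by decide) (by omega)
    (fun m => (red n N).compMultilinearMap (extFunc E hE (zwPow n i m)))
    (fun m => red_extFunc_mem E hc hE N _) (fun m => ?_) m
  rw [← zwHat_mul_zwPow, ← zDiff_extFunc]
  ext x
  exact (map_sub (red n N) _ _).symm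

end Extension

variable [T0Space U] [CompleteSpace U]

lemma extension_smul {i : Fin 2} (μ : KK n i →ₗ[An n] U) (hμ : Continuous μ.toAddMonoidHom)
    (a : An n) (t : KKhat n i) :
    (μ.toAddMonoidHom.extension hμ) ((algebraMap (An n) (KK n i) a : KK n i) * t) =
      a • (μ.toAddMonoidHom.extension hμ) t := by
  induction t using UniformSpace.Completion.induction_on with
  | hp =>
    have hcont : Continuous (μ.toAddMonoidHom.extension hμ) :=
      UniformSpace.Completion.continuous_extension
    exact isClosed_eq (hcont.comp (continuous_const.mul continuous_id)) (hcont.const_smul a)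
  | ih x =>
    rw [← UniformSpace.Completion.coe_mul, ← Algebra.smul_def]
    rw [AddMonoidHom.extension_coe, AddMonoidHom.extension_coe]
    exact μ.map_smul a x

lemma continuous_of_small {i : Fin 2} (μ : KK n i →ₗ[An n] U)
    (h : ∀ N, ∃ M, ∀ f : Fin 2 → Kn n, f i ∈ Jn n M → μ (KK.tmul n i (f 0) (f 1)) ∈ L.nhd N) :
    Continuous μ.toAddMonoidHom := by
  refine continuous_of_continuousAt_zero _ ?_
  rw [ContinuousAt, map_zero, (KK_hasBasis n i).tendsto_iff L.hasBasis]
  intro N _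
  obtain ⟨M, hM⟩ := h N
  refine ⟨M, trivial, fun x hx => ?_⟩
  change μ x ∈ L.nhd N
  induction hx using Submodule.span_induction with
  | zero => rw [map_zero]; exact zero_mem _
  | add x y _ _ hx hy => rw [map_add]; exact add_mem hx hy
  | smul a x _ hx => rw [map_smul]; exact nhd_smul_mem a hx
  | mem x hx => obtain ⟨f, hf, rfl⟩ := hx; exact hM f hf

/-- `mulMap` on the tensor product with the `2`-topology. -/
def mulLin (a b : KField n U) : KK n 1 →ₗ[An n] U := mulMap a b

/-- `mulMap ∘ σ` on the tensor product with the `1`-topology. -/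
def mulSwapLin (a b : KField n U) : KK n 0 →ₗ[An n] U :=
  mulMap b a ∘ₗ (TensorProduct.comm (An n) (Kn n) (Kn n)).toLinearMap

lemma continuous_mulLin (a b : KField n U) : Continuous (mulLin a b).toAddMonoidHom :=
  continuous_of_small _ fun N => (b.exists_mem_nhd N).imp fun _ hM _ hf =>
    (L.nhd N).mul_mem_left _ (hM _ hf)

lemma continuous_mulSwapLin (a b : KField n U) : Continuous (mulSwapLin a b).toAddMonoidHom :=
  continuous_of_small _ fun N => (a.exists_mem_nhd N).imp fun _ hM _ hf =>
    (L.nhd N).mul_mem_left _ (hM _ hf)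

/-- The functional of two variables whose value at `(1, f)` is `(a_(m) b)(f)`, as a difference of
two expansions. -/
def nProdFunc (m : ℤ) (a b : KField n U) : Func n (Fin 2) U :=
  extFunc ((mulLin a b).toAddMonoidHom.extension (continuous_mulLin a b))
      (extension_smul _ _) (zwPow n 1 m) -
    extFunc ((mulSwapLin a b).toAddMonoidHom.extension (continuous_mulSwapLin a b))
      (extension_smul _ _) (zwPow n 0 m)

lemma nProdFunc_apply (m : ℤ) (a b : KField n U) (f : Kn n) :
    nProdFunc m a b ![1, f] = nProdVal m a b f := rfl

/-- The products of two fields in the order `a b`, modulo a left ideal. -/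
abbrev duo (N : ℕ) (a b : KField n U) : Func n (Fin 2) (U ⧸ L.nhd N) := prodMod N ![a, b] 1

/-- The products of two fields in the order `b a`, modulo a left ideal. -/
abbrev duoSwap (N : ℕ) (a b : KField n U) : Func n (Fin 2) (U ⧸ L.nhd N) :=
  prodMod N ![a, b] (Equiv.swap 0 1)

lemma duo_apply (N : ℕ) (a b : KField n U) (x : Fin 2 → Kn n) :
    duo N a b x = red n N (a (x 0) * b (x 1)) := by
  rw [prodMod_apply, prodFunc_apply]; simp

lemma duoSwap_apply (N : ℕ) (a b : KField n U) (x : Fin 2 → Kn n) :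
    duoSwap N a b x = red n N (b (x 1) * a (x 0)) := by
  rw [prodMod_apply, prodFunc_apply]; simp

lemma duo_mem_expDom (N : ℕ) (a b : KField n U) : duo N a b ∈ expDom 0 1 1 :=
  ordered_le_expDom (by decide) (by decide) (prodMod_mem_ordered N _ _)

lemma duoSwap_mem_expDom (N : ℕ) (a b : KField n U) : duoSwap N a b ∈ expDom 0 1 0 :=
  ordered_le_expDom (by decide) (by decide) (prodMod_mem_ordered N _ _)

/-- The products of fields modulo the left ideals: `(z - w) ^ m` is expanded in the two domains
`|z| > |w|` and `|w| > |z|`. -/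
lemma red_nProdFunc (N : ℕ) (m : ℤ) (a b : KField n U) :
    (red n N).compMultilinearMap (nProdFunc m a b) =
      zPow 0 1 1 m (duo N a b) - zPow 0 1 0 m (duoSwap N a b) := by
  have h1 := zPow_red_extFunc ((mulLin a b).toAddMonoidHom.extension (continuous_mulLin a b))
    UniformSpace.Completion.continuous_extension (extension_smul _ _) N m
  have h2 := zPow_red_extFunc
    ((mulSwapLin a b).toAddMonoidHom.extension (continuous_mulSwapLin a b))
    UniformSpace.Completion.continuous_extension (extension_smul _ _) N m
  have e1 : duo N a b = (red n N).compMultilinearMap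
      (extFunc ((mulLin a b).toAddMonoidHom.extension (continuous_mulLin a b))
        (extension_smul _ _) 1) := by
    ext x
    rw [duo_apply]
    change _ = red n N (((mulLin a b).toAddMonoidHom.extension (continuous_mulLin a b)) (1 * _))
    rw [one_mul, tmulHat, AddMonoidHom.extension_coe]
    rfl
  have e2 : duoSwap N a b = (red n N).compMultilinearMap
      (extFunc ((mulSwapLin a b).toAddMonoidHom.extension (continuous_mulSwapLin a b))
        (extension_smul _ _) 1) := by
    ext x
    rw [duoSwap_apply]
    change _ = red n N
      (((mulSwapLin a b).toAddMonoidHom.extension (continuous_mulSwapLin a b)) (1 * _))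
    rw [one_mul, tmulHat, AddMonoidHom.extension_coe]
    rfl
  rw [e1, e2, h1, h2]
  ext x
  exact map_sub (red n N) _ _

/-- The `m`-th product of two fields. -/
def nProd (m : ℤ) (a b : KField n U) : KField n U :=
  KField.mk' ((nProdFunc m a b).toLinearMap ![1, 0] 1) fun N => by
    have h1 := zPow_mem_ordered (by decide : (0 : Fin 2) ≠ 1) (Or.inr rfl)
      (Fin.val_injective.comp (1 : Equiv.Perm (Fin 2))⁻¹.injective) (by decide) (by decide) m
      (prodMod_mem_ordered N ![a, b] 1)
    have h2 := zPow_mem_ordered (by decide : (0 : Fin 2) ≠ 1) (Or.inl rfl)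
      (Fin.val_injective.comp (Equiv.swap (0 : Fin 2) 1)⁻¹.injective) (by decide) (by decide) m
      (prodMod_mem_ordered N ![a, b] (Equiv.swap 0 1))
    obtain ⟨M, hM⟩ := mem_ordered.1 h1 1 ![1, 0]
    obtain ⟨M', hM'⟩ := mem_ordered.1 h2 1 ![1, 0]
    refine ⟨max M M', fun f hf => (red_eq_zero (n := n)).1 ?_⟩
    have e : Function.update ![(1 : Kn n), 0] 1 f = ![1, f] := by
      ext k; fin_cases k <;> rfl
    have hr := congrArg (fun G => G ![1, f]) (red_nProdFunc N m a b)
    have hfix : ∀ r : Fin 2 → ℕ, ∀ k, r 1 < r k → ![(1 : Kn n), f] k = ![(1 : Kn n), 0] k := by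
      intro r k hk
      fin_cases k
      · rfl
      · exact absurd hk (lt_irrefl _)
    rw [MultilinearMap.toLinearMap_apply, e]
    refine hr.trans ?_
    rw [sub_apply, hM _ (hfix _) (Jn_anti n (le_max_left _ _) hf),
      hM' _ (hfix _) (Jn_anti n (le_max_right _ _) hf), sub_zero]

lemma nProd_apply (m : ℤ) (a b : KField n U) (f : Kn n) : nProd m a b f = nProdVal m a b f := by
  have e : Function.update ![(1 : Kn n), 0] 1 f = ![1, f] := by
    ext k; fin_cases k <;> rfl
  change nProdFunc m a b (Function.update ![1, 0] 1 f) = _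
  rw [e, nProdFunc_apply]

lemma isNProd_nProd (m : ℤ) (a b : KField n U) : IsNProd m a b (nProd m a b) :=
  nProd_apply m a b

lemma isNProd_iff {m : ℤ} {a b c : KField n U} : IsNProd m a b c ↔ c = nProd m a b :=
  ⟨fun h => KField.ext fun f => (h f).trans (nProd_apply m a b f).symm,
    fun h => h ▸ isNProd_nProd m a b⟩

/-- The value of `a_(m) b` at `f`, modulo a left ideal, is the difference of the expansions of
`(z - w) ^ m a(z) b(w)` and `(z - w) ^ m b(w) a(z)`, paired with `1 ⊗ f`. -/
lemma red_nProd (N : ℕ) (m : ℤ) (a b : KField n U) (f : Kn n) :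
    red n N (nProd m a b f) =
      zPow 0 1 1 m (duo N a b) ![1, f] - zPow 0 1 0 m (duoSwap N a b) ![1, f] := by
  rw [nProd_apply, ← nProdFunc_apply]
  exact congrArg (fun G => G ![1, f]) (red_nProdFunc N m a b)

lemma duo_add_left (N : ℕ) (a a' b : KField n U) : duo N (a + a') b = duo N a b + duo N a' b := by
  ext x
  rw [_root_.add_apply, duo_apply, duo_apply, duo_apply, KField.add_apply, add_mul, map_add]

lemma duo_add_right (N : ℕ) (a b b' : KField n U) : duo N a (b + b') = duo N a b + duo N a b' := by
  ext x
  rw [_root_.add_apply, duo_apply, duo_apply, duo_apply, KField.add_apply, mul_add, map_add]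

lemma duoSwap_add_left (N : ℕ) (a a' b : KField n U) :
    duoSwap N (a + a') b = duoSwap N a b + duoSwap N a' b := by
  ext x
  rw [_root_.add_apply, duoSwap_apply, duoSwap_apply, duoSwap_apply, KField.add_apply, mul_add,
    map_add]

lemma duoSwap_add_right (N : ℕ) (a b b' : KField n U) :
    duoSwap N a (b + b') = duoSwap N a b + duoSwap N a b' := by
  ext x
  rw [_root_.add_apply, duoSwap_apply, duoSwap_apply, duoSwap_apply, KField.add_apply, add_mul,
    map_add]

lemma duo_smul_left (N : ℕ) (c : An n) (a b : KField n U) :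
    duo N (c • a) b = c • duo N a b := by
  ext x
  rw [_root_.smul_apply, duo_apply, duo_apply, KField.smul_apply, smul_mul_assoc, map_smul]

lemma duo_smul_right (N : ℕ) (c : An n) (a b : KField n U) :
    duo N a (c • b) = c • duo N a b := by
  ext x
  rw [_root_.smul_apply, duo_apply, duo_apply, KField.smul_apply, mul_smul_comm, map_smul]

lemma duoSwap_smul_left (N : ℕ) (c : An n) (a b : KField n U) :
    duoSwap N (c • a) b = c • duoSwap N a b := by
  ext x
  rw [_root_.smul_apply, duoSwap_apply, duoSwap_apply, KField.smul_apply, mul_smul_comm, map_smul]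

lemma duoSwap_smul_right (N : ℕ) (c : An n) (a b : KField n U) :
    duoSwap N a (c • b) = c • duoSwap N a b := by
  ext x
  rw [_root_.smul_apply, duoSwap_apply, duoSwap_apply, KField.smul_apply, smul_mul_assoc, map_smul]

lemma nProd_add_left (m : ℤ) (a a' b : KField n U) :
    nProd m (a + a') b = nProd m a b + nProd m a' b := by
  refine KField.ext fun f => eq_of_red (n := n) fun N => ?_
  rw [KField.add_apply, map_add, red_nProd, red_nProd, red_nProd, duo_add_left, duoSwap_add_left,
    zPow_add m (duo_mem_expDom _ _ _) (duo_mem_expDom _ _ _),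
    zPow_add m (duoSwap_mem_expDom _ _ _) (duoSwap_mem_expDom _ _ _), _root_.add_apply,
    _root_.add_apply]
  abel

lemma nProd_add_right (m : ℤ) (a b b' : KField n U) :
    nProd m a (b + b') = nProd m a b + nProd m a b' := by
  refine KField.ext fun f => eq_of_red (n := n) fun N => ?_
  rw [KField.add_apply, map_add, red_nProd, red_nProd, red_nProd, duo_add_right, duoSwap_add_right,
    zPow_add m (duo_mem_expDom _ _ _) (duo_mem_expDom _ _ _),
    zPow_add m (duoSwap_mem_expDom _ _ _) (duoSwap_mem_expDom _ _ _), _root_.add_apply,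
    _root_.add_apply]
  abel

lemma nProd_smul_left (m : ℤ) (c : An n) (a b : KField n U) :
    nProd m (c • a) b = c • nProd m a b := by
  refine KField.ext fun f => eq_of_red (n := n) fun N => ?_
  rw [KField.smul_apply, map_smul, red_nProd, red_nProd, duo_smul_left, duoSwap_smul_left,
    zPow_smul m c (duo_mem_expDom _ _ _), zPow_smul m c (duoSwap_mem_expDom _ _ _),
    _root_.smul_apply, _root_.smul_apply, smul_sub]

lemma nProd_smul_right (m : ℤ) (c : An n) (a b : KField n U) :
    nProd m a (c • b) = c • nProd m a b := by
  refine KField.ext fun f => eq_of_red (n := n) fun N => ?_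
  rw [KField.smul_apply, map_smul, red_nProd, red_nProd, duo_smul_right, duoSwap_smul_right,
    zPow_smul m c (duo_mem_expDom _ _ _), zPow_smul m c (duoSwap_mem_expDom _ _ _),
    _root_.smul_apply, _root_.smul_apply, smul_sub]

/-- The translation axiom `∂(a_(m) b) - a_(m) ∂b = -m a_(m - 1) b`. -/
lemma deriv_nProd (m : ℤ) (a b : KField n U) :
    (nProd m a b).deriv - nProd m a b.deriv = -(m : An n) • nProd (m - 1) a b := by
  refine KField.ext fun f => eq_of_red (n := n) fun N => ?_
  have h1 : duo N a b.deriv =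
      -slotMap 1 (dK n : Module.End (An n) (Kn n)) (duo N a b) := by
    ext x
    rw [_root_.neg_apply, slotMap_apply, duo_apply, duo_apply, KField.deriv_apply, KField.map_neg,
      mul_neg, map_neg]
    rfl
  have h2 : duoSwap N a b.deriv =
      -slotMap 1 (dK n : Module.End (An n) (Kn n)) (duoSwap N a b) := by
    ext x
    rw [_root_.neg_apply, slotMap_apply, duoSwap_apply, duoSwap_apply, KField.deriv_apply,
      KField.map_neg, neg_mul, map_neg]
    rfl
  have hs : ∀ (G : Func n (Fin 2) (U ⧸ L.nhd N)),
      slotMap 1 (dK n : Module.End (An n) (Kn n)) G ![1, f] = G ![1, dK n f] := by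
    intro G
    rw [slotMap_apply]
    congr 1
    ext k; fin_cases k <;> rfl
  rw [KField.sub_apply, KField.deriv_apply, KField.map_neg, KField.smul_apply, map_sub, map_neg,
    map_smul, red_nProd, red_nProd, red_nProd, h1, h2,
    zPow_neg m (slotMap_dK_mem_vanish 1 (duo_mem_expDom N a b)),
    zPow_neg m (slotMap_dK_mem_vanish 1 (duoSwap_mem_expDom N a b)),
    zPow_slotMap_dK (by decide) (Or.inr rfl) m (duo_mem_expDom N a b),
    zPow_slotMap_dK (by decide) (Or.inl rfl) m (duoSwap_mem_expDom N a b)]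
  simp only [_root_.neg_apply, _root_.sub_apply, _root_.smul_apply, hs, neg_smul, smul_sub]
  abel

end Products

/-! ### Locality -/

section PowLemmas

variable {n : ℕ} {ι : Type*} [DecidableEq ι] {P Q : Type*} [AddCommGroup P] [Module (An n) P]
  [AddCommGroup Q] [Module (An n) Q]

lemma compMultilinearMap_zDiff_pow (T : P →ₗ[An n] Q) (i j : ι) (N : ℕ) (F : Func n ι P) :
    T.compMultilinearMap ((zDiff i j ^ N) F) = (zDiff i j ^ N) (T.compMultilinearMap F) := by
  induction N with
  | zero => rfl
  | succ N ih =>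
    rw [pow_succ', pow_succ', Module.End.mul_apply, Module.End.mul_apply, ← ih]
    ext x
    exact map_sub T _ _

lemma slice_zDiff_pow {i j : ι} (hij : i ≠ j) (x : ι → Kn n) (N : ℕ) (F : Func n ι P) :
    slice i j hij x ((zDiff i j ^ N) F) = (zDiff 0 1 ^ N) (slice i j hij x F) := by
  induction N with
  | zero => rfl
  | succ N ih => rw [pow_succ', pow_succ', Module.End.mul_apply, Module.End.mul_apply, slice_zDiff,
      ih]

lemma zDiff_pow_swap (i j : ι) (N : ℕ) (F : Func n ι P) :
    (zDiff i j ^ N) F = (-1 : An n) ^ N • (zDiff j i ^ N) F := by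
  induction N with
  | zero => simp
  | succ N ih =>
    rw [pow_succ' (zDiff i j), Module.End.mul_apply, ih, map_smul, zDiff_swap,
      pow_succ' (zDiff j i), Module.End.mul_apply, pow_succ (-1 : An n), mul_smul, neg_one_smul]

lemma zDiff_pow_comm (i j k l : ι) (N M : ℕ) (F : Func n ι P) :
    (zDiff i j ^ N) ((zDiff k l ^ M) F) = (zDiff k l ^ M) ((zDiff i j ^ N) F) := by
  have h : Commute (zDiff (n := n) (P := P) i j) (zDiff k l) :=
    LinearMap.ext fun F => zDiff_comm i j k l F
  exact LinearMap.congr_fun (h.pow_pow N M) F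

lemma zPow_zDiff_pow {i j s : ι} (hij : i ≠ j) (hs : s = i ∨ s = j) (k l : ι) (m : ℤ) (N : ℕ)
    {F : Func n ι P} (hF : F ∈ expDom i j s) :
    zPow i j s m ((zDiff k l ^ N) F) = (zDiff k l ^ N) (zPow i j s m F) := by
  refine (map_zPow hij hs hij hs ((zDiff k l ^ N : Module.End (An n) (Func n ι P)) :
    Func n ι P →+ Func n ι P) (fun G hG => ?_) (fun G => ?_) m hF).symm
  · change (zDiff k l ^ N) G ∈ _
    induction N with
    | zero => exact hG
    | succ N ih => rw [pow_succ', Module.End.mul_apply]; exact zDiff_mem_vanish _ _ ih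
  · have := zDiff_pow_comm k l i j N 1 G
    simpa using this

/-- If `x ^ r` and `y ^ s` kill a vector, then so does `(x - y) ^ (r + s)`. -/
lemma pow_sub_apply_eq_zero {V : Type*} [AddCommGroup V] [Module (An n) V]
    {x y : Module.End (An n) V} (hxy : Commute x y) :
    ∀ (N r s : ℕ) (v : V), r + s = N → (x ^ r) v = 0 → (y ^ s) v = 0 → ((x - y) ^ N) v = 0 := by
  intro N
  induction N with
  | zero =>
    intro r s v h hx _
    obtain rfl : r = 0 := by omega
    have : v = 0 := hx
    rw [this, map_zero]
  | succ N ih =>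
    intro r s v h hx hy
    have hx' : ∀ k, (x ^ k) v = 0 → (x ^ k) (y v) = 0 := fun k hk => by
      have := LinearMap.congr_fun (hxy.pow_left k) v
      rw [Module.End.mul_apply, Module.End.mul_apply] at this
      rw [this, hk, map_zero]
    have hy' : ∀ k, (y ^ k) v = 0 → (y ^ k) (x v) = 0 := fun k hk => by
      have := LinearMap.congr_fun (hxy.symm.pow_left k) v
      rw [Module.End.mul_apply, Module.End.mul_apply] at this
      rw [this, hk, map_zero]
    rcases r with _ | r
    · have : v = 0 := hx
      rw [this, map_zero]
    rcases s with _ | s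
    · have : v = 0 := hy
      rw [this, map_zero]
    rw [pow_succ, Module.End.mul_apply, LinearMap.sub_apply, map_sub,
      ih r (s + 1) (x v) (by omega) (by rwa [pow_succ, Module.End.mul_apply] at hx) (hy' _ hy),
      ih (r + 1) s (y v) (by omega) (hx' _ hx) (by rwa [pow_succ, Module.End.mul_apply] at hy),
      sub_zero]

end PowLemmas

section Locality

variable {n : ℕ} {U : Type*} [Ring U] [UniformSpace U] [IsUniformAddGroup U]
  [IsTopologicalRing U] [Algebra (An n) U] [ContinuousConstSMul (An n) U] [L : LeftLinear U]

/-- The commutator `[a(z_0), b(z_1)]` of two fields. -/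
def commFunc (a b : KField n U) : Func n (Fin 2) U :=
  prodFunc ![a, b] 1 - prodFunc ![a, b] (Equiv.swap 0 1)

lemma commFunc_apply (a b : KField n U) (x : Fin 2 → Kn n) :
    commFunc a b x = a (x 0) * b (x 1) - b (x 1) * a (x 0) := by
  rw [commFunc, _root_.sub_apply, prodFunc_apply, prodFunc_apply]; simp

/-- Locality of order `r`: `(z - w) ^ r [a(z), b(w)] = 0`. -/
def IsLocalOfOrder (r : ℕ) (a b : KField n U) : Prop := (zDiff 0 1 ^ r) (commFunc a b) = 0

/-- Two fields are mutually local when their commutator is annihilated by a power of `z - w`. -/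
def IsLocal (a b : KField n U) : Prop := ∃ r, IsLocalOfOrder r a b

lemma IsLocalOfOrder.mono {r s : ℕ} {a b : KField n U} (h : IsLocalOfOrder r a b) (hrs : r ≤ s) :
    IsLocalOfOrder s a b := by
  obtain ⟨k, rfl⟩ := Nat.exists_eq_add_of_le hrs
  rw [IsLocalOfOrder, add_comm, pow_add, Module.End.mul_apply, h, map_zero]

lemma IsLocal.symm {a b : KField n U} (h : IsLocal a b) : IsLocal b a := by
  obtain ⟨r, hr⟩ := h
  refine ⟨r, ?_⟩
  have h1 : commFunc b a = - slice 1 0 (by decide) 0 (commFunc a b) := by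
    ext y
    rw [_root_.neg_apply, slice_apply, commFunc_apply, commFunc_apply, neg_sub]
    simp
  rw [IsLocalOfOrder, h1, map_neg, ← slice_zDiff_pow, zDiff_pow_swap, hr, smul_zero, map_zero,
    neg_zero]

lemma IsLocal.add_left {a a' b : KField n U} (h : IsLocal a b) (h' : IsLocal a' b) :
    IsLocal (a + a') b := by
  obtain ⟨r, hr⟩ := h
  obtain ⟨s, hs⟩ := h'
  refine ⟨max r s, ?_⟩
  have e : commFunc (a + a') b = commFunc a b + commFunc a' b := by
    ext x
    rw [_root_.add_apply, commFunc_apply, commFunc_apply, commFunc_apply, KField.add_apply]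
    noncomm_ring
  rw [IsLocalOfOrder, e, map_add, hr.mono (le_max_left _ _), hs.mono (le_max_right _ _), add_zero]

lemma IsLocal.smul_left (c : An n) {a b : KField n U} (h : IsLocal a b) : IsLocal (c • a) b := by
  obtain ⟨r, hr⟩ := h
  refine ⟨r, ?_⟩
  have e : commFunc (c • a) b = c • commFunc a b := by
    ext x
    rw [_root_.smul_apply, commFunc_apply, commFunc_apply, KField.smul_apply, smul_mul_assoc,
      mul_smul_comm, smul_sub]
  rw [IsLocalOfOrder, e, map_smul, hr, smul_zero]

lemma IsLocal.zero_left (b : KField n U) : IsLocal 0 b := by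
  refine ⟨0, ?_⟩
  ext x
  rw [pow_zero, Module.End.one_apply, commFunc_apply, KField.zero_apply, zero_mul, mul_zero,
    sub_zero]
  rfl

lemma IsLocal.deriv_left {a b : KField n U} (h : IsLocal a b) : IsLocal a.deriv b := by
  obtain ⟨r, hr⟩ := h
  refine ⟨r + 1, ?_⟩
  set d := slotMap (P := U) (0 : Fin 2) (dK n : Module.End (An n) (Kn n))
  have e : commFunc a.deriv b = -d (commFunc a b) := by
    ext x
    rw [_root_.neg_apply, slotMap_apply, commFunc_apply, commFunc_apply, KField.deriv_apply,
      KField.map_neg]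
    simp
    abel
  have hc : ∀ G : Func n (Fin 2) U, zDiff 0 1 (d G) = d (zDiff 0 1 G) + G := by
    intro G
    ext x
    simp only [d, zDiff_apply, _root_.sub_apply, _root_.add_apply, mulSlot_apply, slotMap_apply,
      Function.update_self, Function.update_idem, ne_eq, zero_ne_one, one_ne_zero,
      not_false_eq_true, Function.update_of_ne, Derivation.coeFn_coe, Derivation.leibniz, dK_zK,
      smul_eq_mul, mul_one, MultilinearMap.map_update_add, Function.update_eq_self]
    rw [Function.update_comm (by decide : (0 : Fin 2) ≠ 1)]
    abel
  have key : ∀ k : ℕ, ∀ G : Func n (Fin 2) U, (zDiff 0 1 ^ k) G = 0 →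
      (zDiff 0 1 ^ (k + 1)) (d G) = 0 := by
    intro k
    induction k with
    | zero =>
      intro G hG
      have : G = 0 := hG
      rw [this, map_zero, map_zero]
    | succ k ih =>
      intro G hG
      rw [pow_succ, Module.End.mul_apply, hc, map_add, hG, add_zero]
      exact ih _ (by rwa [pow_succ, Module.End.mul_apply] at hG)
  rw [IsLocalOfOrder, e, map_neg, key r _ hr, neg_zero]

/-- Locality of two adjacent factors at the left end of a product of three fields. -/
lemma zDiff_pow_prodMod_left {r : ℕ} (N : ℕ) (c : Fin 3 → KField n U) (π : Equiv.Perm (Fin 3))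
    (h : IsLocalOfOrder r (c (π 0)) (c (π 1))) :
    (zDiff (π 0) (π 1) ^ r) (prodMod N c (π * Equiv.swap 0 1)) =
      (zDiff (π 0) (π 1) ^ r) (prodMod N c π) := by
  have hπ : π 0 ≠ π 1 := fun h => absurd (π.injective h) (by decide)
  have h2 : π 2 ≠ π 0 := fun h => absurd (π.injective h) (by decide)
  have h2' : π 2 ≠ π 1 := fun h => absurd (π.injective h) (by decide)
  rw [eq_comm, ← sub_eq_zero, ← map_sub]
  ext x
  have e : slice (π 0) (π 1) hπ x (prodMod N c π - prodMod N c (π * Equiv.swap 0 1)) =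
      (red n N ∘ₗ LinearMap.mulRight (An n) (c (π 2) (x (π 2)))).compMultilinearMap
        (commFunc (c (π 0)) (c (π 1))) := by
    ext y
    change _ = red n N (commFunc (c (π 0)) (c (π 1)) y * c (π 2) (x (π 2)))
    rw [slice_apply, _root_.sub_apply, prodMod_apply, prodMod_apply, prodFunc_apply,
      prodFunc_apply, commFunc_apply, ← map_sub]
    simp [List.ofFn_succ, hπ, h2, h2', sub_mul, mul_assoc, Equiv.swap_apply_of_ne_of_ne]
  have hx := slice_zDiff_pow hπ x r (prodMod N c π - prodMod N c (π * Equiv.swap 0 1))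
  rw [e, ← compMultilinearMap_zDiff_pow, h] at hx
  have := congrArg (fun G => G ![x (π 0), x (π 1)]) hx
  simp only [slice_apply] at this
  simpa using this

/-- Locality of two adjacent factors at the right end of a product of three fields. -/
lemma zDiff_pow_prodMod_right {r : ℕ} (N : ℕ) (c : Fin 3 → KField n U) (π : Equiv.Perm (Fin 3))
    (h : IsLocalOfOrder r (c (π 1)) (c (π 2))) :
    (zDiff (π 1) (π 2) ^ r) (prodMod N c (π * Equiv.swap 1 2)) =
      (zDiff (π 1) (π 2) ^ r) (prodMod N c π) := by
  have hπ : π 1 ≠ π 2 := fun h => absurd (π.injective h) (by decide)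
  have h2 : π 0 ≠ π 1 := fun h => absurd (π.injective h) (by decide)
  have h2' : π 0 ≠ π 2 := fun h => absurd (π.injective h) (by decide)
  rw [eq_comm, ← sub_eq_zero, ← map_sub]
  ext x
  have e : slice (π 1) (π 2) hπ x (prodMod N c π - prodMod N c (π * Equiv.swap 1 2)) =
      (red n N ∘ₗ LinearMap.mulLeft (An n) (c (π 0) (x (π 0)))).compMultilinearMap
        (commFunc (c (π 1)) (c (π 2))) := by
    ext y
    change _ = red n N (c (π 0) (x (π 0)) * commFunc (c (π 1)) (c (π 2)) y)
    rw [slice_apply, _root_.sub_apply, prodMod_apply, prodMod_apply, prodFunc_apply,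
      prodFunc_apply, commFunc_apply, ← map_sub]
    simp [List.ofFn_succ, hπ, h2, h2', mul_sub, Equiv.swap_apply_of_ne_of_ne]
  have hx := slice_zDiff_pow hπ x r (prodMod N c π - prodMod N c (π * Equiv.swap 1 2))
  rw [e, ← compMultilinearMap_zDiff_pow, h] at hx
  have := congrArg (fun G => G ![x (π 1), x (π 2)]) hx
  simp only [slice_apply] at this
  simpa using this

lemma zDiff_pow_prodMod_left' {r : ℕ} (N : ℕ) (c : Fin 3 → KField n U)
    {π π' : Equiv.Perm (Fin 3)} {i j : Fin 3} (hi : π 0 = i) (hj : π 1 = j)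
    (hπ : π * Equiv.swap 0 1 = π') (h : IsLocalOfOrder r (c i) (c j)) :
    (zDiff i j ^ r) (prodMod N c π') = (zDiff i j ^ r) (prodMod N c π) := by
  subst hi hj hπ
  exact zDiff_pow_prodMod_left N c π h

lemma zDiff_pow_prodMod_right' {r : ℕ} (N : ℕ) (c : Fin 3 → KField n U)
    {π π' : Equiv.Perm (Fin 3)} {i j : Fin 3} (hi : π 1 = i) (hj : π 2 = j)
    (hπ : π * Equiv.swap 1 2 = π') (h : IsLocalOfOrder r (c i) (c j)) :
    (zDiff i j ^ r) (prodMod N c π') = (zDiff i j ^ r) (prodMod N c π) := by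
  subst hi hj hπ
  exact zDiff_pow_prodMod_right N c π h

lemma prodMod_mem_expDom {s : ℕ} (N : ℕ) (c : Fin s → KField n U) (π : Equiv.Perm (Fin s))
    {i j t : Fin s} (hi : π⁻¹ i ≤ π⁻¹ t) (hj : π⁻¹ j ≤ π⁻¹ t) :
    prodMod N c π ∈ expDom i j t :=
  ordered_le_expDom (r := fun i => ((π⁻¹ i : Fin s) : ℕ)) hi hj (prodMod_mem_ordered N c π)

variable [T0Space U] [CompleteSpace U]

/-- The product of `a_(m) b` with a field on its right, in terms of the product of three fields. -/
lemma red_nProd_mul (N : ℕ) (m : ℤ) (c : Fin 3 → KField n U) (π : Equiv.Perm (Fin 3))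
    (x : Fin 3 → Kn n) (hx : x (π 0) = 1) :
    red n N (nProd m (c (π 0)) (c (π 1)) (x (π 1)) * c (π 2) (x (π 2))) =
      zPow (π 0) (π 1) (π 1) m (prodMod N c π) x -
        zPow (π 0) (π 1) (π 0) m (prodMod N c (π * Equiv.swap 0 1)) x := by
  have hπ : π 0 ≠ π 1 := fun h => absurd (π.injective h) (by decide)
  have h2 : π 2 ≠ π 0 := fun h => absurd (π.injective h) (by decide)
  have h2' : π 2 ≠ π 1 := fun h => absurd (π.injective h) (by decide)
  obtain ⟨M, hM⟩ := exists_mul_mem_nhd (c (π 2) (x (π 2))) N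
  have e1 : (rightMul n hM).compMultilinearMap (duo M (c (π 0)) (c (π 1))) =
      slice (π 0) (π 1) hπ x (prodMod N c π) := by
    ext y
    rw [slice_apply, prodMod_apply, prodFunc_apply]
    change rightMul n hM _ = _
    rw [duo_apply, rightMul_red]
    simp [List.ofFn_succ, mul_assoc, hπ, h2, h2']
  have e2 : (rightMul n hM).compMultilinearMap (duoSwap M (c (π 0)) (c (π 1))) =
      slice (π 0) (π 1) hπ x (prodMod N c (π * Equiv.swap 0 1)) := by
    ext y
    rw [slice_apply, prodMod_apply, prodFunc_apply]
    change rightMul n hM _ = _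
    rw [duoSwap_apply, rightMul_red]
    simp [List.ofFn_succ, mul_assoc, hπ, h2, h2', Equiv.swap_apply_of_ne_of_ne]
  have hv : Function.update (Function.update x (π 0) 1) (π 1) (x (π 1)) = x := by
    rw [← hx, Function.update_eq_self, Function.update_eq_self]
  rw [← rightMul_red hM, red_nProd, map_sub]
  have h1 := congrArg (fun G => G ![1, x (π 1)]) (compMultilinearMap_zPow (by decide) (Or.inr rfl)
    (rightMul n hM) m (duo_mem_expDom M (c (π 0)) (c (π 1))))
  have h2 := congrArg (fun G => G ![1, x (π 1)]) (compMultilinearMap_zPow (by decide) (Or.inl rfl)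
    (rightMul n hM) m (duoSwap_mem_expDom M (c (π 0)) (c (π 1))))
  rw [e1, ← slice_zPow hπ (Or.inr ⟨rfl, rfl⟩) _ _
    (prodMod_mem_expDom N c π (by simp) (by simp))] at h1
  rw [e2, ← slice_zPow hπ (Or.inl ⟨rfl, rfl⟩) _ _
    (prodMod_mem_expDom N c _ (by simp) (by simp))] at h2
  simp only [slice_apply, Matrix.cons_val_zero, Matrix.cons_val_one, hv] at h1 h2
  rw [← h1, ← h2]
  rfl

/-- The product of `a_(m) b` with a field on its left, in terms of the product of three fields. -/
lemma red_mul_nProd (N : ℕ) (m : ℤ) (c : Fin 3 → KField n U) (π : Equiv.Perm (Fin 3))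
    (x : Fin 3 → Kn n) (hx : x (π 1) = 1) :
    red n N (c (π 0) (x (π 0)) * nProd m (c (π 1)) (c (π 2)) (x (π 2))) =
      zPow (π 1) (π 2) (π 2) m (prodMod N c π) x -
        zPow (π 1) (π 2) (π 1) m (prodMod N c (π * Equiv.swap 1 2)) x := by
  have hπ : π 1 ≠ π 2 := fun h => absurd (π.injective h) (by decide)
  have h2 : π 0 ≠ π 1 := fun h => absurd (π.injective h) (by decide)
  have h2' : π 0 ≠ π 2 := fun h => absurd (π.injective h) (by decide)
  have e1 : (leftMul n N (c (π 0) (x (π 0)))).compMultilinearMap (duo N (c (π 1)) (c (π 2))) =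
      slice (π 1) (π 2) hπ x (prodMod N c π) := by
    ext y
    rw [slice_apply, prodMod_apply, prodFunc_apply]
    change leftMul n N _ _ = _
    rw [duo_apply, leftMul_red]
    simp [List.ofFn_succ, hπ, h2, h2']
  have e2 : (leftMul n N (c (π 0) (x (π 0)))).compMultilinearMap (duoSwap N (c (π 1)) (c (π 2))) =
      slice (π 1) (π 2) hπ x (prodMod N c (π * Equiv.swap 1 2)) := by
    ext y
    rw [slice_apply, prodMod_apply, prodFunc_apply]
    change leftMul n N _ _ = _
    rw [duoSwap_apply, leftMul_red]
    simp [List.ofFn_succ, hπ, h2, h2', Equiv.swap_apply_of_ne_of_ne]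
  have hv : Function.update (Function.update x (π 1) 1) (π 2) (x (π 2)) = x := by
    rw [← hx, Function.update_eq_self, Function.update_eq_self]
  rw [← leftMul_red, red_nProd, map_sub]
  have h1 := congrArg (fun G => G ![1, x (π 2)]) (compMultilinearMap_zPow (by decide) (Or.inr rfl)
    (leftMul n N (c (π 0) (x (π 0)))) m (duo_mem_expDom N (c (π 1)) (c (π 2))))
  have h2 := congrArg (fun G => G ![1, x (π 2)]) (compMultilinearMap_zPow (by decide) (Or.inl rfl)
    (leftMul n N (c (π 0) (x (π 0)))) m (duoSwap_mem_expDom N (c (π 1)) (c (π 2))))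
  rw [e1, ← slice_zPow hπ (Or.inr ⟨rfl, rfl⟩) _ _
    (prodMod_mem_expDom N c π (by simp) (by simp))] at h1
  rw [e2, ← slice_zPow hπ (Or.inl ⟨rfl, rfl⟩) _ _
    (prodMod_mem_expDom N c _ (by simp) (by simp))] at h2
  simp only [slice_apply, Matrix.cons_val_zero, Matrix.cons_val_one, hv] at h1 h2
  rw [← h1, ← h2]
  rfl

/-- The commutator of `a_(m) b` with `d` in terms of the four products of three fields it involves.
-/
lemma red_commFunc_nProd (N : ℕ) (m : ℤ) (a b d : KField n U) :
    (red n N).compMultilinearMap (commFunc (nProd m a b) d) =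
      slice 1 2 (by decide) ![1, 0, 0]
        (zPow 0 1 1 m (prodMod N ![a, b, d] 1) -
          zPow 0 1 0 m (prodMod N ![a, b, d] (Equiv.swap 0 1)) -
          (zPow 0 1 1 m (prodMod N ![a, b, d] (Equiv.swap 1 2 * Equiv.swap 0 1)) -
            zPow 0 1 0 m (prodMod N ![a, b, d]
              (Equiv.swap 1 2 * Equiv.swap 0 1 * Equiv.swap 1 2)))) := by
  ext y
  have hv : Function.update (Function.update ![(1 : Kn n), 0, 0] 1 (y 0)) 2 (y 1) =
      ![1, y 0, y 1] := by
    ext k; fin_cases k <;> rfl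
  have h1 := red_nProd_mul N m ![a, b, d] 1 ![1, y 0, y 1] rfl
  have h2 := red_mul_nProd N m ![a, b, d] (Equiv.swap 1 2 * Equiv.swap 0 1) ![1, y 0, y 1] rfl
  rw [slice_apply, hv]
  change red n N (commFunc (nProd m a b) d y) = _
  rw [commFunc_apply, map_sub]
  exact congrArg₂ (· - ·) h1 h2

/-- Dong's lemma: if `a`, `b`, `d` are pairwise mutually local, then so are `a_(m) b` and `d`. -/
theorem IsLocal.nProd_left {a b d : KField n U} (hab : IsLocal a b) (had : IsLocal a d)
    (hbd : IsLocal b d) (m : ℤ) : IsLocal (nProd m a b) d := by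
  obtain ⟨r, hr⟩ : ∃ r, IsLocalOfOrder r a b ∧ IsLocalOfOrder r a d ∧ IsLocalOfOrder r b d := by
    obtain ⟨r₁, h₁⟩ := hab
    obtain ⟨r₂, h₂⟩ := had
    obtain ⟨r₃, h₃⟩ := hbd
    exact ⟨max r₁ (max r₂ r₃), h₁.mono (by omega), h₂.mono (by omega), h₃.mono (by omega)⟩
  obtain ⟨hab, had, hbd⟩ := hr
  -- `s` is chosen so that `(z_0 - z_1) ^ s` turns the exponent `m` into a natural number `q ≥ r`
  obtain ⟨s, q, hsq, hrq⟩ : ∃ s q : ℕ, m + s = q ∧ r ≤ q :=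
    ⟨(r - m).toNat, (m + (r - m).toNat).toNat, by omega, by omega⟩
  refine ⟨r + s + r, ?_⟩
  ext y
  refine eq_of_red (n := n) fun N => ?_
  have hred := congrArg (fun G => G y) (compMultilinearMap_zDiff_pow (red n N) (0 : Fin 2) 1
    (r + s + r) (commFunc (nProd m a b) d))
  refine hred.trans ?_
  rw [red_commFunc_nProd, ← slice_zDiff_pow]
  set c : Fin 3 → KField n U := ![a, b, d] with hcdef
  set t012 := prodMod N c 1 with ht012
  set t102 := prodMod N c (Equiv.swap 0 1) with ht102
  set t201 := prodMod N c (Equiv.swap 1 2 * Equiv.swap 0 1) with ht201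
  set t210 := prodMod N c (Equiv.swap 1 2 * Equiv.swap 0 1 * Equiv.swap 1 2) with ht210
  have d012 : t012 ∈ expDom 0 1 1 := prodMod_mem_expDom N c _ (by decide) (by decide)
  have d102 : t102 ∈ expDom 0 1 0 := prodMod_mem_expDom N c _ (by decide) (by decide)
  have d201 : t201 ∈ expDom 0 1 1 := prodMod_mem_expDom N c _ (by decide) (by decide)
  have d210 : t210 ∈ expDom 0 1 0 := prodMod_mem_expDom N c _ (by decide) (by decide)
  set Θ := zPow 0 1 1 m t012 - zPow 0 1 0 m t102 - (zPow 0 1 1 m t201 - zPow 0 1 0 m t210) with hΘ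
  -- a high power of `z_0 - z_1` makes the exponent nonnegative and kills both commutators
  have k1 : (zDiff 0 1 ^ s) Θ = 0 := by
    have e1 : (zDiff 0 1 ^ q) t102 = (zDiff 0 1 ^ q) t012 :=
      zDiff_pow_prodMod_left' N c rfl rfl (one_mul _) (hab.mono hrq)
    have e2 : (zDiff 0 1 ^ q) t210 = (zDiff 0 1 ^ q) t201 :=
      zDiff_pow_prodMod_right' N c (by decide) (by decide) rfl (hab.mono hrq)
    rw [hΘ, map_sub, map_sub, map_sub, zDiff_pow_zPow (by decide) (Or.inr rfl) _ _ d012,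
      zDiff_pow_zPow (by decide) (Or.inl rfl) _ _ d102,
      zDiff_pow_zPow (by decide) (Or.inr rfl) _ _ d201,
      zDiff_pow_zPow (by decide) (Or.inl rfl) _ _ d210, hsq,
      zPow_natCast (by decide) (Or.inr rfl) _ d012, zPow_natCast (by decide) (Or.inl rfl) _ d102,
      zPow_natCast (by decide) (Or.inr rfl) _ d201, zPow_natCast (by decide) (Or.inl rfl) _ d210,
      e1, e2]
    abel
  -- powers of `z_0 - z_2` and `z_1 - z_2` move the third field to the left
  have k2 : (zDiff 0 2 ^ r) ((zDiff 1 2 ^ r) Θ) = 0 := by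
    have e1 : (zDiff 0 2 ^ r) ((zDiff 1 2 ^ r) t012) = (zDiff 0 2 ^ r) ((zDiff 1 2 ^ r) t201) := by
      have h1 : (zDiff 1 2 ^ r) (prodMod N c (Equiv.swap 1 2)) = (zDiff 1 2 ^ r) t012 :=
        zDiff_pow_prodMod_right' N c rfl rfl (one_mul _) hbd
      have h2 : (zDiff 0 2 ^ r) t201 = (zDiff 0 2 ^ r) (prodMod N c (Equiv.swap 1 2)) :=
        zDiff_pow_prodMod_left' N c (by decide) (by decide) rfl had
      rw [← h1, zDiff_pow_comm, ← h2, zDiff_pow_comm]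
    have e2 : (zDiff 0 2 ^ r) ((zDiff 1 2 ^ r) t102) = (zDiff 0 2 ^ r) ((zDiff 1 2 ^ r) t210) := by
      have h1 : (zDiff 0 2 ^ r) (prodMod N c (Equiv.swap 0 1 * Equiv.swap 1 2)) =
          (zDiff 0 2 ^ r) t102 :=
        zDiff_pow_prodMod_right' N c (by decide) (by decide) rfl had
      have h2 : (zDiff 1 2 ^ r) t210 =
          (zDiff 1 2 ^ r) (prodMod N c (Equiv.swap 0 1 * Equiv.swap 1 2)) :=
        zDiff_pow_prodMod_left' N c (by decide) (by decide) (by decide) hbd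
      rw [zDiff_pow_comm, ← h1, zDiff_pow_comm, ← h2]
    have hp : ∀ {i : Fin 3} {F : Func n (Fin 3) (U ⧸ L.nhd N)}, i = 0 ∨ i = 1 →
        F ∈ expDom 0 1 i →
        (zDiff 0 2 ^ r) ((zDiff 1 2 ^ r) (zPow 0 1 i m F)) =
          zPow 0 1 i m ((zDiff 0 2 ^ r) ((zDiff 1 2 ^ r) F)) := by
      intro i F hi hF
      have hF' : (zDiff 1 2 ^ r) F ∈ expDom 0 1 i := by
        generalize r = k
        induction k with
        | zero => exact hF
        | succ k ih => rw [pow_succ', Module.End.mul_apply]; exact zDiff_mem_vanish _ _ ih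
      rw [zPow_zDiff_pow (by decide) hi _ _ _ _ hF', zPow_zDiff_pow (by decide) hi _ _ _ _ hF]
    rw [hΘ, map_sub, map_sub, map_sub, map_sub, map_sub, map_sub, hp (Or.inr rfl) d012,
      hp (Or.inl rfl) d102, hp (Or.inr rfl) d201, hp (Or.inl rfl) d210, e1, e2]
    abel
  -- combine the two using `z_1 - z_2 = (z_0 - z_2) - (z_0 - z_1)`
  have hcomm : Commute (zDiff (n := n) (P := U ⧸ L.nhd N) (0 : Fin 3) 2) (zDiff 0 1) :=
    LinearMap.ext fun F => zDiff_comm _ _ _ _ F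
  have hz : zDiff (n := n) (P := U ⧸ L.nhd N) (1 : Fin 3) 2 = zDiff 0 2 - zDiff 0 1 := by
    ext F : 1
    rw [LinearMap.sub_apply, zDiff_apply, zDiff_apply, zDiff_apply]; abel
  have k3 := pow_sub_apply_eq_zero hcomm (r + s) r s ((zDiff 1 2 ^ r) Θ) rfl k2
    (by rw [zDiff_pow_comm, k1, map_zero])
  rw [← hz, ← Module.End.mul_apply, ← pow_add] at k3
  rw [k3, map_zero]
  rfl

/-- For natural exponents the two expansions of `(z - w) ^ m` coincide, so that locality truncates
the products. -/
lemma nProd_eq_zero_of_isLocalOfOrder {r : ℕ} {a b : KField n U} (h : IsLocalOfOrder r a b)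
    {m : ℤ} (hm : r ≤ m) : nProd m a b = 0 := by
  obtain ⟨q, rfl⟩ := Int.eq_ofNat_of_zero_le (show 0 ≤ m by omega)
  refine KField.ext fun f => eq_of_red (n := n) fun N => ?_
  have e : (red n N).compMultilinearMap (commFunc a b) = duo N a b - duoSwap N a b := by
    ext x; exact map_sub (red n N) _ _
  change red n N (nProd (q : ℤ) a b f) = red n N 0
  rw [red_nProd, zPow_natCast (by decide) (Or.inr rfl) q (duo_mem_expDom N a b),
    zPow_natCast (by decide) (Or.inl rfl) q (duoSwap_mem_expDom N a b), ← _root_.sub_apply,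
    ← map_sub, ← e, ← compMultilinearMap_zDiff_pow, h.mono (show r ≤ q by omega)]
  rfl

end Locality

/-! ### Commutators of products -/

/-- An iterated difference in two indices as an alternating sum with binomial coefficients. -/
lemma sum_alternating_eq {V : Type*} [AddCommGroup V] (f : ℕ → ℤ → ℤ → V)
    (h : ∀ M p q, f (M + 1) p q = f M (p + 1) q - f M p (q + 1)) (M : ℕ) (p q : ℤ) :
    ∑ j ∈ Finset.range (M + 1), ((-1 : ℤ) ^ j * (M.choose j : ℤ)) • f 0 (p + M - j) (q + j) =
      f M p q := by
  induction M generalizing p q with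
  | zero => simp
  | succ M ih =>
    rw [h, ← ih, ← ih, Finset.sum_range_succ']
    have e1 : ∑ j ∈ Finset.range (M + 1), ((-1 : ℤ) ^ j * (M.choose j : ℤ)) •
        f 0 (p + 1 + M - j) (q + j) =
        ∑ j ∈ Finset.range (M + 1), ((-1 : ℤ) ^ (j + 1) * (M.choose (j + 1) : ℤ)) •
        f 0 (p + 1 + M - (j + 1 : ℕ)) (q + (j + 1 : ℕ)) + f 0 (p + 1 + M) q := by
      have := Finset.sum_range_succ (fun j : ℕ => ((-1 : ℤ) ^ j * (M.choose j : ℤ)) •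
        f 0 (p + 1 + M - j) (q + j)) (M + 1)
      rw [Nat.choose_succ_self, Nat.cast_zero, mul_zero, zero_smul, add_zero] at this
      rw [← this, Finset.sum_range_succ']
      simp
    rw [e1, add_sub_right_comm (α := V), ← Finset.sum_sub_distrib]
    congr 1
    · refine Finset.sum_congr rfl fun j _ => ?_
      rw [Nat.choose_succ_succ, pow_succ]
      have e2 : p + ((M + 1 : ℕ) : ℤ) - ((j + 1 : ℕ) : ℤ) = p + M - j := by push_cast; ring
      have e3 : p + 1 + (M : ℤ) - ((j + 1 : ℕ) : ℤ) = p + M - j := by push_cast; ring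
      have e4 : q + ((j + 1 : ℕ) : ℤ) = q + 1 + j := by push_cast; ring
      rw [e2, e3, e4, ← sub_smul]
      congr 1
      push_cast
      ring
    · simp [add_assoc, add_comm (1 : ℤ)]

section BiPow

variable {n : ℕ} {P : Type*} [AddCommGroup P] [Module (An n) P]

/-- The functionals of three variables to which the expansions of all the functions
`(z_0 - z_2) ^ p (z_1 - z_2) ^ q`, with small slots `s` and `t`, can be applied. -/
def biDom (s t : Fin 3) : Submodule (An n) (Func n (Fin 3) P) where
  carrier := {F | F ∈ expDom 1 2 t ∧ ∀ q, zPow 1 2 t q F ∈ expDom 0 2 s}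
  add_mem' {F G} hF hG := ⟨add_mem hF.1 hG.1, fun q => by
    rw [zPow_add q hF.1 hG.1]; exact add_mem (hF.2 q) (hG.2 q)⟩
  zero_mem' := ⟨zero_mem _, fun q => by
    have := zPow_smul (P := P) q (0 : An n) (zero_mem (expDom 1 2 t))
    rw [zero_smul, zero_smul] at this
    rw [this]; exact zero_mem _⟩
  smul_mem' a F hF := ⟨Submodule.smul_mem _ _ hF.1, fun q => by
    rw [zPow_smul q a hF.1]; exact Submodule.smul_mem _ _ (hF.2 q)⟩

/-- Multiplication by `(z_0 - z_2) ^ p (z_1 - z_2) ^ q`. -/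
def biPow (s t : Fin 3) (p q : ℤ) (F : Func n (Fin 3) P) : Func n (Fin 3) P :=
  zPow 0 2 s p (zPow 1 2 t q F)

variable {s t : Fin 3}

lemma biPow_add (p q : ℤ) {F G : Func n (Fin 3) P} (hF : F ∈ biDom s t) (hG : G ∈ biDom s t) :
    biPow s t p q (F + G) = biPow s t p q F + biPow s t p q G := by
  rw [biPow, zPow_add q hF.1 hG.1, zPow_add p (hF.2 q) (hG.2 q)]; rfl

lemma biPow_sub (p q : ℤ) {F G : Func n (Fin 3) P} (hF : F ∈ biDom s t) (hG : G ∈ biDom s t) :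
    biPow s t p q (F - G) = biPow s t p q F - biPow s t p q G := by
  rw [biPow, zPow_sub q hF.1 hG.1, zPow_sub p (hF.2 q) (hG.2 q)]; rfl

lemma biPow_neg (p q : ℤ) {F : Func n (Fin 3) P} (hF : F ∈ biDom s t) :
    biPow s t p q (-F) = -biPow s t p q F := by
  rw [biPow, zPow_neg q hF.1, zPow_neg p (hF.2 q)]; rfl

lemma biPow_smul (p q : ℤ) (a : An n) {F : Func n (Fin 3) P} (hF : F ∈ biDom s t) :
    biPow s t p q (a • F) = a • biPow s t p q F := by
  rw [biPow, zPow_smul q a hF.1, zPow_smul p a (hF.2 q)]; rfl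

lemma biPow_zero (p q : ℤ) : biPow s t p q (0 : Func n (Fin 3) P) = 0 := by
  have := biPow_smul (P := P) p q (0 : An n) (zero_mem (biDom s t))
  rwa [zero_smul, zero_smul] at this

lemma zDiff_mem_biDom (ht : t = 1 ∨ t = 2) (k l : Fin 3) {F : Func n (Fin 3) P}
    (hF : F ∈ biDom s t) : zDiff k l F ∈ biDom s t := by
  refine ⟨zDiff_mem_vanish _ _ hF.1, fun q => ?_⟩
  have := zPow_zDiff_pow (by decide) ht k l q 1 hF.1
  rw [pow_one] at this
  rw [this]
  exact zDiff_mem_vanish _ _ (hF.2 q)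

lemma biPow_zDiff (hs : s = 0 ∨ s = 2) (ht : t = 1 ∨ t = 2) (p q : ℤ) {F : Func n (Fin 3) P}
    (hF : F ∈ biDom s t) :
    biPow s t p q (zDiff 0 1 F) = biPow s t (p + 1) q F - biPow s t p (q + 1) F := by
  have e : zDiff 0 1 F = zDiff 0 2 F - zDiff 1 2 F := by
    rw [zDiff_apply, zDiff_apply, zDiff_apply]; abel
  have h1 := zPow_zDiff_pow (by decide) ht 0 2 q 1 hF.1
  rw [pow_one] at h1
  rw [e, biPow_sub p q (zDiff_mem_biDom ht _ _ hF) (zDiff_mem_biDom ht _ _ hF), biPow, biPow, h1,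
    zPow_zDiff (by decide) hs _ (hF.2 q), zPow_zDiff (by decide) ht _ hF.1]
  rfl

/-- The binomial expansion of `((z_0 - z_2) - (z_1 - z_2)) ^ M = (z_0 - z_1) ^ M`. -/
lemma sum_biPow (hs : s = 0 ∨ s = 2) (ht : t = 1 ∨ t = 2) (M : ℕ) (p q : ℤ)
    {F : Func n (Fin 3) P} (hF : F ∈ biDom s t) :
    ∑ j ∈ Finset.range (M + 1), ((-1 : ℤ) ^ j * (M.choose j : ℤ)) •
      biPow s t (p + M - j) (q + j) F = biPow s t p q ((zDiff 0 1 ^ M) F) := by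
  refine sum_alternating_eq (fun M p q => biPow s t p q ((zDiff 0 1 ^ M) F)) (fun M p q => ?_) M p q
  have hM : (zDiff 0 1 ^ M) F ∈ biDom s t := by
    induction M with
    | zero => exact hF
    | succ M ih => rw [pow_succ', Module.End.mul_apply]; exact zDiff_mem_biDom ht _ _ ih
  rw [pow_succ', Module.End.mul_apply, biPow_zDiff hs ht p q hM]

/-- A family of functionals that satisfies the recursions of `(z_0 - z_2) ^ p (z_1 - z_2) ^ q`
consists of the expansions of these functions applied to its member with `p = q = 0`. -/
lemma biPow_unique (hs : s = 0 ∨ s = 2) (ht : t = 1 ∨ t = 2) (B : ℤ → ℤ → Func n (Fin 3) P)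
    (hB : ∀ p q, B p q ∈ expDom 1 2 t) (hB' : ∀ p q, B p q ∈ expDom 0 2 s)
    (h1 : ∀ p q, zDiff 0 2 (B p q) = B (p + 1) q) (h2 : ∀ p q, zDiff 1 2 (B p q) = B p (q + 1)) :
    B 0 0 ∈ biDom s t ∧ ∀ p q, biPow s t p q (B 0 0) = B p q := by
  have h3 : ∀ q, zPow 1 2 t q (B 0 0) = B 0 q :=
    zPow_unique (by decide) ht (fun q => B 0 q) (hB 0) (h2 0)
  refine ⟨⟨hB 0 0, fun q => by rw [h3]; exact hB' 0 q⟩, fun p q => ?_⟩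
  rw [biPow, h3]
  exact zPow_unique (by decide) hs (fun p => B p q) (fun p => hB' p q) (fun p => h1 p q) p

end BiPow

section Commutator

variable {n : ℕ} {U : Type*} [Ring U] [UniformSpace U] [IsUniformAddGroup U]
  [IsTopologicalRing U] [Algebra (An n) U] [ContinuousConstSMul (An n) U] [L : LeftLinear U]

lemma zPow_prodMod_mem_expDom {s : ℕ} (N : ℕ) (c : Fin s → KField n U) (π : Equiv.Perm (Fin s))
    {i j t i' j' t' : Fin s} (hij : i ≠ j) (ht : t = i ∨ t = j) (hi : π⁻¹ i ≤ π⁻¹ t)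
    (hj : π⁻¹ j ≤ π⁻¹ t) (hi' : π⁻¹ i' ≤ π⁻¹ t') (hj' : π⁻¹ j' ≤ π⁻¹ t') (q : ℤ) :
    zPow i j t q (prodMod N c π) ∈ expDom i' j' t' :=
  ordered_le_expDom (r := fun i => ((π⁻¹ i : Fin s) : ℕ)) hi' hj'
    (zPow_mem_ordered hij ht (Fin.val_injective.comp (π⁻¹).injective) hi hj q
      (prodMod_mem_ordered N c π))

lemma zPow_comm_prodMod {s : ℕ} (N : ℕ) (c : Fin s → KField n U) (π : Equiv.Perm (Fin s))
    {i j t i' j' t' : Fin s} (hij : i ≠ j) (ht : t = i ∨ t = j) (hi : π⁻¹ i ≤ π⁻¹ t)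
    (hj : π⁻¹ j ≤ π⁻¹ t) (hij' : i' ≠ j') (ht' : t' = i' ∨ t' = j') (hi' : π⁻¹ i' ≤ π⁻¹ t')
    (hj' : π⁻¹ j' ≤ π⁻¹ t') (p q : ℤ) :
    zPow i j t p (zPow i' j' t' q (prodMod N c π)) =
      zPow i' j' t' q (zPow i j t p (prodMod N c π)) :=
  zPow_comm (r := fun i => ((π⁻¹ i : Fin s) : ℕ)) hij ht hij' ht'
    (Fin.val_injective.comp (π⁻¹).injective) hi hj hi' hj' p q (prodMod_mem_ordered N c π)

variable [T0Space U] [CompleteSpace U]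

/-- The iterated product `a_(p) (b_(q) d)` in terms of the products of three fields. -/
lemma red_nProd_nProd (N : ℕ) (p q : ℤ) (c : Fin 3 → KField n U) (π : Equiv.Perm (Fin 3))
    (x : Fin 3 → Kn n) (hx : x (π 0) = 1) (hx' : x (π 1) = 1) :
    red n N (nProd p (c (π 0)) (nProd q (c (π 1)) (c (π 2))) (x (π 2))) =
      zPow (π 0) (π 2) (π 2) p (zPow (π 1) (π 2) (π 2) q (prodMod N c π) -
        zPow (π 1) (π 2) (π 1) q (prodMod N c (π * Equiv.swap 1 2))) x -
      zPow (π 0) (π 2) (π 0) p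
        (zPow (π 1) (π 2) (π 2) q (prodMod N c (π * Equiv.swap 0 1 * Equiv.swap 1 2)) -
        zPow (π 1) (π 2) (π 1) q
          (prodMod N c (π * Equiv.swap 0 1 * Equiv.swap 1 2 * Equiv.swap 0 1))) x := by
  have hπ : π 0 ≠ π 2 := fun h => absurd (π.injective h) (by decide)
  have h1 : π 1 ≠ π 0 := fun h => absurd (π.injective h) (by decide)
  have h2 : π 1 ≠ π 2 := fun h => absurd (π.injective h) (by decide)
  have e1 : duo N (c (π 0)) (nProd q (c (π 1)) (c (π 2))) = slice (π 0) (π 2) hπ x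
      (zPow (π 1) (π 2) (π 2) q (prodMod N c π) -
        zPow (π 1) (π 2) (π 1) q (prodMod N c (π * Equiv.swap 1 2))) := by
    ext y
    have := red_mul_nProd N q c π (Function.update (Function.update x (π 0) (y 0)) (π 2) (y 1))
      (by simp [h1, h2, hx'])
    rw [duo_apply, slice_apply, _root_.sub_apply, ← this]
    simp [hπ]
  have hρ0 : (π * Equiv.swap 0 1 * Equiv.swap 1 2 : Equiv.Perm (Fin 3)) 0 = π 1 := by
    simp [Equiv.swap_apply_of_ne_of_ne]
  have hρ1 : (π * Equiv.swap 0 1 * Equiv.swap 1 2 : Equiv.Perm (Fin 3)) 1 = π 2 := by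
    simp [Equiv.swap_apply_of_ne_of_ne]
  have hρ2 : (π * Equiv.swap 0 1 * Equiv.swap 1 2 : Equiv.Perm (Fin 3)) 2 = π 0 := by
    simp
  have e2 : duoSwap N (c (π 0)) (nProd q (c (π 1)) (c (π 2))) = slice (π 0) (π 2) hπ x
      (zPow (π 1) (π 2) (π 2) q (prodMod N c (π * Equiv.swap 0 1 * Equiv.swap 1 2)) -
        zPow (π 1) (π 2) (π 1) q
          (prodMod N c (π * Equiv.swap 0 1 * Equiv.swap 1 2 * Equiv.swap 0 1))) := by
    ext y
    have := red_nProd_mul N q c (π * Equiv.swap 0 1 * Equiv.swap 1 2)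
      (Function.update (Function.update x (π 0) (y 0)) (π 2) (y 1))
      (by rw [hρ0]; simp [h1, h2, hx'])
    rw [hρ0, hρ1, hρ2] at this
    rw [duoSwap_apply, slice_apply, _root_.sub_apply, ← this]
    simp [hπ]
  have hv : Function.update (Function.update x (π 0) 1) (π 2) (x (π 2)) = x := by
    rw [← hx, Function.update_eq_self, Function.update_eq_self]
  rw [red_nProd, e1, e2, ← slice_zPow hπ (Or.inr ⟨rfl, rfl⟩), ← slice_zPow hπ (Or.inl ⟨rfl, rfl⟩),
    slice_apply, slice_apply]
  · simp only [Matrix.cons_val_zero, Matrix.cons_val_one, hv]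
  · exact sub_mem
      (zPow_prodMod_mem_expDom N c _ h2 (Or.inr rfl) (by simp; try decide)
        (by simp; try decide) (by simp; try decide) (by simp; try decide) q)
      (zPow_prodMod_mem_expDom N c _ h2 (Or.inl rfl) (by simp; try decide)
        (by simp; try decide) (by simp; try decide) (by simp; try decide) q)
  · exact sub_mem
      (zPow_prodMod_mem_expDom N c _ h2 (Or.inr rfl) (by simp; try decide)
        (by simp; try decide) (by simp; try decide) (by simp; try decide) q)
      (zPow_prodMod_mem_expDom N c _ h2 (Or.inl rfl) (by simp; try decide)
        (by simp; try decide) (by simp; try decide) (by simp; try decide) q)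

lemma prodMod_mem_biDom (N : ℕ) (c : Fin 3 → KField n U) (π : Equiv.Perm (Fin 3)) {s t : Fin 3}
    (ht : t = 1 ∨ t = 2) (h1 : π⁻¹ 1 ≤ π⁻¹ t) (h2 : π⁻¹ 2 ≤ π⁻¹ t) (h3 : π⁻¹ 0 ≤ π⁻¹ s)
    (h4 : π⁻¹ 2 ≤ π⁻¹ s) : prodMod N c π ∈ biDom s t :=
  ⟨prodMod_mem_expDom N c π h1 h2,
    zPow_prodMod_mem_expDom N c π (by decide) ht h1 h2 h3 h4⟩

/-- The commutator `[a_(p), b_(q)]` applied to `d`: the mixed terms, where the third field stands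
between the other two, cancel. -/
lemma red_commutator (N : ℕ) (p q : ℤ) (c : Fin 3 → KField n U) (h : Kn n) :
    red n N (nProd p (c 0) (nProd q (c 1) (c 2)) h - nProd q (c 1) (nProd p (c 0) (c 2)) h) =
      (biPow 2 2 p q (prodMod N c 1 - prodMod N c (Equiv.swap 0 1)) +
        biPow 0 1 p q (prodMod N c (Equiv.swap 1 2 * Equiv.swap 0 1 * Equiv.swap 1 2) -
          prodMod N c (Equiv.swap 1 2 * Equiv.swap 0 1))) ![1, 1, h] := by
  have A := red_nProd_nProd N p q c 1 ![1, 1, h] rfl rfl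
  have B := red_nProd_nProd N q p c (Equiv.swap 0 1) ![1, 1, h] rfl rfl
  have r1 : (1 * Equiv.swap 0 1 * Equiv.swap 1 2 * Equiv.swap 0 1 : Equiv.Perm (Fin 3)) =
      Equiv.swap 1 2 * Equiv.swap 0 1 * Equiv.swap 1 2 := by decide
  have r2 : (Equiv.swap 0 1 * Equiv.swap 0 1 * Equiv.swap 1 2 : Equiv.Perm (Fin 3)) =
      Equiv.swap 1 2 := by decide
  rw [one_mul, r1, one_mul] at A
  rw [r2] at B
  change red n N (nProd p (c 0) (nProd q (c 1) (c 2)) h) =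
    zPow 0 2 2 p (zPow 1 2 2 q (prodMod N c 1) -
      zPow 1 2 1 q (prodMod N c (Equiv.swap 1 2))) ![1, 1, h] -
    zPow 0 2 0 p (zPow 1 2 2 q (prodMod N c (Equiv.swap 0 1 * Equiv.swap 1 2)) -
      zPow 1 2 1 q (prodMod N c (Equiv.swap 1 2 * Equiv.swap 0 1 * Equiv.swap 1 2)))
      ![1, 1, h] at A
  change red n N (nProd q (c 1) (nProd p (c 0) (c 2)) h) =
    zPow 1 2 2 q (zPow 0 2 2 p (prodMod N c (Equiv.swap 0 1)) -
      zPow 0 2 0 p (prodMod N c (Equiv.swap 0 1 * Equiv.swap 1 2))) ![1, 1, h] -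
    zPow 1 2 1 q (zPow 0 2 2 p (prodMod N c (Equiv.swap 1 2)) -
      zPow 0 2 0 p (prodMod N c (Equiv.swap 1 2 * Equiv.swap 0 1)))
      ![1, 1, h] at B
  have h02 : (0 : Fin 3) ≠ 2 := by decide
  have h12 : (1 : Fin 3) ≠ 2 := by decide
  -- all the expansions below are compatible with the order of the factors, so they are additive and
  -- the powers of `z_0 - z_2` and `z_1 - z_2` commute
  have m1 := zPow_prodMod_mem_expDom N c 1 h12 (Or.inr rfl) (i' := 0) (j' := 2) (t' := 2)
    (by decide) (by decide) (by decide) (by decide) q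
  have m2 := zPow_prodMod_mem_expDom N c (Equiv.swap 1 2) h12 (Or.inl rfl) (i' := 0) (j' := 2)
    (t' := 2) (by decide) (by decide) (by decide) (by decide) q
  have m3 := zPow_prodMod_mem_expDom N c (Equiv.swap 0 1 * Equiv.swap 1 2) h12 (Or.inr rfl)
    (i' := 0) (j' := 2) (t' := 0) (by decide) (by decide) (by decide) (by decide) q
  have m4 := zPow_prodMod_mem_expDom N c (Equiv.swap 1 2 * Equiv.swap 0 1 * Equiv.swap 1 2) h12
    (Or.inl rfl) (i' := 0) (j' := 2) (t' := 0) (by decide) (by decide) (by decide) (by decide) q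
  have m5 := zPow_prodMod_mem_expDom N c (Equiv.swap 0 1) h02 (Or.inr rfl) (i' := 1) (j' := 2)
    (t' := 2) (by decide) (by decide) (by decide) (by decide) p
  have m6 := zPow_prodMod_mem_expDom N c (Equiv.swap 0 1 * Equiv.swap 1 2) h02 (Or.inl rfl)
    (i' := 1) (j' := 2) (t' := 2) (by decide) (by decide) (by decide) (by decide) p
  have m7 := zPow_prodMod_mem_expDom N c (Equiv.swap 1 2) h02 (Or.inr rfl)
    (i' := 1) (j' := 2) (t' := 1) (by decide) (by decide) (by decide) (by decide) p
  have m8 := zPow_prodMod_mem_expDom N c (Equiv.swap 1 2 * Equiv.swap 0 1) h02 (Or.inl rfl)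
    (i' := 1) (j' := 2) (t' := 1) (by decide) (by decide) (by decide) (by decide) p
  have c1 := zPow_comm_prodMod N c (Equiv.swap 0 1) (i := 0) (j := 2) (t := 2) (i' := 1) (j' := 2)
    (t' := 2) h02 (by decide) (by decide) (by decide) h12 (by decide) (by decide) (by decide) p q
  have c2 := zPow_comm_prodMod N c (Equiv.swap 0 1 * Equiv.swap 1 2) (i := 0) (j := 2) (t := 0)
    (i' := 1) (j' := 2) (t' := 2) h02 (by decide) (by decide) (by decide) h12 (by decide)
    (by decide) (by decide) p q
  have c3 := zPow_comm_prodMod N c (Equiv.swap 1 2) (i := 0) (j := 2) (t := 2)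
    (i' := 1) (j' := 2) (t' := 1) h02 (by decide) (by decide) (by decide) h12 (by decide)
    (by decide) (by decide) p q
  have c4 := zPow_comm_prodMod N c (Equiv.swap 1 2 * Equiv.swap 0 1) (i := 0) (j := 2) (t := 0)
    (i' := 1) (j' := 2) (t' := 1) h02 (by decide) (by decide) (by decide) h12 (by decide)
    (by decide) (by decide) p q
  rw [zPow_sub p m1 m2, zPow_sub p m3 m4] at A
  rw [zPow_sub q m5 m6, zPow_sub q m7 m8, ← c1, ← c2, ← c3, ← c4] at B
  rw [map_sub, A, B, biPow_sub, biPow_sub]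
  · simp only [_root_.sub_apply, _root_.add_apply, biPow]
    abel
  all_goals refine prodMod_mem_biDom N c _ ?_ ?_ ?_ ?_ ?_ <;> decide

/-- Mutually local fields satisfy the locality axiom of vertex algebras. -/
lemma IsLocalOfOrder.sum_commutator {M : ℕ} {a b : KField n U} (h : IsLocalOfOrder M a b)
    (p q : ℤ) (d : KField n U) :
    ∑ j ∈ Finset.range (M + 1), ((-1 : ℤ) ^ j * (M.choose j : ℤ)) •
      (nProd (p + M - j) a (nProd (q + j) b d) - nProd (q + j) b (nProd (p + M - j) a d)) = 0 := by
  refine KField.ext fun f => eq_of_red (n := n) fun N => ?_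
  let e : KField n U →+ U ⧸ L.nhd N := ⟨⟨fun c => red n N (c f), rfl⟩, fun _ _ => rfl⟩
  let ev : Func n (Fin 3) (U ⧸ L.nhd N) →+ U ⧸ L.nhd N :=
    ⟨⟨fun G => G ![1, 1, f], rfl⟩, fun _ _ => rfl⟩
  change e _ = e 0
  rw [map_sum, map_zero]
  set c : Fin 3 → KField n U := ![a, b, d]
  -- in the alternating sum, `(z_0 - z_1) ^ M` is applied to the commutator of `a` and `b`
  have hterm : ∀ p q : ℤ, e (nProd p a (nProd q b d) - nProd q b (nProd p a d)) =
      ev (biPow 2 2 p q (prodMod N c 1 - prodMod N c (Equiv.swap 0 1)) +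
        biPow 0 1 p q (prodMod N c (Equiv.swap 1 2 * Equiv.swap 0 1 * Equiv.swap 1 2) -
          prodMod N c (Equiv.swap 1 2 * Equiv.swap 0 1))) :=
    fun p q => red_commutator N p q c f
  simp only [map_zsmul, hterm]
  simp only [← map_zsmul, ← map_sum, smul_add, Finset.sum_add_distrib]
  have z1 : (zDiff 0 1 ^ M) (prodMod N c (Equiv.swap 0 1)) = (zDiff 0 1 ^ M) (prodMod N c 1) :=
    zDiff_pow_prodMod_left' N c rfl rfl (one_mul _) h
  have z2 : (zDiff 0 1 ^ M) (prodMod N c (Equiv.swap 1 2 * Equiv.swap 0 1 * Equiv.swap 1 2)) =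
      (zDiff 0 1 ^ M) (prodMod N c (Equiv.swap 1 2 * Equiv.swap 0 1)) :=
    zDiff_pow_prodMod_right' N c (by decide) (by decide) rfl h
  rw [sum_biPow (by decide) (by decide), sum_biPow (by decide) (by decide), map_sub, map_sub, z1,
    z2, sub_self, sub_self, biPow_zero, biPow_zero, add_zero, map_zero]
  · refine sub_mem ?_ ?_ <;> refine prodMod_mem_biDom N c _ ?_ ?_ ?_ ?_ ?_ <;> decide
  · refine sub_mem ?_ ?_ <;> refine prodMod_mem_biDom N c _ ?_ ?_ ?_ ?_ ?_ <;> decide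

end Commutator

/-! ### Fields with affine commutation relations -/

section Pull

variable {n : ℕ} {P : Type*} [AddCommGroup P] [Module (An n) P]

lemma update_fin_two_zero {α : Type*} (f h g : α) : Function.update ![f, h] 0 g = ![g, h] := by
  ext k; fin_cases k <;> rfl

lemma update_fin_two_one {α : Type*} (f h g : α) : Function.update ![f, h] 1 g = ![f, g] := by
  ext k; fin_cases k <;> rfl

lemma Func.add_left (E : Func n (Fin 2) P) (y z w : Kn n) :
    E ![y + z, w] = E ![y, w] + E ![z, w] := by
  simpa only [update_fin_two_zero] using E.map_update_add ![0, w] 0 y z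

lemma Func.add_right (E : Func n (Fin 2) P) (y z w : Kn n) :
    E ![y, z + w] = E ![y, z] + E ![y, w] := by
  simpa only [update_fin_two_one] using E.map_update_add ![y, 0] 1 z w

lemma Func.smul_left (E : Func n (Fin 2) P) (c : An n) (y w : Kn n) :
    E ![c • y, w] = c • E ![y, w] := by
  simpa only [update_fin_two_zero] using E.map_update_smul ![0, w] 0 c y

lemma Func.smul_right (E : Func n (Fin 2) P) (c : An n) (y w : Kn n) :
    E ![y, c • w] = c • E ![y, w] := by
  simpa only [update_fin_two_one] using E.map_update_smul ![y, 0] 1 c w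

/-- The functional `x ↦ E (β x_0 x_1, x_2)` of three variables. -/
def pull (β : Kn n →ₗ[An n] Kn n →ₗ[An n] Kn n) : Func n (Fin 2) P →ₗ[An n] Func n (Fin 3) P where
  toFun E :=
    { toFun := fun x => E ![β (x 0) (x 1), x 2]
      map_update_add' := by
        intro d x k f h
        obtain rfl := Subsingleton.elim (instDecidableEqFin 3) d
        fin_cases k <;> simp [Func.add_left, Func.add_right]
      map_update_smul' := by
        intro d x k c f
        obtain rfl := Subsingleton.elim (instDecidableEqFin 3) d
        fin_cases k <;> simp [Func.smul_left, Func.smul_right] }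
  map_add' _ _ := rfl
  map_smul' _ _ := rfl

lemma pull_apply (β : Kn n →ₗ[An n] Kn n →ₗ[An n] Kn n) (E : Func n (Fin 2) P)
    (x : Fin 3 → Kn n) : pull β E x = E ![β (x 0) (x 1), x 2] := rfl

/-- The bilinear map `(f, h) ↦ f h`. -/
abbrev mulForm (n : ℕ) : Kn n →ₗ[An n] Kn n →ₗ[An n] Kn n := LinearMap.mul (An n) (Kn n)

/-- The bilinear map `(f, h) ↦ h ∂f`. -/
def dForm (n : ℕ) : Kn n →ₗ[An n] Kn n →ₗ[An n] Kn n :=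
  LinearMap.mul (An n) (Kn n) ∘ₗ (dK n : Kn n →ₗ[An n] Kn n)

lemma dForm_apply (f h : Kn n) : dForm n f h = dK n f * h := rfl

lemma zDiff_apply_fin_two (E : Func n (Fin 2) P) (f h : Kn n) :
    zDiff 0 1 E ![f, h] = E ![zK n * f, h] - E ![f, zK n * h] := by
  rw [zDiff_apply, sub_apply, mulSlot_apply, mulSlot_apply, update_fin_two_zero,
    update_fin_two_one]; rfl

lemma zDiff_zero_two_pull (β : Kn n →ₗ[An n] Kn n →ₗ[An n] Kn n) (E : Func n (Fin 2) P)
    (x : Fin 3 → Kn n) : zDiff 0 2 (pull β E) x =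
      E ![β (zK n * x 0) (x 1), x 2] - E ![β (x 0) (x 1), zK n * x 2] := by
  rw [zDiff_apply, sub_apply, mulSlot_apply, mulSlot_apply, pull_apply, pull_apply]; simp

lemma zDiff_one_two_pull (β : Kn n →ₗ[An n] Kn n →ₗ[An n] Kn n) (E : Func n (Fin 2) P)
    (x : Fin 3 → Kn n) : zDiff 1 2 (pull β E) x =
      E ![β (x 0) (zK n * x 1), x 2] - E ![β (x 0) (x 1), zK n * x 2] := by
  rw [zDiff_apply, sub_apply, mulSlot_apply, mulSlot_apply, pull_apply, pull_apply]; simp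

lemma zDiff_zero_two_pull_mulForm (E : Func n (Fin 2) P) :
    zDiff 0 2 (pull (mulForm n) E) = pull (mulForm n) (zDiff 0 1 E) := by
  ext x
  rw [zDiff_zero_two_pull, pull_apply, zDiff_apply_fin_two]
  simp [mul_assoc]

lemma zDiff_one_two_pull_mulForm (E : Func n (Fin 2) P) :
    zDiff 1 2 (pull (mulForm n) E) = pull (mulForm n) (zDiff 0 1 E) := by
  ext x
  rw [zDiff_one_two_pull, pull_apply, zDiff_apply_fin_two]
  simp [mul_left_comm]

lemma zDiff_zero_two_pull_dForm (E : Func n (Fin 2) P) :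
    zDiff 0 2 (pull (dForm n) E) = pull (mulForm n) E + pull (dForm n) (zDiff 0 1 E) := by
  ext x
  have h : dForm n (zK n * x 0) (x 1) = x 0 * x 1 + zK n * dForm n (x 0) (x 1) := by
    rw [dForm_apply, dForm_apply, Derivation.leibniz, dK_zK, smul_eq_mul, smul_eq_mul]; ring
  rw [zDiff_zero_two_pull, add_apply, pull_apply, pull_apply, zDiff_apply_fin_two, h,
    Func.add_left, add_sub_assoc]
  rfl

lemma zDiff_one_two_pull_dForm (E : Func n (Fin 2) P) :
    zDiff 1 2 (pull (dForm n) E) = pull (dForm n) (zDiff 0 1 E) := by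
  ext x
  rw [zDiff_one_two_pull, pull_apply, zDiff_apply_fin_two]
  simp [dForm_apply, mul_left_comm]

lemma dForm_left (f : Kn n) (N : ℕ) : ∃ M, ∀ h ∈ Jn n M, dForm n f h ∈ Jn n N :=
  Jn_left n (dK n f) N

lemma dForm_right (h : Kn n) (N : ℕ) : ∃ M, ∀ f ∈ Jn n M, dForm n f h ∈ Jn n N := by
  obtain ⟨M, hM⟩ := Jn_left n h N
  exact ⟨M + 1, fun f hf => by rw [dForm_apply, mul_comm]; exact hM _ (Jn_dK n hf)⟩

lemma mulForm_right (h : Kn n) (N : ℕ) : ∃ M, ∀ f ∈ Jn n M, mulForm n f h ∈ Jn n N := by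
  obtain ⟨M, hM⟩ := Jn_left n h N
  exact ⟨M, fun f hf => by rw [LinearMap.mul_apply', mul_comm]; exact hM _ hf⟩

/-- The admissible pairs of small slots for the pull-back of a functional of two variables with
small slot `i`. -/
def PullSlots (i : Fin 2) (s t : Fin 3) : Prop := i = 1 ∧ s = 2 ∧ t = 2 ∨ i = 0 ∧ s = 0 ∧ t = 1

/-- The pull-back of a functional along a bilinear map that is continuous in each variable can be
expanded in the same way as the functional itself. -/
lemma pull_mem_expDom {i : Fin 2} {s t : Fin 3} (hi : PullSlots i s t)
    {β : Kn n →ₗ[An n] Kn n →ₗ[An n] Kn n} (h1 : ∀ f N, ∃ M, ∀ h ∈ Jn n M, β f h ∈ Jn n N)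
    (h2 : ∀ h N, ∃ M, ∀ f ∈ Jn n M, β f h ∈ Jn n N) {E : Func n (Fin 2) P}
    (hE : E ∈ expDom 0 1 i) : pull β E ∈ expDom 0 2 s ∧ pull β E ∈ expDom 1 2 t := by
  obtain ⟨M, hM⟩ := hE 0
  have hc : ∀ x : Fin 2 → Kn n, ∀ k ∈ ({0, 1}ᶜ : Set (Fin 2)), x k = (0 : Fin 2 → Kn n) k := by
    intro x k hk
    fin_cases k <;> simp at hk
  rcases hi with ⟨rfl, rfl, rfl⟩ | ⟨rfl, rfl, rfl⟩
  · exact ⟨fun y => ⟨M, fun x _ hx => hM _ (hc _) hx⟩, fun y => ⟨M, fun x _ hx => hM _ (hc _) hx⟩⟩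
  · refine ⟨fun y => ?_, fun y => ?_⟩
    · obtain ⟨M', hM'⟩ := h2 (y 1) M
      refine ⟨M', fun x hx hx' => hM _ (hc _) ?_⟩
      have := hM' _ hx'
      rwa [← hx 1 (by decide)] at this
    · obtain ⟨M', hM'⟩ := h1 (y 0) M
      refine ⟨M', fun x hx hx' => hM _ (hc _) ?_⟩
      have := hM' _ hx'
      rwa [← hx 0 (by decide)] at this

lemma PullSlots.cases {i : Fin 2} {s t : Fin 3} (hi : PullSlots i s t) :
    (s = 0 ∨ s = 2) ∧ (t = 1 ∨ t = 2) ∧ (i = 0 ∨ i = 1) := by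
  rcases hi with ⟨rfl, rfl, rfl⟩ | ⟨rfl, rfl, rfl⟩ <;> decide

/-- On functionals of `(f h, e)`, both `z_0 - z_2` and `z_1 - z_2` act as `z - w`. -/
lemma biPow_pull_mulForm {i : Fin 2} {s t : Fin 3} (hi : PullSlots i s t) {E : Func n (Fin 2) P}
    (hE : E ∈ expDom 0 1 i) : pull (mulForm n) E ∈ biDom s t ∧ ∀ p q,
      biPow s t p q (pull (mulForm n) E) = pull (mulForm n) (zPow 0 1 i (p + q) E) := by
  obtain ⟨hs, ht, hi'⟩ := hi.cases
  have hm := fun m => pull_mem_expDom hi (Jn_left n) mulForm_right (zPow_mem m hE)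
  have := biPow_unique hs ht (fun p q => pull (mulForm n) (zPow 0 1 i (p + q) E))
    (fun p q => (hm _).2) (fun p q => (hm _).1)
    (fun p q => by rw [zDiff_zero_two_pull_mulForm, zDiff_zPow (by decide) hi' _ hE,
      add_right_comm])
    (fun p q => by rw [zDiff_one_two_pull_mulForm, zDiff_zPow (by decide) hi' _ hE, add_assoc])
  rwa [add_zero, zPow_zero hE] at this

/-- On functionals of `(h ∂f, e)`, the factor `z_0 - z_2` acts as `z - w` up to the term that comes
from `∂(z f) = z ∂f + f`. -/
lemma biPow_pull_dForm {i : Fin 2} {s t : Fin 3} (hi : PullSlots i s t) {E : Func n (Fin 2) P}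
    (hE : E ∈ expDom 0 1 i) : pull (dForm n) E ∈ biDom s t ∧ ∀ p q,
      biPow s t p q (pull (dForm n) E) = pull (dForm n) (zPow 0 1 i (p + q) E) +
        (p : An n) • pull (mulForm n) (zPow 0 1 i (p + q - 1) E) := by
  obtain ⟨hs, ht, hi'⟩ := hi.cases
  have hm := fun m => pull_mem_expDom hi (Jn_left n) mulForm_right (zPow_mem m hE)
  have hm' := fun m => pull_mem_expDom hi dForm_left dForm_right (zPow_mem m hE)
  have := biPow_unique hs ht (fun p q => pull (dForm n) (zPow 0 1 i (p + q) E) +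
      (p : An n) • pull (mulForm n) (zPow 0 1 i (p + q - 1) E))
    (fun p q => add_mem (hm' _).2 (Submodule.smul_mem _ _ (hm _).2))
    (fun p q => add_mem (hm' _).1 (Submodule.smul_mem _ _ (hm _).1))
    (fun p q => by
      rw [map_add, map_smul, zDiff_zero_two_pull_dForm, zDiff_zero_two_pull_mulForm,
        zDiff_zPow (by decide) hi' _ hE, zDiff_zPow (by decide) hi' _ hE, sub_add_cancel,
        add_right_comm p 1 q, add_sub_cancel_right, Int.cast_add, add_smul, Int.cast_one, one_smul]
      abel)
    (fun p q => by
      rw [map_add, map_smul, zDiff_one_two_pull_dForm, zDiff_one_two_pull_mulForm,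
        zDiff_zPow (by decide) hi' _ hE, zDiff_zPow (by decide) hi' _ hE, sub_add_cancel,
        ← add_assoc, add_sub_cancel_right])
  simpa only [add_zero, Int.cast_zero, zero_smul, zPow_zero hE] using this

end Pull

section Affine

variable {n : ℕ} {U : Type*} [Ring U] [UniformSpace U] [IsUniformAddGroup U]
  [IsTopologicalRing U] [Algebra (An n) U] [ContinuousConstSMul (An n) U] [L : LeftLinear U]

/-- The relation `[a(f), b(h)] = c(f h) + e(h ∂f)`. -/
def AffineRel (a b c e : KField n U) : Prop :=
  ∀ f h, a f * b h - b h * a f = c (f * h) + e (dK n f * h)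

/-- The right-hand side of the relation is a combination of a delta function and its derivative,
which `(z - w) ^ 2` annihilates. -/
lemma AffineRel.isLocalOfOrder {a b c e : KField n U} (H : AffineRel a b c e) :
    IsLocalOfOrder 2 a b := by
  ext x
  rw [pow_two, Module.End.mul_apply, zDiff_apply (i := 0) (j := 1) (F := zDiff 0 1 _),
    _root_.sub_apply, mulSlot_apply, mulSlot_apply]
  have hx : x = ![x 0, x 1] := by ext k; fin_cases k <;> rfl
  have h0 : Function.update x 0 (zK n * x 0) = ![zK n * x 0, x 1] := by
    ext k; fin_cases k <;> rfl
  have h1 : Function.update x 1 (zK n * x 1) = ![x 0, zK n * x 1] := by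
    ext k; fin_cases k <;> rfl
  rw [h0, h1, zDiff_apply_fin_two, zDiff_apply_fin_two]
  simp only [commFunc_apply, Matrix.cons_val_zero, Matrix.cons_val_one, H _ _,
    Derivation.leibniz, dK_zK, smul_eq_mul, mul_one, add_mul, mul_add, KField.map_add, mul_assoc,
    mul_left_comm (x 0) (zK n)]
  simp only [mul_left_comm (dK n (x 0)) (zK n)]
  abel_nf
  rfl

variable [T0Space U] [CompleteSpace U]

/-- The relation `[a_(p), b_(q)] = c_(p + q) + p e_(p + q - 1)` between the products with a third
field. -/
lemma AffineRel.commutator {a b c e : KField n U} (H : AffineRel a b c e) (p q : ℤ)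
    (d : KField n U) :
    nProd p a (nProd q b d) - nProd q b (nProd p a d) =
      nProd (p + q) c d + (p : An n) • nProd (p + q - 1) e d := by
  refine KField.ext fun h => eq_of_red (n := n) fun N => ?_
  have hcom := red_commutator N p q ![a, b, d] h
  have e1 : prodMod N ![a, b, d] 1 - prodMod N ![a, b, d] (Equiv.swap 0 1) =
      pull (mulForm n) (duo N c d) + pull (dForm n) (duo N e d) := by
    refine MultilinearMap.ext fun (x : Fin 3 → Kn n) => ?_
    rw [_root_.sub_apply, _root_.add_apply, pull_apply, pull_apply, duo_apply, duo_apply,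
      prodMod_apply, prodMod_apply, prodFunc_apply, prodFunc_apply, ← map_sub, ← map_add]
    simp only [Matrix.cons_val_zero, Matrix.cons_val_one, LinearMap.mul_apply', dForm_apply]
    rw [← add_mul, ← H]
    simp [List.ofFn_succ, sub_mul, mul_assoc, Equiv.swap_apply_of_ne_of_ne]
  have e2 : prodMod N ![a, b, d] (Equiv.swap 1 2 * Equiv.swap 0 1 * Equiv.swap 1 2) -
        prodMod N ![a, b, d] (Equiv.swap 1 2 * Equiv.swap 0 1) =
      -(pull (mulForm n) (duoSwap N c d) + pull (dForm n) (duoSwap N e d)) := by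
    refine MultilinearMap.ext fun (x : Fin 3 → Kn n) => ?_
    rw [_root_.neg_apply, _root_.sub_apply, _root_.add_apply, pull_apply, pull_apply,
      duoSwap_apply, duoSwap_apply,
      prodMod_apply, prodMod_apply, prodFunc_apply, prodFunc_apply, ← map_sub, ← map_add,
      ← map_neg]
    simp only [Matrix.cons_val_zero, Matrix.cons_val_one, LinearMap.mul_apply', dForm_apply]
    rw [← mul_add, ← H]
    simp [List.ofFn_succ, mul_sub, Equiv.swap_apply_of_ne_of_ne]
  have s1 : PullSlots 1 2 2 := Or.inl ⟨rfl, rfl, rfl⟩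
  have s0 : PullSlots 0 0 1 := Or.inr ⟨rfl, rfl, rfl⟩
  obtain ⟨m1, k1⟩ := biPow_pull_mulForm s1 (duo_mem_expDom N c d)
  obtain ⟨m2, k2⟩ := biPow_pull_dForm s1 (duo_mem_expDom N e d)
  obtain ⟨m3, k3⟩ := biPow_pull_mulForm s0 (duoSwap_mem_expDom N c d)
  obtain ⟨m4, k4⟩ := biPow_pull_dForm s0 (duoSwap_mem_expDom N e d)
  have h0 : ∀ E : Func n (Fin 2) (U ⧸ L.nhd N), E ![0, h] = 0 := fun E =>
    E.map_coord_zero (i := 0) rfl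
  rw [e1, e2, biPow_neg p q (add_mem m3 m4), biPow_add p q m1 m2, biPow_add p q m3 m4, k1, k2, k3,
    k4] at hcom
  refine hcom.trans ?_
  rw [KField.add_apply, KField.smul_apply, map_add, map_smul, red_nProd, red_nProd]
  simp only [_root_.add_apply, _root_.neg_apply, _root_.smul_apply, pull_apply, dForm_apply,
    Matrix.cons_val_zero, Matrix.cons_val_one, Matrix.cons_val, Derivation.map_one_eq_zero,
    h0, LinearMap.mul_apply', mul_one, smul_sub]
  abel

end Affine

/-! ### The vacuum -/

section Residue

variable {n : ℕ}

lemma residue_pow_mul_phiInv_pow (hn : 0 < n) {a : ℕ} (ha : a < n) (N : ℕ) :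
    residue n (zK n ^ a * phiInv n ^ (N + 1)) = if N = 0 ∧ a + 1 = n then 1 else 0 := by
  have h : zK n ^ a * phiInv n ^ (N + 1) * phiK n ^ (N + 1) =
      algebraMap (Rn n) (Kn n) (PowerSeries.X ^ a) := by
    rw [mul_assoc, ← mul_pow, mul_comm (phiInv n), phiK_mul_phiInv, one_pow, mul_one, map_pow, zK]
  rw [residue_eq n h, resNum_eq n (q := 0) (p := X ^ a), Polynomial.coeff_X_pow]
  · have : (N + 1) * n - 1 = a ↔ N = 0 ∧ a + 1 = n := by
      constructor
      · intro h'
        rcases N with _ | N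
        · simp at h'; omega
        · have : (N + 1 + 1) * n = N * n + n + n := by ring
          have := Nat.zero_le (N * n)
          omega
      · rintro ⟨rfl, rfl⟩; simp
    simp [this]
  · rw [Polynomial.degree_X_pow]
    have : a < (N + 1) * n := by nlinarith
    exact_mod_cast this
  · simp

end Residue

section VacuumFunctional

variable {n : ℕ} {P : Type*} [AddCommGroup P] [Module (An n) P]

/-- The functional `(f, h) ↦ (∫ f) β(h)` has only one expansion `G` of its quotient by `z - w`
that is small in the second variable, and `G (1, f) = β f`: this is the residue of
`β(w) / (z - w)`. -/
lemma expansion_residue (hn : 0 < n) (β : Kn n →ₗ[An n] P) {G : Func n (Fin 2) P}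
    (hG : G ∈ expDom 0 1 1)
    (h : ∀ f h : Kn n, G ![zK n * f, h] - G ![f, zK n * h] = residue n f • β h) (f : Kn n) :
    G ![1, f] = β f := by
  have step : ∀ N f, G ![phiInv n ^ N, f] =
      G ![phiInv n ^ (N + 1), phiK n * f] + (if N = 0 then 1 else 0 : An n) • β f := by
    intro N f
    set u := phiInv n ^ (N + 1)
    let Λ : Kn n →ₗ[An n] P :=
      { toFun := fun y => G ![y * u, f] - G ![u, y * f]
        map_add' := fun y y' => by rw [add_mul, add_mul, Func.add_left, Func.add_right]; abel
        map_smul' := fun c y => by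
          rw [smul_mul_assoc, smul_mul_assoc, Func.smul_left, Func.smul_right, smul_sub]; rfl }
    have hz : ∀ k ≤ n, ∀ f, G ![zK n ^ k * u, f] = G ![u, zK n ^ k * f] +
        (if N = 0 ∧ k = n then 1 else 0 : An n) • β f := by
      intro k
      induction k with
      | zero => intro _ f; simp [hn.ne]
      | succ k ih =>
        intro hk f
        have h1 := h (zK n ^ k * u) f
        rw [residue_pow_mul_phiInv_pow hn (by omega), ih (by omega)] at h1
        rw [if_neg (by omega), zero_smul, add_zero, sub_eq_iff_eq_add'] at h1
        rw [pow_succ', mul_assoc, h1, ← mul_assoc, ← pow_succ, ← pow_succ']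
    have hΛ : ∀ k ≤ n, Λ (zK n ^ k) = (if N = 0 ∧ k = n then 1 else 0 : An n) • β f :=
      fun k hk => sub_eq_iff_eq_add'.2 (hz k hk f)
    have h2 : Λ (phiK n) = (if N = 0 then 1 else 0 : An n) • β f := by
      rw [← aeval_phi, Polynomial.aeval_eq_sum_range, map_sum, phi_natDegree,
        Finset.sum_range_succ, Finset.sum_eq_zero, zero_add, map_smul, hΛ n le_rfl]
      · have : (phi n).coeff n = 1 := by
          have := (phi_monic n).coeff_natDegree
          rwa [phi_natDegree] at this
        simp [this]
      · intro k hk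
        rw [Finset.mem_range] at hk
        rw [map_smul, hΛ k hk.le, if_neg (by omega), zero_smul, smul_zero]
    have h3 : phiK n * u = phiInv n ^ N := by
      rw [show u = phiInv n * phiInv n ^ N from pow_succ' _ _, ← mul_assoc, phiK_mul_phiInv,
        one_mul]
    have h4 : Λ (phiK n) = G ![phiK n * u, f] - G ![u, phiK n * f] := rfl
    rw [h2, h3] at h4
    rw [h4]; abel
  have key : ∀ M, G ![1, f] = G ![phiInv n ^ (M + 1), phiK n ^ (M + 1) * f] + β f := by
    intro M
    induction M with
    | zero => simpa using step 0 f
    | succ M ih =>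
      rw [ih, step (M + 1), if_neg (by omega), zero_smul, add_zero, ← mul_assoc, ← pow_succ']
  obtain ⟨M, hM⟩ := hG 0
  obtain ⟨N, hN⟩ := phiK_pow_mul_mem f M
  rw [key N, hM _ (fun k hk => by fin_cases k <;> simp at hk) (hN _ (by omega)), zero_add]

/-- A functional annihilated by `z - w` that is continuous in each variable is symmetric on pairs
`(1, f)`. -/
lemma symm_of_zDiff_eq_zero {D : Func n (Fin 2) P}
    (h : ∀ f h : Kn n, D ![zK n * f, h] = D ![f, zK n * h])
    (h0 : ∃ M, ∀ f ∈ Jn n M, D ![f, 1] = 0) (h1 : ∃ M, ∀ f ∈ Jn n M, D ![1, f] = 0) (f : Kn n) :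
    D ![1, f] = D ![f, 1] := by
  let S : Subalgebra (An n) (Kn n) :=
    { carrier := {r | ∀ f h, D ![r * f, h] = D ![f, r * h]}
      mul_mem' := fun {r s} hr hs f h => by rw [mul_assoc, hr, hs, ← mul_assoc, mul_comm s]
      add_mem' := fun {r s} hr hs f h => by
        rw [add_mul, add_mul, Func.add_left, Func.add_right, hr, hs]
      algebraMap_mem' := fun a f h => by
        rw [← Algebra.smul_def, ← Algebra.smul_def, Func.smul_left, Func.smul_right] }
  have hS : ∀ p : (An n)[X], Polynomial.aeval (zK n) p ∈ S := fun p =>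
    (Algebra.adjoin_le (S := S) (Set.singleton_subset_iff.2 h))
      (Polynomial.aeval_mem_adjoin_singleton _ _)
  have hφ : phiInv n ∈ S := fun f h => by
    have h1 : phiK n ∈ S := aeval_phi (n := n) ▸ hS _
    have h2 := h1 (phiInv n * f) (phiInv n * h)
    rw [← mul_assoc, ← mul_assoc, phiK_mul_phiInv, one_mul, one_mul] at h2
    exact h2.symm
  obtain ⟨M, hM⟩ := h0
  obtain ⟨M', hM'⟩ := h1
  obtain ⟨N, r, hr⟩ := exists_num n f
  set L := N + max M M'
  obtain ⟨q, hq⟩ := remPhi_spec n L r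
  set p := remPhi n L r
  have hf : f = phiInv n ^ N * Polynomial.aeval (zK n) p +
      phiK n ^ max M M' * algebraMap (Rn n) (Kn n) q := by
    have : f = phiInv n ^ N * algebraMap (Rn n) (Kn n) r := by
      rw [← hr, mul_comm f, phiInv_pow_mul]
    rw [this, hq, aeval_zK, map_add, map_mul, map_pow]
    change phiInv n ^ N * (phiK n ^ (N + max M M') * _ + _) = _
    rw [pow_add, mul_add, mul_assoc, phiInv_pow_mul, add_comm]
  have hmem : ∀ K ≤ max M M', phiK n ^ max M M' * algebraMap (Rn n) (Kn n) q ∈ Jn n K :=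
    fun K hK => Jn_anti n hK ⟨q, rfl⟩
  have hs : phiInv n ^ N * Polynomial.aeval (zK n) p ∈ S := mul_mem (pow_mem hφ N) (hS p)
  have hs' := hs 1 1
  rw [mul_one] at hs'
  rw [hf, Func.add_left, Func.add_right, hM _ (hmem _ (le_max_left _ _)),
    hM' _ (hmem _ (le_max_right _ _)), hs']

end VacuumFunctional

section Vacuum

variable {n : ℕ} {U : Type*} [Ring U] [UniformSpace U] [IsUniformAddGroup U]
  [IsTopologicalRing U] [Algebra (An n) U] [ContinuousConstSMul (An n) U] [L : LeftLinear U]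

lemma isLocalOfOrder_oneField_left (b : KField n U) : IsLocalOfOrder 0 (oneField n U) b := by
  ext x
  rw [pow_zero, Module.End.one_apply, commFunc_apply, oneField_apply, Algebra.commutes, sub_self]
  rfl

lemma isLocalOfOrder_oneField_right (b : KField n U) : IsLocalOfOrder 0 b (oneField n U) := by
  ext x
  rw [pow_zero, Module.End.one_apply, commFunc_apply, oneField_apply, Algebra.commutes, sub_self]
  rfl

lemma oneField_deriv : (oneField n U).deriv = 0 := by
  refine KField.ext fun f => ?_
  rw [KField.deriv_apply, oneField_apply, map_neg, residue_dK, neg_zero, map_zero]; rfl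

lemma residue_eq_zero_of_mem {f : Kn n} (hf : f ∈ Jn n 0) : residue n f = 0 := by
  obtain ⟨r, rfl⟩ := hf
  rw [pow_zero, one_mul, residue_Rn]

variable [T0Space U] [CompleteSpace U]

/-- The vacuum axiom `𝟏_(-1) b = b`. In the swapped order, the expansion only involves the residues
of elements of `R_n` and vanishes; the other one is computed by `expansion_residue`. -/
lemma nProd_oneField_left_neg_one (hn : 0 < n) (b : KField n U) :
    nProd (-1) (oneField n U) b = b := by
  refine KField.ext fun f => eq_of_red (n := n) fun N => ?_
  have d1 := duo_mem_expDom N (oneField n U) b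
  have d0 := duoSwap_mem_expDom N (oneField n U) b
  have h0 : duoSwap N (oneField n U) b ∈ vanishAt 0 0 := fun x hx => by
    rw [duoSwap_apply, oneField_apply, residue_eq_zero_of_mem hx, map_zero, mul_zero, map_zero]
  rw [red_nProd, zPow_mem_vanishAt (by decide) (Or.inl rfl) (-1) h0 ![1, f] ⟨1, by simp⟩, sub_zero]
  refine expansion_residue hn (red n N ∘ₗ b.lin) (zPow_mem (-1) d1) (fun f h => ?_) f
  rw [← zDiff_apply_fin_two, zDiff_zPow (by decide) (Or.inr rfl) _ d1, neg_add_cancel,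
    zPow_zero d1, duo_apply, oneField_apply]
  simp only [Matrix.cons_val_zero, Matrix.cons_val_one]
  rw [← Algebra.smul_def, map_smul]
  rfl

/-- The vacuum axiom `a_(-1) 𝟏 = a`. The two expansions of `(z - w)⁻¹ a(z) 𝟏(w)` differ by a
functional supported on the diagonal, which is symmetric on the pairs `(1, f)`; the exchange of
variables reduces the claim to `expansion_residue`. -/
lemma nProd_oneField_right_neg_one (hn : 0 < n) (a : KField n U) :
    nProd (-1) a (oneField n U) = a := by
  refine KField.ext fun f => eq_of_red (n := n) fun N => ?_
  have hinj : ∀ π : Equiv.Perm (Fin 2), Function.Injective fun i => ((π⁻¹ i : Fin 2) : ℕ) :=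
    fun π => Fin.val_injective.comp (π⁻¹).injective
  have d1 := duo_mem_expDom N a (oneField n U)
  have d0 := duoSwap_mem_expDom N a (oneField n U)
  have o1 := zPow_mem_ordered (by decide : (0 : Fin 2) ≠ 1) (Or.inr rfl) (hinj 1) (by decide)
    (by decide) (-1) (prodMod_mem_ordered N ![a, oneField n U] 1)
  have o0 := zPow_mem_ordered (by decide : (0 : Fin 2) ≠ 1) (Or.inl rfl) (hinj (Equiv.swap 0 1))
    (by decide) (by decide) (-1) (prodMod_mem_ordered N ![a, oneField n U] (Equiv.swap 0 1))
  set G := zPow 0 1 1 (-1) (duo N a (oneField n U)) with hG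
  set G' := zPow 0 1 0 (-1) (duoSwap N a (oneField n U)) with hG'
  have e1 : zDiff 0 1 G = duo N a (oneField n U) := by
    rw [hG, zDiff_zPow (by decide) (Or.inr rfl) _ d1, neg_add_cancel, zPow_zero d1]
  have e0 : zDiff 0 1 G' = duoSwap N a (oneField n U) := by
    rw [hG', zDiff_zPow (by decide) (Or.inl rfl) _ d0, neg_add_cancel, zPow_zero d0]
  have e01 : duo N a (oneField n U) = duoSwap N a (oneField n U) := by
    ext x
    rw [duo_apply, duoSwap_apply, oneField_apply, Algebra.commutes]
  have hz : ∀ f h : Kn n, (G - G') ![zK n * f, h] = (G - G') ![f, zK n * h] := fun f h => by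
    rw [← sub_eq_zero, ← zDiff_apply_fin_two, map_sub, e1, e0, e01, sub_self]; rfl
  -- a bilinear functional that is continuous in one variable for each value of the other
  have hv : ∀ {r : Fin 2 → ℕ} {H : Func n (Fin 2) (U ⧸ L.nhd N)}, H ∈ ordered r →
      (∃ M, ∀ f ∈ Jn n M, H ![f, 1] = 0) ∧ ∃ M, ∀ f ∈ Jn n M, H ![1, f] = 0 := by
    intro r H hH
    obtain ⟨M, hM⟩ := mem_ordered.1 hH 0 ![1, 1]
    obtain ⟨M', hM'⟩ := mem_ordered.1 hH 1 ![1, 1]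
    refine ⟨⟨M, fun f hf => hM _ (fun k hk => ?_) hf⟩, M', fun f hf => hM' _ (fun k hk => ?_) hf⟩
    · fin_cases k
      · simp at hk
      · rfl
    · fin_cases k
      · rfl
      · simp at hk
  obtain ⟨⟨M1, h1⟩, M1', h1'⟩ := hv o1
  obtain ⟨⟨M0, h0⟩, M0', h0'⟩ := hv o0
  have hsym := symm_of_zDiff_eq_zero hz
    ⟨max M1 M0, fun f hf => by
      rw [_root_.sub_apply, h1 f (Jn_anti n (le_max_left _ _) hf),
        h0 f (Jn_anti n (le_max_right _ _) hf), sub_zero]⟩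
    ⟨max M1' M0', fun f hf => by
      rw [_root_.sub_apply, h1' f (Jn_anti n (le_max_left _ _) hf),
        h0' f (Jn_anti n (le_max_right _ _) hf), sub_zero]⟩ f
  have hG0 : G ![f, 1] = 0 :=
    zPow_mem_vanishAt (by decide) (Or.inr rfl) (-1) (M := 0) (fun x hx => by
      rw [duo_apply, oneField_apply, residue_eq_zero_of_mem hx, map_zero, mul_zero, map_zero])
      ![f, 1] ⟨1, by simp⟩
  -- the expansion that is small in the first variable, with the variables exchanged
  have hs : ∀ f h, -slice 1 0 (by decide) 0 G' ![f, h] = -G' ![h, f] := fun f h => by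
    rw [slice_apply]
    congr 2
    ext k; fin_cases k <;> rfl
  have hG1 : -G' ![f, 1] = red n N (a f) := by
    rw [← hs]
    refine expansion_residue hn (red n N ∘ₗ a.lin) (G := -slice 1 0 (by decide) 0 G') ?_
      (fun f h => ?_) f
    · exact neg_mem (slice_mem_expDom (s' := 1) _ (Or.inr ⟨rfl, rfl⟩) _
        (ordered_le_expDom (by decide) (by decide) o0))
    · rw [_root_.neg_apply, _root_.neg_apply, hs, hs, neg_sub_neg, ← zDiff_apply_fin_two, e0,
        duoSwap_apply, oneField_apply]
      simp only [Matrix.cons_val_zero, Matrix.cons_val_one]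
      rw [← Algebra.smul_def, map_smul]
      rfl
  rw [red_nProd, ← _root_.sub_apply, hsym, _root_.sub_apply, hG0, zero_sub, hG1]

lemma intCast_smul_eq_zero {m : ℤ} (hm : m ≠ 0) {a : KField n U} (h : (m : An n) • a = 0) :
    a = 0 := by
  have : IsUnit ((m : ℤ) : An n) := by
    have h1 : ((m : ℤ) : An n) = algebraMap ℂ (An n) (m : ℂ) := by simp
    rw [h1]
    exact (IsUnit.mk0 _ (by exact_mod_cast hm)).map _
  exact this.smul_eq_zero.1 h

/-- The remaining products with `𝟏` on the left follow from translation covariance and locality. -/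
lemma nProd_oneField_left (hn : 0 < n) (m : ℤ) (b : KField n U) :
    nProd m (oneField n U) b = if m = -1 then b else 0 := by
  rcases lt_trichotomy m (-1) with h | h | h
  · rw [if_neg h.ne]
    obtain ⟨k, rfl⟩ : ∃ k : ℕ, m = -1 - k - 1 := ⟨(-1 - m - 1).toNat, by omega⟩
    clear h
    induction k generalizing b with
    | zero =>
      have := deriv_nProd (-1) (oneField n U) b
      rw [nProd_oneField_left_neg_one hn, nProd_oneField_left_neg_one hn, sub_self] at this
      simpa using this.symm
    | succ k ih =>
      have h1 := deriv_nProd (-1 - (k : ℤ) - 1) (oneField n U) b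
      have hd : (0 : KField n U).deriv = 0 := rfl
      rw [ih b, ih b.deriv, sub_zero, hd, ← Int.cast_neg] at h1
      have h2 := intCast_smul_eq_zero (by omega) h1.symm
      rwa [show (-1 - (k : ℤ) - 1 - 1) = -1 - ((k + 1 : ℕ) : ℤ) - 1 by push_cast; ring] at h2
  · rw [if_pos h, h, nProd_oneField_left_neg_one hn]
  · rw [if_neg h.ne', nProd_eq_zero_of_isLocalOfOrder (isLocalOfOrder_oneField_left b)
      (by push_cast; omega)]

lemma nProd_oneField_right_nonneg {m : ℤ} (hm : 0 ≤ m) (a : KField n U) :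
    nProd m a (oneField n U) = 0 :=
  nProd_eq_zero_of_isLocalOfOrder (isLocalOfOrder_oneField_right a) (by exact_mod_cast hm)

end Vacuum

/-! ### The vertex algebra of fields -/

section OfModes

variable {V : Type*} [AddCommGroup V] [Module ℂ V]

lemma vertexOperator_ext {A B : VertexOperator ℂ V} (h : ∀ m b, A.ncoeff m b = B.ncoeff m b) :
    A = B := by
  refine VertexOperator.ext A B fun b => ?_
  apply (HahnModule.of ℂ).symm.injective
  refine HahnSeries.ext (funext fun m => ?_)
  have := h (-m - 1) b
  rwa [← VertexOperator.coeff_eq_ncoeff, ← VertexOperator.coeff_eq_ncoeff] at this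

/-- The state-field correspondence with given products `mode m a b = a_(m) b`. -/
def correspondenceOfModes (mode : ℤ → V →ₗ[ℂ] V →ₗ[ℂ] V)
    (h : ∀ a b, BddBelow (Function.support fun y : ℤ => mode (-y - 1) a b)) :
    V →ₗ[ℂ] VertexOperator ℂ V where
  toFun a := VertexOperator.of_coeff (fun y => mode (-y - 1) a) (h a)
  map_add' a a' := vertexOperator_ext fun m b => by
    simp [VertexOperator.ncoeff_of_coeff]
  map_smul' c a := vertexOperator_ext fun m b => by
    simp [VertexOperator.ncoeff_of_coeff]

lemma ncoeff_correspondenceOfModes (mode : ℤ → V →ₗ[ℂ] V →ₗ[ℂ] V)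
    (h : ∀ a b, BddBelow (Function.support fun y : ℤ => mode (-y - 1) a b)) (a : V) (m : ℤ) :
    (correspondenceOfModes mode h a).ncoeff m = mode m a := by
  change (VertexOperator.of_coeff (fun y => mode (-y - 1) a) (h a)).ncoeff m = _
  rw [VertexOperator.ncoeff_of_coeff, neg_sub, sub_neg_eq_add, add_sub_cancel_left]

/-- The vertex algebra with given products. -/
def VertexAlgebra.ofModes (vac : V) (T : V →ₗ[ℂ] V) (mode : ℤ → V →ₗ[ℂ] V →ₗ[ℂ] V)
    (h : ∀ a b, BddBelow (Function.support fun y : ℤ => mode (-y - 1) a b))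
    (vac_mode : ∀ m b, mode m vac b = if m = -1 then b else 0)
    (mode_vac_nonneg : ∀ a, ∀ m : ℤ, 0 ≤ m → mode m a vac = 0)
    (mode_vac_neg_one : ∀ a, mode (-1) a vac = a) (T_vac : T vac = 0)
    (translation : ∀ a m b, T (mode m a b) - mode m a (T b) = -(m : ℂ) • mode (m - 1) a b)
    (locality : ∀ a b, ∃ N : ℕ, ∀ (p q : ℤ) (c : V),
      ∑ j ∈ Finset.range (N + 1), ((-1 : ℂ) ^ j * (N.choose j : ℂ)) •
        (mode (p + N - j) a (mode (q + j) b c) - mode (q + j) b (mode (p + N - j) a c)) = 0) :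
    VertexAlgebra V where
  vac := vac
  T := T
  Y := correspondenceOfModes mode h
  vac_mode m b := by rw [ncoeff_correspondenceOfModes, vac_mode]
  mode_vac_nonneg a m hm := by rw [ncoeff_correspondenceOfModes, mode_vac_nonneg a m hm]
  mode_vac_neg_one a := by rw [ncoeff_correspondenceOfModes, mode_vac_neg_one]
  T_vac := T_vac
  translation a m b := by
    rw [ncoeff_correspondenceOfModes, ncoeff_correspondenceOfModes, translation]
  locality a b := by
    simp only [ncoeff_correspondenceOfModes]
    exact locality a b

end OfModes

section Commutant

variable {n : ℕ} {U : Type*} [Ring U] [UniformSpace U] [IsUniformAddGroup U]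
  [IsTopologicalRing U] [Algebra (An n) U] [ContinuousConstSMul (An n) U] [L : LeftLinear U]

/-- The fields that are mutually local with all the fields of `S`. -/
def localCommutant (S : Set (KField n U)) : Submodule ℂ (KField n U) where
  carrier := {a | ∀ b ∈ S, IsLocal a b}
  add_mem' ha ha' b hb := (ha b hb).add_left (ha' b hb)
  zero_mem' b _ := IsLocal.zero_left b
  smul_mem' c a ha b hb := by rw [KField.complex_smul_eq]; exact (ha b hb).smul_left _

lemma oneField_mem_localCommutant (S : Set (KField n U)) : oneField n U ∈ localCommutant S :=
  fun b _ => ⟨0, isLocalOfOrder_oneField_left b⟩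

variable [T0Space U] [CompleteSpace U]

/-- The double commutant of a set of mutually local fields is a closed space of mutually local
fields. -/
lemma isClosedSpace_localCommutant {S : Set (KField n U)} (hS : ∀ a ∈ S, ∀ b ∈ S, IsLocal a b) :
    S ⊆ localCommutant (localCommutant S : Set (KField n U)) ∧
      IsClosedSpace (localCommutant (localCommutant S : Set (KField n U))) ∧
      ∀ a ∈ localCommutant (localCommutant S : Set (KField n U)),
        ∀ b ∈ localCommutant (localCommutant S : Set (KField n U)), IsLocal a b := by
  have h1 : S ⊆ localCommutant (localCommutant S : Set (KField n U)) :=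
    fun a ha b hb => (hb a ha).symm
  have h2 : ∀ a ∈ localCommutant (localCommutant S : Set (KField n U)), a ∈ localCommutant S :=
    fun a ha b hb => ha b (hS b hb)
  have h3 : ∀ a ∈ localCommutant (localCommutant S : Set (KField n U)),
      ∀ b ∈ localCommutant (localCommutant S : Set (KField n U)), IsLocal a b :=
    fun a ha b hb => ha b (h2 b hb)
  refine ⟨h1, ⟨fun a ha b hb m c hc => ?_, fun a ha b hb => (ha b hb).deriv_left⟩, h3⟩
  rw [isNProd_iff.1 hc]
  exact fun d hd => (h3 a ha b hb).nProd_left (ha d hd) (hb d hd) m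

end Commutant

section Hat

variable (n : ℕ) (g : Type*) [LieRing g] [LieAlgebra ℂ g] (k : ℂ)

/-- The closure of the `N`-th left ideal in the completed enveloping algebra. -/
def leftIdealHat (N : ℕ) : Ideal (UTilde n g k) where
  carrier := closure ((fun u : UPrime (dataKn n) g k => (u : UTilde n g k)) '' leftIdeal n g k N)
  add_mem' {u v} hu hv := by
    refine map_mem_closure₂ continuous_add hu hv ?_
    rintro _ ⟨a, ha, rfl⟩ _ ⟨b, hb, rfl⟩
    exact ⟨a + b, add_mem ha hb, UniformSpace.Completion.coe_add a b⟩
  zero_mem' := subset_closure ⟨0, zero_mem _, UniformSpace.Completion.coe_zero⟩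
  smul_mem' u v hv := by
    refine map_mem_closure₂ continuous_mul (UniformSpace.Completion.denseRange_coe u) hv ?_
    rintro _ ⟨a, rfl⟩ _ ⟨b, hb, rfl⟩
    exact ⟨a * b, Ideal.mul_mem_left _ a hb, UniformSpace.Completion.coe_mul a b⟩

/-- The completed enveloping algebra has a basis of neighbourhoods of `0` consisting of left
ideals. -/
instance : LeftLinear (UTilde n g k) where
  nhd := leftIdealHat n g k
  hasBasis := (leftIdeal_basis n g k).hasBasis_nhds_zero.hasBasis_of_isDenseInducing
    UniformSpace.Completion.isDenseInducing_coe

lemma hatField_apply (x : g) (f : Kn n) :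
    hatField n g k x f = (curU (dataKn n) g k x f : UTilde n g k) := rfl

lemma coe_algebraMap_UTilde (a : An n) :
    ((algebraMap (An n) (UPrime (dataKn n) g k) a : UPrime (dataKn n) g k) : UTilde n g k) =
      algebraMap (An n) (UTilde n g k) a := rfl

/-- The commutation relations of the fields `X̂`. -/
lemma affineRel_hatField (x y : g) : AffineRel (hatField n g k x) (hatField n g k y)
    (hatField n g k ⁅x, y⁆) (levelForm g k x y • oneField n (UTilde n g k)) := by
  intro f h
  rw [KField.complex_smul_eq, KField.smul_apply, oneField_apply, Algebra.smul_def, ← map_mul,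
    ← Algebra.smul_def, hatField_apply, hatField_apply, hatField_apply,
    ← coe_algebraMap_UTilde, sub_eq_iff_eq_add', ← UniformSpace.Completion.coe_mul,
    ← UniformSpace.Completion.coe_mul, ← UniformSpace.Completion.coe_add,
    ← UniformSpace.Completion.coe_add, curU_mul_curU, mul_comm (dK n f), ← add_assoc]
  rfl

lemma isLocal_hatField (x y : g) : IsLocal (hatField n g k x) (hatField n g k y) :=
  ⟨2, (affineRel_hatField n g k x y).isLocalOfOrder⟩

lemma hatField_mem (x : g) : hatField n g k x ∈ hatClosure n g k := by
  refine Submodule.mem_sInf.2 fun G hG => hG.1 (Submodule.subset_span ⟨x, rfl⟩)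

lemma isClosedSpace_hatClosure : IsClosedSpace (hatClosure n g k) where
  nProd a ha b hb m c hc := Submodule.mem_sInf.2 fun G hG =>
    hG.2.nProd a (Submodule.mem_sInf.1 ha G hG) b (Submodule.mem_sInf.1 hb G hG) m c hc
  deriv a ha := Submodule.mem_sInf.2 fun G hG => hG.2.deriv a (Submodule.mem_sInf.1 ha G hG)

lemma hatClosure_le {G : Submodule ℂ (KField n (UTilde n g k))}
    (h : ∀ x, hatField n g k x ∈ G) (hG : IsClosedSpace G) : hatClosure n g k ≤ G :=
  sInf_le ⟨Submodule.span_le.2 (by rintro _ ⟨x, rfl⟩; exact h x), hG⟩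

lemma isLocal_VKn {a b : KField n (UTilde n g k)} (ha : a ∈ VKn n g k) (hb : b ∈ VKn n g k) :
    IsLocal a b := by
  obtain ⟨h1, h2, h3⟩ := isClosedSpace_localCommutant (S := Set.range (hatField n g k))
    (by rintro _ ⟨x, rfl⟩ _ ⟨y, rfl⟩; exact isLocal_hatField n g k x y)
  have hle : VKn n g k ≤ localCommutant (localCommutant (Set.range (hatField n g k)) :
      Set (KField n (UTilde n g k))) :=
    sup_le (hatClosure_le n g k (fun x => h1 ⟨x, rfl⟩) h2)
      (Submodule.span_le.2 (Set.singleton_subset_iff.2 (oneField_mem_localCommutant _)))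
  exact h3 a (hle ha) b (hle hb)

lemma hatClosure_le_VKn : hatClosure n g k ≤ VKn n g k := le_sup_left

lemma oneField_mem_VKn : oneField n (UTilde n g k) ∈ VKn n g k :=
  (le_sup_right : _ ≤ VKn n g k) (Submodule.subset_span rfl)

lemma nProd_mem_hatClosure {a b : KField n (UTilde n g k)} (ha : a ∈ hatClosure n g k)
    (hb : b ∈ hatClosure n g k) (m : ℤ) : nProd m a b ∈ hatClosure n g k :=
  (isClosedSpace_hatClosure n g k).nProd a ha b hb m _ (isNProd_nProd m a b)

lemma deriv_mem_VKn {a : KField n (UTilde n g k)} (ha : a ∈ VKn n g k) : a.deriv ∈ VKn n g k := by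
  obtain ⟨b, hb, c, hc, rfl⟩ := Submodule.mem_sup.1 ha
  obtain ⟨c, rfl⟩ := Submodule.mem_span_singleton.1 hc
  have e : (b + c • oneField n (UTilde n g k)).deriv = b.deriv := by
    change b.deriv + algebraMap ℂ (An n) c • (oneField n (UTilde n g k)).deriv = _
    rw [oneField_deriv, smul_zero, add_zero]
  rw [e]
  exact hatClosure_le_VKn n g k ((isClosedSpace_hatClosure n g k).deriv b hb)

variable {n}

/-- The products `a_(-1 - j) 𝟏` are multiples of the iterated derivatives of `a`, so that the sum
of the closure of the fields `X̂` and `ℂ 𝟏` is stable under products. -/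
lemma nProd_oneField_right_mem_hatClosure (hn : 0 < n) {a : KField n (UTilde n g k)}
    (ha : a ∈ hatClosure n g k) (m : ℤ) :
    nProd m a (oneField n (UTilde n g k)) ∈ hatClosure n g k := by
  rcases lt_or_ge m 0 with h | h
  · obtain ⟨j, rfl⟩ : ∃ j : ℕ, m = -1 - j := ⟨(-1 - m).toNat, by omega⟩
    clear h
    induction j with
    | zero => rw [Nat.cast_zero, sub_zero, nProd_oneField_right_neg_one hn]; exact ha
    | succ j ih =>
      have h1 := deriv_nProd (-1 - (j : ℤ)) a (oneField n (UTilde n g k))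
      have h2 : nProd (-1 - (j : ℤ)) a (0 : KField n (UTilde n g k)) = 0 := by
        have := nProd_smul_right (-1 - (j : ℤ)) 0 a (0 : KField n (UTilde n g k))
        rwa [zero_smul, zero_smul] at this
      rw [oneField_deriv, h2, sub_zero] at h1
      have h3 : (-((-1 - (j : ℤ) : ℤ) : An n)) = algebraMap ℂ (An n) (j + 1) := by
        simp
      rw [h3, ← KField.complex_smul_eq] at h1
      have h4 := (isClosedSpace_hatClosure n g k).deriv _ ih
      rw [h1, Submodule.smul_mem_iff _ (by exact_mod_cast Nat.succ_ne_zero j)] at h4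
      rwa [show -1 - (j : ℤ) - 1 = -1 - ((j + 1 : ℕ) : ℤ) by push_cast; ring] at h4
  · rw [nProd_oneField_right_nonneg h]; exact zero_mem _

lemma nProd_mem_VKn (hn : 0 < n) {a b : KField n (UTilde n g k)} (ha : a ∈ VKn n g k)
    (hb : b ∈ VKn n g k) (m : ℤ) : nProd m a b ∈ VKn n g k := by
  obtain ⟨a, ha', c', hc, rfl⟩ := Submodule.mem_sup.1 ha
  obtain ⟨c, rfl⟩ := Submodule.mem_span_singleton.1 hc
  rw [nProd_add_left, KField.complex_smul_eq, nProd_smul_left, ← KField.complex_smul_eq,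
    nProd_oneField_left hn]
  refine add_mem ?_ (Submodule.smul_mem _ _ ?_)
  · obtain ⟨b, hb', d', hd, rfl⟩ := Submodule.mem_sup.1 hb
    obtain ⟨d, rfl⟩ := Submodule.mem_span_singleton.1 hd
    rw [nProd_add_right, KField.complex_smul_eq, nProd_smul_right, ← KField.complex_smul_eq]
    exact hatClosure_le_VKn n g k (add_mem (nProd_mem_hatClosure n g k ha' hb' m)
      (Submodule.smul_mem _ _ (nProd_oneField_right_mem_hatClosure g k hn ha' m)))
  · split_ifs
    · exact hb
    · exact zero_mem _

variable (hn : 0 < n)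

/-- The product `a_(m) b` on the space of fields. -/
def fieldMode (m : ℤ) : VKn n g k →ₗ[ℂ] VKn n g k →ₗ[ℂ] VKn n g k :=
  LinearMap.mk₂ ℂ (fun a b => ⟨nProd m a.1 b.1, nProd_mem_VKn g k hn a.2 b.2 m⟩)
    (fun a a' b => Subtype.ext (nProd_add_left m a.1 a'.1 b.1))
    (fun c a b => Subtype.ext (nProd_smul_left m (algebraMap ℂ (An n) c) a.1 b.1))
    (fun a b b' => Subtype.ext (nProd_add_right m a.1 b.1 b'.1))
    (fun c a b => Subtype.ext (nProd_smul_right m (algebraMap ℂ (An n) c) a.1 b.1))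

lemma fieldMode_coe (m : ℤ) (a b : VKn n g k) :
    (fieldMode g k hn m a b : KField n (UTilde n g k)) = nProd m a.1 b.1 := rfl

/-- The field `𝟏`, as an element of `V^k_{K_n}(g)`. -/
def fieldVacuum (n : ℕ) : VKn n g k := ⟨oneField n (UTilde n g k), oneField_mem_VKn n g k⟩

lemma fieldVacuum_coe : (fieldVacuum g k n : KField n (UTilde n g k)) = oneField n _ := rfl

lemma fieldMode_vacuum_left (m : ℤ) (b : VKn n g k) :
    fieldMode g k hn m (fieldVacuum g k n) b = if m = -1 then b else 0 := by
  refine Subtype.ext ?_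
  rw [fieldMode_coe, fieldVacuum_coe, nProd_oneField_left hn]
  split_ifs <;> rfl

lemma fieldMode_vacuum_right_nonneg {m : ℤ} (hm : 0 ≤ m) (a : VKn n g k) :
    fieldMode g k hn m a (fieldVacuum g k n) = 0 := by
  refine Subtype.ext ?_
  rw [fieldMode_coe, fieldVacuum_coe, nProd_oneField_right_nonneg hm, Submodule.coe_zero]

lemma fieldMode_vacuum_right_neg_one (a : VKn n g k) :
    fieldMode g k hn (-1) a (fieldVacuum g k n) = a := by
  refine Subtype.ext ?_
  rw [fieldMode_coe, fieldVacuum_coe, nProd_oneField_right_neg_one hn]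

lemma bddBelow_fieldMode (a b : VKn n g k) :
    BddBelow (Function.support fun y : ℤ => fieldMode g k hn (-y - 1) a b) := by
  obtain ⟨r, hr⟩ := isLocal_VKn n g k a.2 b.2
  refine ⟨-r, fun y hy => ?_⟩
  by_contra hlt
  exact hy (Subtype.ext (nProd_eq_zero_of_isLocalOfOrder hr (by omega)))

/-- The translation operator on the space of fields. -/
def fieldTranslation (n : ℕ) : VKn n g k →ₗ[ℂ] VKn n g k where
  toFun a := ⟨a.1.deriv, deriv_mem_VKn n g k a.2⟩
  map_add' _ _ := rfl
  map_smul' _ _ := rfl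

lemma fieldTranslation_vacuum : fieldTranslation g k n (fieldVacuum g k n) = 0 :=
  Subtype.ext oneField_deriv

lemma translation_fieldMode (a : VKn n g k) (m : ℤ) (b : VKn n g k) :
    fieldTranslation g k n (fieldMode g k hn m a b) -
      fieldMode g k hn m a (fieldTranslation g k n b) =
      -(m : ℂ) • fieldMode g k hn (m - 1) a b := by
  refine Subtype.ext ?_
  rw [Submodule.coe_sub, Submodule.coe_smul, KField.complex_smul_eq, map_neg, map_intCast]
  exact deriv_nProd m a.1 b.1

lemma locality_fieldMode (a b : VKn n g k) : ∃ N : ℕ, ∀ (p q : ℤ) (c : VKn n g k),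
    ∑ j ∈ Finset.range (N + 1), ((-1 : ℂ) ^ j * (N.choose j : ℂ)) •
      (fieldMode g k hn (p + N - j) a (fieldMode g k hn (q + j) b c) -
        fieldMode g k hn (q + j) b (fieldMode g k hn (p + N - j) a c)) = 0 := by
  obtain ⟨N, hN⟩ := isLocal_VKn n g k a.2 b.2
  refine ⟨N, fun p q c => Subtype.ext ?_⟩
  refine Eq.trans ?_ (hN.sum_commutator p q c.1)
  rw [Submodule.coe_sum]
  refine Finset.sum_congr rfl fun j _ => ?_
  rw [Submodule.coe_smul, Submodule.coe_sub, fieldMode_coe, fieldMode_coe, fieldMode_coe,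
    fieldMode_coe, ← Int.cast_smul_eq_zsmul ℂ]
  push_cast
  rfl

/-- The vertex algebra structure on the space of fields. -/
def fieldVertexAlgebra : VertexAlgebra (VKn n g k) :=
  .ofModes (fieldVacuum g k n) (fieldTranslation g k n) (fieldMode g k hn)
    (bddBelow_fieldMode g k hn) (fieldMode_vacuum_left g k hn)
    (fun a _ hm => fieldMode_vacuum_right_nonneg g k hn hm a)
    (fieldMode_vacuum_right_neg_one g k hn) (fieldTranslation_vacuum g k)
    (translation_fieldMode g k hn) (locality_fieldMode g k hn)

lemma ncoeff_fieldVertexAlgebra (a : VKn n g k) (m : ℤ) :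
    ((fieldVertexAlgebra g k hn).Y a).ncoeff m = fieldMode g k hn m a :=
  ncoeff_correspondenceOfModes _ _ _ _

lemma isFieldStructure_fieldVertexAlgebra :
    IsFieldStructure n g k (fieldVertexAlgebra g k hn) where
  vac := rfl
  T _ := rfl
  mode a b m := by
    rw [ncoeff_fieldVertexAlgebra, fieldMode_coe]
    exact isNProd_nProd _ _ _

end Hat

/-! ### Representations of the affine Lie algebra -/

section Lift

attribute [local instance 100] LieRing.ofAssociativeRing

variable {A K : Type*} [CommRing A] [CommRing K] [Algebra A K] [Algebra ℂ A] [Algebra ℂ K]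
  [IsScalarTower ℂ A K] (D : ResidueData A K) (g : Type*) [LieRing g] [LieAlgebra ℂ g] (k : ℂ)
  {B : Type*} [Ring B] [Algebra ℂ B] [Algebra A B] [IsScalarTower ℂ A B]

/-- The elements `J f x` of `B` satisfy the relations of the elements `x f` of the affine Lie
algebra. -/
structure IsCurrent (J : K →ₗ[ℂ] g →ₗ[ℂ] B) : Prop where
  smul : ∀ (a : A) f x, J (a • f) x = a • J f x
  comm : ∀ f h x y, J f x * J h y - J h y * J f x =
    J (f * h) ⁅x, y⁆ + algebraMap A B (levelForm g k x y • D.res (h * D.d f))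

variable {D g k} {J : K →ₗ[ℂ] g →ₗ[ℂ] B}

/-- The extension of a current to the affine Lie algebra. -/
def IsCurrent.linearMap (hJ : IsCurrent D g k J) : AffLie D g k →ₗ[A] B where
  toFun u := TensorProduct.lift J u.1 + algebraMap A B u.2
  map_add' u v := by
    change TensorProduct.lift J (u.1 + v.1) + algebraMap A B (u.2 + v.2) = _
    rw [map_add, map_add]; abel
  map_smul' a u := by
    change TensorProduct.lift J (a • u.1) + algebraMap A B (a • u.2) = _
    have h : ∀ t : K ⊗[ℂ] g, TensorProduct.lift J (a • t) = a • TensorProduct.lift J t := by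
      intro t
      induction t with
      | zero => simp
      | add s t hs ht => rw [smul_add, map_add, map_add, hs, ht, smul_add]
      | tmul f x =>
        rw [TensorProduct.smul_tmul', TensorProduct.lift.tmul, TensorProduct.lift.tmul, hJ.smul]
    rw [h, RingHom.id_apply, smul_add, smul_eq_mul, map_mul, ← Algebra.smul_def]

lemma IsCurrent.linearMap_apply (hJ : IsCurrent D g k J) (u : AffLie D g k) :
    hJ.linearMap u = TensorProduct.lift J u.1 + algebraMap A B u.2 := rfl

lemma IsCurrent.linearMap_lie (hJ : IsCurrent D g k J) (u v : AffLie D g k) :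
    hJ.linearMap ⁅u, v⁆ = hJ.linearMap u * hJ.linearMap v - hJ.linearMap v * hJ.linearMap u := by
  have h : ∀ s t : K ⊗[ℂ] g, TensorProduct.lift J ⁅s, t⁆ + algebraMap A B (cocycle D g k s t) =
      TensorProduct.lift J s * TensorProduct.lift J t -
        TensorProduct.lift J t * TensorProduct.lift J s := by
    intro s t
    induction s with
    | zero => simp
    | add s s' hs hs' =>
      rw [add_lie, map_add, map_add, map_add, LinearMap.add_apply, map_add, add_mul, mul_add,
        add_add_add_comm, hs, hs']
      abel
    | tmul f x =>
      induction t with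
      | zero => simp
      | add t t' ht ht' =>
        rw [lie_add, map_add, map_add, map_add, map_add, add_mul, mul_add, add_add_add_comm, ht,
          ht']
        abel
      | tmul h y =>
        rw [LieAlgebra.ExtendScalars.bracket_tmul, cocycle_tmul, TensorProduct.lift.tmul,
          TensorProduct.lift.tmul, TensorProduct.lift.tmul, hJ.comm]
  refine (h u.1 v.1).trans ?_
  rw [hJ.linearMap_apply, hJ.linearMap_apply, add_mul, add_mul, mul_add, mul_add, mul_add, mul_add,
    Algebra.commutes u.2 (TensorProduct.lift J v.1),
    Algebra.commutes v.2 (TensorProduct.lift J u.1), Algebra.commutes u.2 (algebraMap A B v.2)]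
  abel

/-- The homomorphism from the enveloping algebra given by a current. -/
def IsCurrent.lift (hJ : IsCurrent D g k J) : UPrime D g k →ₐ[A] B :=
  RingQuot.liftAlgHom A ⟨UniversalEnvelopingAlgebra.lift A
    { hJ.linearMap with
      map_lie' := fun {u v} => by
        rw [LieRing.of_associative_ring_bracket]; exact hJ.linearMap_lie u v }, by
    rintro _ _ ⟨⟩
    rw [UniversalEnvelopingAlgebra.lift_ι_apply, map_one]
    change TensorProduct.lift J 0 + algebraMap A B 1 = 1
    rw [map_zero, map_one, zero_add]⟩

lemma IsCurrent.lift_curU (hJ : IsCurrent D g k J) (x : g) (f : K) :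
    hJ.lift (curU D g k x f) = J f x := by
  change RingQuot.liftAlgHom A _ (RingQuot.mkAlgHom A (OneRel D g k)
    (UniversalEnvelopingAlgebra.ι A (cur D g k x f))) = _
  rw [RingQuot.liftAlgHom_mkAlgHom_apply, UniversalEnvelopingAlgebra.lift_ι_apply]
  change TensorProduct.lift J (f ⊗ₜ x) + algebraMap A B 0 = _
  rw [TensorProduct.lift.tmul, map_zero, add_zero]

end Lift

section Laurent

lemma tpow_mul (a b : ℤ) : Lt.tpow a * Lt.tpow b = Lt.tpow (a + b) := by
  rw [Lt.tpow, Lt.tpow, Lt.tpow, ← map_mul, HahnSeries.single_mul_single, one_mul]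

lemma tpow_zero : Lt.tpow 0 = 1 := rfl

lemma exists_eq_tpow_mul (f : Lt) : ∃ (N : ℕ) (r : PowerSeries ℂ),
    f = Lt.tpow (-N) * algebraMap (PowerSeries ℂ) Lt r := by
  obtain ⟨⟨r, y⟩, h⟩ := IsLocalization.surj (Submonoid.powers (PowerSeries.X : PowerSeries ℂ)) f
  obtain ⟨N, hN⟩ := y.2
  refine ⟨N, r, ?_⟩
  simp only at h hN
  rw [← hN, ← Lt.tpow_natCast] at h
  rw [← h, mul_comm f, ← mul_assoc, tpow_mul, neg_add_cancel, tpow_zero, one_mul]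

/-- The submodule `t ^ M ℂ[[t]]` of `ℂ((t))`. -/
def LtNhd (M : ℤ) : Submodule ℂ Lt where
  carrier := {f | ∃ r, f = Lt.tpow M * algebraMap (PowerSeries ℂ) Lt r}
  add_mem' := by rintro _ _ ⟨r, rfl⟩ ⟨s, rfl⟩; exact ⟨r + s, by rw [map_add, mul_add]⟩
  zero_mem' := ⟨0, by rw [map_zero, mul_zero]⟩
  smul_mem' c := by
    rintro _ ⟨r, rfl⟩
    exact ⟨c • r, by rw [← mul_smul_comm, Algebra.algebraMap_eq_smul_one,
      Algebra.algebraMap_eq_smul_one, smul_assoc]⟩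

lemma LtNhd_anti {M N : ℤ} (h : M ≤ N) : LtNhd N ≤ LtNhd M := by
  rintro _ ⟨r, rfl⟩
  obtain ⟨j, rfl⟩ := Int.le.dest h
  exact ⟨PowerSeries.X ^ j * r, by rw [map_mul, ← Lt.tpow_natCast, ← mul_assoc, tpow_mul]⟩

lemma coeff_eq_zero_of_mem_LtNhd {M m : ℤ} {f : Lt} (hf : f ∈ LtNhd M) (hm : m < M) :
    Lt.coeff m f = 0 := by
  obtain ⟨r, rfl⟩ := hf
  have h := Lt.coeff_mul_tpow (m - M) M (algebraMap (PowerSeries ℂ) Lt r)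
  rw [sub_add_cancel] at h
  rw [mul_comm, h]
  exact (PowerSeries.coeff_coe r (m - M)).trans (if_pos (by omega))

lemma exists_mem_LtNhd (f : Lt) : ∃ N : ℕ, f ∈ LtNhd (-N) := by
  obtain ⟨N, r, hr⟩ := exists_eq_tpow_mul f
  exact ⟨N, r, hr⟩

lemma mul_mem_LtNhd {M N : ℤ} {f h : Lt} (hf : f ∈ LtNhd M) (hh : h ∈ LtNhd N) :
    f * h ∈ LtNhd (M + N) := by
  obtain ⟨r, rfl⟩ := hf
  obtain ⟨s, rfl⟩ := hh
  exact ⟨r * s, by rw [← tpow_mul, map_mul]; ring⟩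

lemma coeff_tpow (m p : ℤ) : Lt.coeff m (Lt.tpow p) = if m = p then 1 else 0 := by
  by_cases h : m = p
  · subst h; rw [if_pos rfl]; exact HahnSeries.coeff_single_same m 1
  · rw [if_neg h]; exact HahnSeries.coeff_single_of_ne h

lemma dLaurent_algebraMap (r : PowerSeries ℂ) : dLaurent (algebraMap (PowerSeries ℂ) Lt r) =
    algebraMap (PowerSeries ℂ) Lt (PowerSeries.derivative ℂ r) := locDer_algebraMap _ _ _

lemma dLaurent_tpow (p : ℤ) : dLaurent (Lt.tpow p) = (p : ℂ) • Lt.tpow (p - 1) := by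
  have hnat : ∀ m : ℕ, dLaurent (Lt.tpow m) = (m : ℂ) • Lt.tpow (m - 1) := by
    intro m
    rw [Lt.tpow_natCast, dLaurent_algebraMap, Derivation.leibniz_pow, PowerSeries.derivative_X]
    rcases m with _ | m
    · simp
    · rw [show (((m + 1 : ℕ) : ℤ) - 1) = (m : ℤ) by push_cast; ring, Lt.tpow_natCast]
      simp [Algebra.smul_def]
  obtain ⟨m, rfl | rfl⟩ := Int.eq_nat_or_neg p
  · exact_mod_cast hnat m
  · have h := congrArg dLaurent (tpow_mul (-(m : ℤ)) m)
    rw [neg_add_cancel, tpow_zero, Derivation.map_one_eq_zero, Derivation.leibniz, hnat,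
      smul_eq_mul, smul_eq_mul, mul_smul_comm, tpow_mul] at h
    have h2 := congrArg (fun f => f * Lt.tpow (-(m : ℤ))) (eq_neg_of_add_eq_zero_right h)
    beta_reduce at h2
    rw [mul_right_comm, tpow_mul, add_neg_cancel, tpow_zero, one_mul, neg_mul, smul_mul_assoc,
      tpow_mul] at h2
    rw [h2, Int.cast_neg, neg_smul, Int.cast_natCast]
    congr 3
    ring

lemma dLaurent_mem_LtNhd {M : ℤ} {f : Lt} (hf : f ∈ LtNhd M) : dLaurent f ∈ LtNhd (M - 1) := by
  obtain ⟨r, rfl⟩ := hf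
  rw [Derivation.leibniz, dLaurent_algebraMap, dLaurent_tpow, smul_eq_mul, smul_eq_mul,
    mul_smul_comm, mul_comm _ (Lt.tpow (M - 1))]
  exact add_mem (LtNhd_anti (by omega) ⟨_, rfl⟩) (Submodule.smul_mem _ _ ⟨_, rfl⟩)

lemma resLaurent_eq_zero {f : Lt} (hf : f ∈ LtNhd 0) : resLaurent f = 0 :=
  coeff_eq_zero_of_mem_LtNhd hf (by omega)

/-- Laurent polynomials are dense: a subspace that contains the powers of `t` and a
neighbourhood of `0` is everything. -/
lemma mem_of_tpow_mem {S : Submodule ℂ Lt} (h : ∀ m, Lt.tpow m ∈ S) {M : ℤ} (hM : LtNhd M ≤ S)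
    (f : Lt) : f ∈ S := by
  obtain ⟨N, r, rfl⟩ := exists_eq_tpow_mul f
  obtain ⟨K, hK⟩ : ∃ K : ℕ, M ≤ -N + K := ⟨(M + N).toNat, by omega⟩
  obtain ⟨q, hq⟩ : PowerSeries.X ^ K ∣ r - (PowerSeries.trunc K r : PowerSeries ℂ) := by
    rw [PowerSeries.X_pow_dvd_iff]
    intro m hm
    rw [map_sub, Polynomial.coeff_coe, PowerSeries.coeff_trunc, if_pos hm, sub_self]
  rw [sub_eq_iff_eq_add] at hq
  rw [hq, map_add, mul_add]
  refine add_mem (hM (LtNhd_anti hK ⟨q, ?_⟩)) ?_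
  · rw [map_mul, ← Lt.tpow_natCast, ← mul_assoc, tpow_mul]
  · generalize PowerSeries.trunc K r = p
    induction p using Polynomial.induction_on' with
    | add p q hp hq => rw [Polynomial.coe_add, map_add, mul_add]; exact add_mem hp hq
    | monomial j a =>
      rw [← Polynomial.C_mul_X_pow_eq_monomial, ← Polynomial.smul_eq_C_mul, Polynomial.coe_smul,
        Polynomial.coe_pow, Polynomial.coe_X, Algebra.algebraMap_eq_smul_one, smul_assoc,
        ← Algebra.algebraMap_eq_smul_one, ← Lt.tpow_natCast, mul_smul_comm, tpow_mul]
      exact S.smul_mem _ (h _)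

end Laurent

section Smooth

variable {g : Type*} [LieRing g] [LieAlgebra ℂ g] {k : ℂ} {V : Type*} [AddCommGroup V] [Module ℂ V]

/-- The operators `X m x = x_m` form a smooth representation of level `k` of the affine Lie
algebra. -/
structure IsSmooth (k : ℂ) (X : ℤ → g →ₗ[ℂ] V →ₗ[ℂ] V) : Prop where
  smooth : ∀ x v, ∃ M : ℤ, ∀ m, M ≤ m → X m x v = 0
  comm : ∀ p q x y v, X p x (X q y v) - X q y (X p x v) =
    X (p + q) ⁅x, y⁆ v + (levelForm g k x y * if p + q = 0 then (p : ℂ) else 0) • v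

variable {X : ℤ → g →ₗ[ℂ] V →ₗ[ℂ] V}

lemma IsSmooth.finite (hX : IsSmooth k X) (f : Lt) (x : g) (v : V) :
    (Function.support fun m => Lt.coeff m f • X m x v).Finite := by
  obtain ⟨N, hN⟩ := exists_mem_LtNhd f
  obtain ⟨M, hM⟩ := hX.smooth x v
  refine (Set.finite_Icc (-(N : ℤ)) M).subset fun m hm => ?_
  by_contra h
  rw [Set.mem_Icc, not_and_or, not_le, not_le] at h
  rcases h with h | h
  · exact hm (by simp only [coeff_eq_zero_of_mem_LtNhd hN h, zero_smul])
  · exact hm (by simp only [hM m h.le, smul_zero])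

/-- The operator `∑ f_m x_m` attached to the Laurent series `f = ∑ f_m t ^ m`. -/
def IsSmooth.op (hX : IsSmooth k X) (f : Lt) (x : g) : Module.End ℂ V where
  toFun v := ∑ᶠ m, Lt.coeff m f • X m x v
  map_add' v w := by
    rw [← finsum_add_distrib (hX.finite f x v) (hX.finite f x w)]
    simp only [map_add, smul_add]
  map_smul' c v := by
    rw [RingHom.id_apply, smul_finsum' c (hX.finite f x v)]
    simp only [map_smul, smul_comm c]

lemma IsSmooth.op_apply (hX : IsSmooth k X) (f : Lt) (x : g) (v : V) :
    hX.op f x v = ∑ᶠ m, Lt.coeff m f • X m x v := rfl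

/-- The action of the loop algebra `g((t))` on a smooth representation. -/
def IsSmooth.current (hX : IsSmooth k X) : Lt →ₗ[ℂ] g →ₗ[ℂ] Module.End ℂ V :=
  LinearMap.mk₂ ℂ hX.op
    (fun f h x => by
      refine LinearMap.ext fun v => ?_
      rw [LinearMap.add_apply, hX.op_apply, hX.op_apply, hX.op_apply,
        ← finsum_add_distrib (hX.finite f x v) (hX.finite h x v)]
      exact finsum_congr fun m => by rw [Lt.coeff_add, add_smul])
    (fun c f x => by
      refine LinearMap.ext fun v => ?_
      rw [LinearMap.smul_apply, hX.op_apply, hX.op_apply, smul_finsum' c (hX.finite f x v)]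
      exact finsum_congr fun m => by rw [Lt.coeff_smul, mul_smul])
    (fun f x y => by
      refine LinearMap.ext fun v => ?_
      rw [LinearMap.add_apply, hX.op_apply, hX.op_apply, hX.op_apply,
        ← finsum_add_distrib (hX.finite f x v) (hX.finite f y v)]
      exact finsum_congr fun m => by rw [map_add, LinearMap.add_apply, smul_add])
    (fun c f x => by
      refine LinearMap.ext fun v => ?_
      rw [LinearMap.smul_apply, hX.op_apply, hX.op_apply, smul_finsum' c (hX.finite f x v)]
      exact finsum_congr fun m => by rw [map_smul, LinearMap.smul_apply, smul_comm c])

lemma IsSmooth.current_apply (hX : IsSmooth k X) (f : Lt) (x : g) (v : V) :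
    hX.current f x v = ∑ᶠ m, Lt.coeff m f • X m x v := rfl

lemma IsSmooth.current_tpow (hX : IsSmooth k X) (p : ℤ) (x : g) (v : V) :
    hX.current (Lt.tpow p) x v = X p x v := by
  rw [hX.current_apply, finsum_eq_single _ p (fun m hm => by rw [coeff_tpow, if_neg hm, zero_smul]),
    coeff_tpow, if_pos rfl, one_smul]

lemma IsSmooth.current_eq_zero (hX : IsSmooth k X) {M : ℤ} {f : Lt} (hf : f ∈ LtNhd M) {x : g}
    {v : V} (h : ∀ m, M ≤ m → X m x v = 0) : hX.current f x v = 0 := by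
  rw [hX.current_apply]
  refine (finsum_congr fun m => ?_).trans finsum_zero
  rcases lt_or_ge m M with hm | hm
  · rw [coeff_eq_zero_of_mem_LtNhd hf hm, zero_smul]
  · rw [h m hm, smul_zero]

/-- The operators of a smooth representation extend from Laurent polynomials to a representation of
the affine Lie algebra over `ℂ((t))`. -/
lemma IsSmooth.isCurrent (hX : IsSmooth k X) : IsCurrent dataLaurent g k hX.current where
  smul a f x := by rw [map_smul, LinearMap.smul_apply]
  comm f h x y := by
    ext v
    -- both sides are continuous in `f` and `h`, hence `f` and `h` can be taken to be powers of `t`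
    let δ : Lt →ₗ[ℂ] Lt →ₗ[ℂ] V := LinearMap.mk₂ ℂ (fun f h =>
        hX.current f x (hX.current h y v) - hX.current h y (hX.current f x v) -
          (hX.current (f * h) ⁅x, y⁆ v + levelForm g k x y • resLaurent (h * dLaurent f) • v))
      (fun f f' h => by
        simp only [map_add, LinearMap.add_apply, add_mul, mul_add, add_smul, smul_add]; abel)
      (fun c f h => by
        simp only [map_smul, LinearMap.smul_apply, smul_mul_assoc, mul_smul_comm, smul_sub,
          smul_add, smul_eq_mul, mul_smul, Derivation.map_smul, smul_comm c])
      (fun f h h' => by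
        simp only [map_add, LinearMap.add_apply, add_mul, mul_add, add_smul, smul_add]; abel)
      (fun c f h => by
        simp only [map_smul, LinearMap.smul_apply, smul_mul_assoc, mul_smul_comm, smul_sub,
          smul_add, smul_eq_mul, mul_smul, smul_comm c])
    suffices hδ : ∀ f h, δ f h = 0 by
      have := sub_eq_zero.1 (hδ f h)
      refine this.trans ?_
      rw [LinearMap.add_apply, ← smul_assoc]
      rfl
    have hsmall : ∀ f h, (∃ M, LtNhd M ≤ LinearMap.ker (δ f)) ∧
        ∃ M, LtNhd M ≤ LinearMap.ker (δ.flip h) := by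
      intro f h
      obtain ⟨L, hL⟩ := hX.smooth ⁅x, y⁆ v
      obtain ⟨N, hN⟩ := exists_mem_LtNhd f
      obtain ⟨N', hN'⟩ := exists_mem_LtNhd h
      constructor
      · obtain ⟨M₁, h₁⟩ := hX.smooth y v
        obtain ⟨M₂, h₂⟩ := hX.smooth y (hX.current f x v)
        refine ⟨max (max M₁ M₂) (max (L + N) (N + 1)), fun h hh => ?_⟩
        rw [LinearMap.mem_ker]
        change hX.current f x (hX.current h y v) - hX.current h y (hX.current f x v) -
          (hX.current (f * h) ⁅x, y⁆ v + levelForm g k x y • resLaurent (h * dLaurent f) • v) = 0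
        rw [hX.current_eq_zero (LtNhd_anti (by omega) hh) h₁,
          hX.current_eq_zero (LtNhd_anti (by omega) hh) h₂,
          hX.current_eq_zero (LtNhd_anti (by omega) (mul_mem_LtNhd hN hh)) hL,
          resLaurent_eq_zero (LtNhd_anti (by omega) (mul_mem_LtNhd hh (dLaurent_mem_LtNhd hN))),
          map_zero, zero_smul, smul_zero, sub_zero, add_zero, sub_zero]
      · obtain ⟨M₁, h₁⟩ := hX.smooth x v
        obtain ⟨M₂, h₂⟩ := hX.smooth x (hX.current h y v)
        refine ⟨max (max M₁ M₂) (max (L + N') (N' + 1)), fun f hf => ?_⟩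
        rw [LinearMap.mem_ker]
        change hX.current f x (hX.current h y v) - hX.current h y (hX.current f x v) -
          (hX.current (f * h) ⁅x, y⁆ v + levelForm g k x y • resLaurent (h * dLaurent f) • v) = 0
        rw [hX.current_eq_zero (LtNhd_anti (by omega) hf) h₁,
          hX.current_eq_zero (LtNhd_anti (by omega) hf) h₂,
          hX.current_eq_zero (LtNhd_anti (by omega) (mul_mem_LtNhd hf hN')) hL,
          resLaurent_eq_zero (LtNhd_anti (by omega) (mul_mem_LtNhd hN' (dLaurent_mem_LtNhd hf))),
          map_zero, zero_smul, smul_zero, sub_zero, add_zero, sub_zero]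
    intro f h
    obtain ⟨M, hM⟩ := (hsmall f h).2
    refine mem_of_tpow_mem (S := LinearMap.ker (δ.flip h)) (fun p => ?_) hM f
    obtain ⟨M', hM'⟩ := (hsmall (Lt.tpow p) h).1
    refine mem_of_tpow_mem (S := LinearMap.ker (δ (Lt.tpow p))) (fun q => ?_) hM' h
    change hX.current (Lt.tpow p) x (hX.current (Lt.tpow q) y v) -
      hX.current (Lt.tpow q) y (hX.current (Lt.tpow p) x v) -
          (hX.current (Lt.tpow p * Lt.tpow q) ⁅x, y⁆ v +
            levelForm g k x y • resLaurent (Lt.tpow q * dLaurent (Lt.tpow p)) • v) = 0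
    have hr : resLaurent (Lt.tpow q * dLaurent (Lt.tpow p)) = if p + q = 0 then (p : ℂ) else 0 := by
      rw [dLaurent_tpow, mul_smul_comm, tpow_mul, resLaurent_apply, Lt.coeff_smul, coeff_tpow]
      by_cases h : p + q = 0
      · rw [if_pos h, if_pos (by omega), mul_one]
      · rw [if_neg h, if_neg (by omega), mul_zero]
    rw [tpow_mul, hX.current_tpow, hX.current_tpow, hX.current_tpow, hX.current_tpow,
      hX.current_tpow, hX.comm, hr, mul_smul, sub_self]

end Smooth

/-! ### The vacuum module -/

section Vacuum

variable {g : Type*} [LieRing g] [LieAlgebra ℂ g] {k : ℂ}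

lemma curU_smul_smul (x y : g) (f h : Lt) (v : Vac g k) :
    curU dataLaurent g k x f • curU dataLaurent g k y h • v =
      curU dataLaurent g k y h • curU dataLaurent g k x f • v +
        curU dataLaurent g k ⁅x, y⁆ (f * h) • v +
          (levelForm g k x y * resLaurent (h * dLaurent f)) • v := by
  rw [smul_smul, curU_mul_curU, add_smul, add_smul, ← smul_smul]
  exact congrArg _ <| algebraMap_smul (UPrime dataLaurent g k)
    (levelForm g k x y • resLaurent (h * dLaurent f)) v

/-- `f ↦ x f v` as a linear map. -/
def curSmul (x : g) (v : Vac g k) : Lt →ₗ[ℂ] Vac g k where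
  toFun f := curU dataLaurent g k x f • v
  map_add' f h := by rw [curU_add, add_smul]
  map_smul' c f := by rw [curU_smul, RingHom.id_apply, smul_assoc]

lemma curSmul_apply (x : g) (v : Vac g k) (f : Lt) :
    curSmul x v f = curU dataLaurent g k x f • v := rfl

lemma curU_smul_vacVec (x : g) {f : Lt} (hf : f ∈ LtNhd 0) :
    curU dataLaurent g k x f • vacVec g k = 0 := by
  obtain ⟨r, rfl⟩ := hf
  rw [tpow_zero, one_mul]
  refine (Submodule.Quotient.mk_eq_zero _).2 ?_
  change curU dataLaurent g k x (algebraMap (PowerSeries ℂ) Lt r) * 1 ∈ _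
  rw [mul_one]
  exact Ideal.subset_span ⟨x, r, rfl⟩

lemma exists_smul_vacVec (v : Vac g k) : ∃ u : UPrime dataLaurent g k, v = u • vacVec g k := by
  obtain ⟨u, rfl⟩ := Submodule.Quotient.mk_surjective _ v
  refine ⟨u, ?_⟩
  rw [vacVec, ← Submodule.Quotient.mk_smul, smul_eq_mul, mul_one]

/-- Every vector of the vacuum module is killed by `x t ^ M ℂ[[t]]` for large `M`. -/
lemma Vac.smooth (v : Vac g k) (x : g) : ∃ M, LtNhd M ≤ LinearMap.ker (curSmul x v) := by
  obtain ⟨u, rfl⟩ := exists_smul_vacVec v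
  suffices h : ∀ v : Vac g k, (∀ x, ∃ M, LtNhd M ≤ LinearMap.ker (curSmul x v)) →
      ∀ x, ∃ M, LtNhd M ≤ LinearMap.ker (curSmul x (u • v)) from
    h _ (fun x => ⟨0, fun f hf => curU_smul_vacVec x hf⟩) x
  clear x
  induction u using UPrime.induction with
  | hC a =>
    intro v hv x
    obtain ⟨M, hM⟩ := hv x
    refine ⟨M, fun f hf => ?_⟩
    have h0 : curU dataLaurent g k x f • v = 0 := hM hf
    rw [LinearMap.mem_ker, curSmul_apply, smul_smul, ← Algebra.commutes, ← smul_smul, h0, smul_zero]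
  | hadd u u' h h' =>
    intro v hv x
    obtain ⟨M, hM⟩ := h v hv x
    obtain ⟨M', hM'⟩ := h' v hv x
    refine ⟨max M M', fun f hf => ?_⟩
    have h0 : curU dataLaurent g k x f • u • v = 0 := hM (LtNhd_anti (le_max_left _ _) hf)
    have h0' : curU dataLaurent g k x f • u' • v = 0 := hM' (LtNhd_anti (le_max_right _ _) hf)
    rw [LinearMap.mem_ker, curSmul_apply, add_smul, smul_add, h0, h0', add_zero]
  | hmul u u' h h' =>
    intro v hv x
    simp only [mul_smul]
    exact h _ (h' v hv) x
  | hcur y h =>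
    intro v hv x
    obtain ⟨M, hM⟩ := hv x
    obtain ⟨M', hM'⟩ := hv ⁅x, y⁆
    obtain ⟨N, hN⟩ := exists_mem_LtNhd h
    refine ⟨max M (max (M' + N) (N + 1)), fun f hf => ?_⟩
    have h0 : curU dataLaurent g k x f • v = 0 := hM (LtNhd_anti (by omega) hf)
    have h1 : curU dataLaurent g k ⁅x, y⁆ (f * h) • v = 0 :=
      hM' (LtNhd_anti (by omega) (mul_mem_LtNhd hf hN))
    rw [LinearMap.mem_ker, curSmul_apply, curU_smul_smul, h0, h1,
      resLaurent_eq_zero (LtNhd_anti (by omega) (mul_mem_LtNhd hN (dLaurent_mem_LtNhd hf))),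
      mul_zero, zero_smul, smul_zero, add_zero, add_zero]

/-- The vacuum module is generated by `|0⟩` under the operators `x_m`. -/
lemma Vac.mem_of_act_mem {W : Submodule ℂ (Vac g k)} (h0 : vacVec g k ∈ W)
    (hact : ∀ x m, ∀ v ∈ W, act g k x m v ∈ W) (v : Vac g k) : v ∈ W := by
  obtain ⟨u, rfl⟩ := exists_smul_vacVec v
  suffices h : ∀ v ∈ W, u • v ∈ W from h _ h0
  induction u using UPrime.induction with
  | hC a => intro v hv; rw [algebraMap_smul]; exact W.smul_mem a hv
  | hadd u u' h h' => intro v hv; rw [add_smul]; exact add_mem (h v hv) (h' v hv)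
  | hmul u u' h h' => intro v hv; rw [mul_smul]; exact h _ (h' v hv)
  | hcur x f =>
    intro v hv
    obtain ⟨M, hM⟩ := Vac.smooth v x
    refine mem_of_tpow_mem (S := W.comap (curSmul x v)) (fun m => hact x m v hv) (M := M) ?_ f
    intro f hf
    rw [Submodule.mem_comap, LinearMap.mem_ker.1 (hM hf)]
    exact W.zero_mem

/-- A linear map on the vacuum module is determined by the image of `|0⟩` and by how it intertwines
the operators `x_m`. -/
lemma Vac.ext_of_act {V : Type*} [AddCommGroup V] [Module ℂ V] {Φ Ψ : Vac g k →ₗ[ℂ] V}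
    {X : ℤ → g → V → V} (h0 : Φ (vacVec g k) = Ψ (vacVec g k))
    (hΦ : ∀ x m v, Φ (act g k x m v) = X m x (Φ v))
    (hΨ : ∀ x m v, Ψ (act g k x m v) = X m x (Ψ v)) : Φ = Ψ := by
  refine LinearMap.ext fun v => ?_
  refine Vac.mem_of_act_mem (W := LinearMap.eqLocus Φ Ψ) h0 (fun x m v hv => ?_) v
  rw [LinearMap.mem_eqLocus] at hv ⊢
  rw [hΦ, hΨ, hv]

variable {V : Type*} [AddCommGroup V] [Module ℂ V] {X : ℤ → g →ₗ[ℂ] V →ₗ[ℂ] V}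

/-- The map from the vacuum module to a smooth representation given by a vacuum vector `v₀`. -/
def IsSmooth.lift (hX : IsSmooth k X) (v₀ : V) (h₀ : ∀ m : ℤ, 0 ≤ m → ∀ x, X m x v₀ = 0) :
    Vac g k →ₗ[ℂ] V :=
  Submodule.liftQ ((vacIdeal g k).restrictScalars ℂ)
    (LinearMap.applyₗ v₀ ∘ₗ hX.isCurrent.lift.toLinearMap) (by
      have h : ∀ u : UPrime dataLaurent g k, u ∈ vacIdeal g k → hX.isCurrent.lift u v₀ = 0 := by
        intro u hu
        induction hu using Submodule.span_induction with
        | zero => rw [map_zero, LinearMap.zero_apply]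
        | add u u' _ _ h h' => rw [map_add, LinearMap.add_apply, h, h', add_zero]
        | smul a u _ h => rw [smul_eq_mul, map_mul, Module.End.mul_apply, h, map_zero]
        | mem u hu =>
          obtain ⟨x, r, rfl⟩ := hu
          rw [IsCurrent.lift_curU]
          exact hX.current_eq_zero (M := 0) ⟨r, by rw [tpow_zero, one_mul]⟩ fun m hm => h₀ m hm x
      exact fun u hu => h u hu) ∘ₗ
    (Submodule.Quotient.restrictScalarsEquiv ℂ (vacIdeal g k)).symm.toLinearMap

lemma IsSmooth.lift_mk (hX : IsSmooth k X) (v₀ : V) (h₀ : ∀ m : ℤ, 0 ≤ m → ∀ x, X m x v₀ = 0)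
    (u : UPrime dataLaurent g k) :
    hX.lift v₀ h₀ (Submodule.Quotient.mk u) = hX.isCurrent.lift u v₀ := rfl

lemma IsSmooth.lift_vacVec (hX : IsSmooth k X) (v₀ : V)
    (h₀ : ∀ m : ℤ, 0 ≤ m → ∀ x, X m x v₀ = 0) : hX.lift v₀ h₀ (vacVec g k) = v₀ := by
  rw [vacVec, hX.lift_mk, map_one, Module.End.one_apply]

lemma IsSmooth.lift_act (hX : IsSmooth k X) (v₀ : V)
    (h₀ : ∀ m : ℤ, 0 ≤ m → ∀ x, X m x v₀ = 0) (x : g) (m : ℤ) (v : Vac g k) :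
    hX.lift v₀ h₀ (act g k x m v) = X m x (hX.lift v₀ h₀ v) := by
  obtain ⟨u, rfl⟩ := Submodule.Quotient.mk_surjective _ v
  rw [act, ← Submodule.Quotient.mk_smul, hX.lift_mk, hX.lift_mk, smul_eq_mul, map_mul,
    IsCurrent.lift_curU, Module.End.mul_apply, hX.current_tpow]

end Vacuum

/-! ### Maps from the vacuum module to vertex algebras -/

section ShiftDiff

variable {Q : Type*} [AddCommGroup Q] [Module ℂ Q]

/-- Multiplication by `z - w` on the formal distributions `∑ E p q z ^ (-p - 1) w ^ (-q - 1)`. -/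
def shiftDiff : Module.End ℂ (ℤ → ℤ → Q) where
  toFun E p q := E (p + 1) q - E p (q + 1)
  map_add' E E' := by
    funext p q
    simp only [Pi.add_apply]
    abel
  map_smul' c E := by
    funext p q
    simp only [Pi.smul_apply, RingHom.id_apply, smul_sub]

lemma shiftDiff_apply (E : ℤ → ℤ → Q) (p q : ℤ) :
    shiftDiff E p q = E (p + 1) q - E p (q + 1) := rfl

lemma shiftDiff_pow_apply (N : ℕ) (E : ℤ → ℤ → Q) (p q : ℤ) : (shiftDiff ^ N) E p q =
    ∑ j ∈ Finset.range (N + 1), ((-1 : ℂ) ^ j * (N.choose j : ℂ)) • E (p + N - j) (q + j) := by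
  rw [← sum_alternating_eq (fun M p q => (shiftDiff ^ M) E p q)
    (fun M p q => by rw [pow_succ', Module.End.mul_apply, shiftDiff_apply])]
  refine Finset.sum_congr rfl fun j _ => ?_
  rw [← Int.cast_smul_eq_zsmul ℂ]
  push_cast
  rfl

lemma shiftDiff_pow_eq_zero_mono {N M : ℕ} (h : N ≤ M) {E : ℤ → ℤ → Q}
    (hE : (shiftDiff ^ N) E = 0) : (shiftDiff ^ M) E = 0 := by
  obtain ⟨j, rfl⟩ := Nat.exists_eq_add_of_le' h
  rw [pow_add, Module.End.mul_apply, hE, map_zero]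

/-- A local distribution that is a Laurent series in `w` vanishes. -/
lemma eq_zero_of_shiftDiff_pow {N : ℕ} {E : ℤ → ℤ → Q} (hE : (shiftDiff ^ N) E = 0) {q₀ : ℤ}
    (h : ∀ p q, q₀ ≤ q → E p q = 0) (p q : ℤ) : E p q = 0 := by
  induction N generalizing E p q with
  | zero => exact congrFun (congrFun hE p) q
  | succ N ih =>
    rw [pow_succ, Module.End.mul_apply] at hE
    have h1 : ∀ p q, E (p + 1) q = E p (q + 1) := fun p q => sub_eq_zero.1 <|
      ih hE (fun p q hq => by
        rw [shiftDiff_apply, h _ _ hq, h _ _ (hq.trans (by omega)), sub_zero]) p q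
    have h2 : ∀ j : ℕ, ∀ p q, E p q = E (p - j) (q + j) := by
      intro j
      induction j with
      | zero => intro p q; simp
      | succ j ihj =>
        intro p q
        rw [ihj, Nat.cast_succ, show p - (j : ℤ) = p - (j + 1) + 1 by ring, h1, add_assoc]
    rw [h2 (q₀ - q).toNat, h _ _ (by omega)]

end ShiftDiff

section Vertex

variable {V : Type*} [AddCommGroup V] [Module ℂ V] (W : VertexAlgebra V)

lemma VertexAlgebra.exists_ncoeff_eq_zero (a b : V) :
    ∃ M : ℤ, ∀ m, M ≤ m → (W.Y a).ncoeff m b = 0 := by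
  by_cases h0 : (W.Y a).ncoeff = 0
  · exact ⟨0, fun m _ => by rw [h0]; rfl⟩
  refine ⟨-((HahnModule.of ℂ).symm ((W.Y a) b)).order, fun m hm => ?_⟩
  exact VertexOperator.ncoeff_eq_zero_of_lt_order _ _ _ (by omega)

lemma VertexAlgebra.exists_shiftDiff (a b : V) : ∃ N : ℕ, ∀ c,
    (shiftDiff ^ N) (fun p q => (W.Y a).ncoeff p ((W.Y b).ncoeff q c) -
      (W.Y b).ncoeff q ((W.Y a).ncoeff p c)) = 0 := by
  obtain ⟨N, hN⟩ := W.locality a b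
  refine ⟨N, fun c => ?_⟩
  funext p q
  rw [shiftDiff_pow_apply]
  exact hN p q c

/-- Translation covariance determines the products `a_(-1 - j) |0⟩`. -/
lemma VertexAlgebra.ncoeff_vac_neg (a : V) (j : ℕ) :
    ((j : ℂ) + 1) • (W.Y a).ncoeff (-1 - (j + 1 : ℕ)) W.vac =
      W.T ((W.Y a).ncoeff (-1 - j) W.vac) := by
  have h := W.translation a (-1 - j) W.vac
  rw [W.T_vac, map_zero, sub_zero] at h
  rw [h]
  congr 1
  · push_cast; ring
  · push_cast; ring_nf

/-- A `T`-stable subspace is closed under the products with the vacuum on the right. -/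
lemma VertexAlgebra.ncoeff_vac_mem {G : Submodule ℂ V} (hT : ∀ a ∈ G, W.T a ∈ G) {a : V}
    (ha : a ∈ G) (m : ℤ) : (W.Y a).ncoeff m W.vac ∈ G := by
  rcases lt_or_ge m 0 with h | h
  · obtain ⟨j, rfl⟩ : ∃ j : ℕ, m = -1 - j := ⟨(-1 - m).toNat, by omega⟩
    clear h
    induction j with
    | zero => rw [Nat.cast_zero, sub_zero, W.mode_vac_neg_one]; exact ha
    | succ j ih =>
      have hj : ((j : ℂ) + 1) ≠ 0 := Nat.cast_add_one_ne_zero j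
      refine (Submodule.smul_mem_iff _ hj).1 ?_
      rw [W.ncoeff_vac_neg]
      exact hT _ ih
  · rw [W.mode_vac_nonneg _ _ h]; exact G.zero_mem

variable {g : Type*} [LieRing g] [LieAlgebra ℂ g] {k : ℂ}

variable {W} {J : g → V} {Φ : Vac g k →ₗ[ℂ] V}

lemma translation_mem_range (h0 : Φ (vacVec g k) = W.vac)
    (hact : ∀ x m v, Φ (act g k x m v) = (W.Y (J x)).ncoeff m (Φ v)) :
    ∀ a ∈ LinearMap.range Φ, W.T a ∈ LinearMap.range Φ := by
  rintro _ ⟨v, rfl⟩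
  refine Vac.mem_of_act_mem (W := (LinearMap.range Φ).comap (W.T ∘ₗ Φ)) ?_ (fun x m v hv => ?_) v
  · rw [Submodule.mem_comap, LinearMap.comp_apply, h0, W.T_vac]
    exact zero_mem _
  · rw [Submodule.mem_comap, LinearMap.comp_apply] at hv ⊢
    obtain ⟨v', hv'⟩ := hv
    rw [hact, sub_eq_iff_eq_add.1 (W.translation (J x) m (Φ v)), ← hv', ← hact, ← hact, ← map_smul,
      ← map_add]
    exact ⟨_, rfl⟩

/-- The image of the vacuum module is closed under the products. -/
lemma ncoeff_mem_range (h0 : Φ (vacVec g k) = W.vac)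
    (hact : ∀ x m v, Φ (act g k x m v) = (W.Y (J x)).ncoeff m (Φ v)) {a b : V}
    (ha : a ∈ LinearMap.range Φ) (hb : b ∈ LinearMap.range Φ) (m : ℤ) :
    (W.Y a).ncoeff m b ∈ LinearMap.range Φ := by
  obtain ⟨v, rfl⟩ := hb
  let G : Submodule ℂ (Vac g k) :=
    ⨅ m, (LinearMap.range Φ).comap ((W.Y a).ncoeff m ∘ₗ Φ)
  have hG : ∀ v, v ∈ G ↔ ∀ m, (W.Y a).ncoeff m (Φ v) ∈ LinearMap.range Φ := fun v => by
    simp only [G, Submodule.mem_iInf, Submodule.mem_comap, LinearMap.comp_apply]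
  refine (hG v).1 (Vac.mem_of_act_mem (W := G) ?_ (fun x q v hv => ?_) v) m
  · rw [hG, h0]
    exact W.ncoeff_vac_mem (translation_mem_range h0 hact) ha
  · rw [hG] at hv ⊢
    intro p
    -- modulo the image, `a_(p) x_q v` is local and vanishes for large `q`
    obtain ⟨N, hN⟩ := W.exists_shiftDiff a (J x)
    obtain ⟨M, hM⟩ := W.exists_ncoeff_eq_zero (J x) (Φ v)
    let E : ℤ → ℤ → V ⧸ LinearMap.range Φ := fun p q =>
      (LinearMap.range Φ).mkQ ((W.Y a).ncoeff p ((W.Y (J x)).ncoeff q (Φ v)))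
    have hE : (shiftDiff ^ N) E = 0 := by
      funext p q
      have h := congrArg (LinearMap.range Φ).mkQ (congrFun (congrFun (hN (Φ v)) p) q)
      rw [shiftDiff_pow_apply, map_sum] at h
      rw [shiftDiff_pow_apply]
      refine Eq.trans (Finset.sum_congr rfl fun j _ => ?_) (h.trans (map_zero _))
      obtain ⟨u, hu⟩ := hv (p + N - j)
      have h0 : (LinearMap.range Φ).mkQ ((W.Y (J x)).ncoeff (q + j)
          ((W.Y a).ncoeff (p + N - j) (Φ v))) = 0 := by
        rw [← hu, ← hact]
        exact (Submodule.Quotient.mk_eq_zero _).2 ⟨_, rfl⟩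
      rw [map_smul, map_sub, h0, sub_zero]
    have h := eq_zero_of_shiftDiff_pow hE (q₀ := M)
      (fun p q hq => by simp only [E, hM q hq, map_zero]) p q
    rw [hact]
    exact (Submodule.Quotient.mk_eq_zero _).1 h

lemma map_translation {S : VertexAlgebra (Vac g k)} (hS : IsAffineStructure g k S)
    (h0 : Φ (vacVec g k) = W.vac)
    (hact : ∀ x m v, Φ (act g k x m v) = (W.Y (J x)).ncoeff m (Φ v)) (v : Vac g k) :
    Φ (S.T v) = W.T (Φ v) := by
  refine Vac.mem_of_act_mem (W := LinearMap.eqLocus (Φ ∘ₗ S.T) (W.T ∘ₗ Φ)) ?_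
    (fun x m v hv => ?_) v
  · rw [LinearMap.mem_eqLocus, LinearMap.comp_apply, LinearMap.comp_apply, h0, W.T_vac, ← hS.vac,
      S.T_vac, map_zero]
  · rw [LinearMap.mem_eqLocus, LinearMap.comp_apply, LinearMap.comp_apply] at hv ⊢
    rw [hact, sub_eq_iff_eq_add.1 (W.translation (J x) m (Φ v)), ← hv, ← hS.mode,
      sub_eq_iff_eq_add.1 (S.translation _ m v), hS.mode, hS.mode, map_add, map_smul, hact, hact]

/-- A linear map that intertwines the currents is a morphism of vertex algebras. -/
lemma map_ncoeff {S : VertexAlgebra (Vac g k)} (hS : IsAffineStructure g k S)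
    (h0 : Φ (vacVec g k) = W.vac)
    (hact : ∀ x m v, Φ (act g k x m v) = (W.Y (J x)).ncoeff m (Φ v)) (a : Vac g k) (m : ℤ)
    (v : Vac g k) : Φ ((S.Y a).ncoeff m v) = (W.Y (Φ a)).ncoeff m (Φ v) := by
  let G : Submodule ℂ (Vac g k) :=
    ⨅ m, LinearMap.eqLocus (Φ ∘ₗ (S.Y a).ncoeff m) ((W.Y (Φ a)).ncoeff m ∘ₗ Φ)
  have hG : ∀ v, v ∈ G ↔ ∀ m, Φ ((S.Y a).ncoeff m v) = (W.Y (Φ a)).ncoeff m (Φ v) := fun v => by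
    simp only [G, Submodule.mem_iInf, LinearMap.mem_eqLocus, LinearMap.comp_apply]
  refine (hG v).1 (Vac.mem_of_act_mem (W := G) ?_ (fun x q v hv => ?_) v) m
  · rw [hG]
    intro m
    rw [h0, ← hS.vac]
    rcases lt_or_ge m 0 with h | h
    · obtain ⟨j, rfl⟩ : ∃ j : ℕ, m = -1 - j := ⟨(-1 - m).toNat, by omega⟩
      clear h
      induction j with
      | zero => rw [Nat.cast_zero, sub_zero, W.mode_vac_neg_one, S.mode_vac_neg_one]
      | succ j ih =>
        have hj : ((j : ℂ) + 1) ≠ 0 := Nat.cast_add_one_ne_zero j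
        refine smul_right_injective V hj ?_
        beta_reduce
        rw [W.ncoeff_vac_neg, ← ih, ← map_smul, S.ncoeff_vac_neg, map_translation hS h0 hact]
    · rw [W.mode_vac_nonneg _ _ h, S.mode_vac_nonneg _ _ h, map_zero]
  · rw [hG] at hv ⊢
    intro p
    set b := act g k x (-1) (vacVec g k)
    obtain ⟨N, hN⟩ := S.exists_shiftDiff a b
    obtain ⟨N', hN'⟩ := W.exists_shiftDiff (Φ a) (J x)
    obtain ⟨M, hM⟩ := S.exists_ncoeff_eq_zero b v
    obtain ⟨M', hM'⟩ := W.exists_ncoeff_eq_zero (J x) (Φ v)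
    let E : ℤ → ℤ → V := fun p q => Φ ((S.Y a).ncoeff p ((S.Y b).ncoeff q v)) -
      (W.Y (Φ a)).ncoeff p ((W.Y (J x)).ncoeff q (Φ v))
    -- the terms in the other order agree, so that `E` is a difference of two commutators
    have hE : (shiftDiff ^ max N N') E = 0 := by
      have h1 : (shiftDiff ^ max N N') (fun p q => Φ ((S.Y a).ncoeff p ((S.Y b).ncoeff q v) -
          (S.Y b).ncoeff q ((S.Y a).ncoeff p v))) = 0 := by
        funext p q
        have h := congrArg Φ (congrFun (congrFun
          (shiftDiff_pow_eq_zero_mono (le_max_left N N') (hN v)) p) q)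
        rw [shiftDiff_pow_apply, map_sum] at h
        rw [shiftDiff_pow_apply]
        refine Eq.trans (Finset.sum_congr rfl fun j _ => ?_) (h.trans (map_zero _))
        rw [map_smul]
      have h2 := shiftDiff_pow_eq_zero_mono (le_max_right N N') (hN' (Φ v))
      have h3 := (map_sub (shiftDiff ^ max N N') _ _).trans (congrArg₂ (· - ·) h1 h2)
      rw [sub_zero] at h3
      rw [← h3]
      congr 1
      funext p q
      simp only [Pi.sub_apply, E]
      rw [map_sub, hS.mode x q ((S.Y a).ncoeff p v), hact, hv]
      abel
    have h := eq_zero_of_shiftDiff_pow hE (q₀ := max M M') (fun p q hq => by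
      simp only [E]
      rw [hM q ((le_max_left _ _).trans hq), hM' q ((le_max_right _ _).trans hq), map_zero,
        map_zero, map_zero, sub_zero]) p q
    rw [hact, ← hS.mode]
    exact sub_eq_zero.1 h

end Vertex

section Transport

variable {V V' : Type*} [AddCommGroup V] [Module ℂ V] [AddCommGroup V'] [Module ℂ V']

/-- Transport of a vertex algebra structure along a linear equivalence. -/
def VertexAlgebra.comap (W : VertexAlgebra V') (e : V ≃ₗ[ℂ] V') : VertexAlgebra V :=
  .ofModes (e.symm W.vac) (e.symm.toLinearMap ∘ₗ W.T ∘ₗ e.toLinearMap)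
    (fun m => LinearMap.mk₂ ℂ (fun a b => e.symm ((W.Y (e a)).ncoeff m (e b)))
      (fun a a' b => by simp) (fun c a b => by simp)
      (fun a b b' => by simp) (fun c a b => by simp))
    (fun a b => by
      obtain ⟨M, hM⟩ := W.exists_ncoeff_eq_zero (e a) (e b)
      refine ⟨-M, fun y hy => ?_⟩
      by_contra hlt
      refine hy ?_
      change e.symm ((W.Y (e a)).ncoeff (-y - 1) (e b)) = 0
      rw [hM _ (by omega), map_zero])
    (fun m b => by
      rw [LinearMap.mk₂_apply, e.apply_symm_apply, W.vac_mode]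
      split_ifs
      · exact e.symm_apply_apply b
      · exact map_zero _)
    (fun a m hm => by
      rw [LinearMap.mk₂_apply, e.apply_symm_apply, W.mode_vac_nonneg _ _ hm, map_zero])
    (fun a => by
      rw [LinearMap.mk₂_apply, e.apply_symm_apply, W.mode_vac_neg_one, e.symm_apply_apply])
    (by simp [W.T_vac])
    (fun a m b => by
      have h := congrArg e.symm (W.translation (e a) m (e b))
      rw [map_sub, map_smul] at h
      simpa using h)
    (fun a b => by
      obtain ⟨N, hN⟩ := W.locality (e a) (e b)
      refine ⟨N, fun p q c => ?_⟩
      have h := congrArg e.symm (hN p q (e c))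
      rw [map_sum, map_zero] at h
      simpa using h)

lemma VertexAlgebra.ncoeff_comap (W : VertexAlgebra V') (e : V ≃ₗ[ℂ] V') (a b : V) (m : ℤ) :
    ((W.comap e).Y a).ncoeff m b = e.symm ((W.Y (e a)).ncoeff m (e b)) := by
  refine (LinearMap.congr_fun (ncoeff_correspondenceOfModes _ _ a m) b).trans ?_
  rfl

end Transport

/-! ### The map from the vacuum module to the fields -/

section CanonicalMap

variable (n : ℕ) (g : Type*) [LieRing g] [LieAlgebra ℂ g] (k : ℂ)

lemma curU_add_left {A K : Type*} [CommRing A] [CommRing K] [Algebra A K] [Algebra ℂ A]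
    [Algebra ℂ K] [IsScalarTower ℂ A K] (D : ResidueData A K) (x y : g) (f : K) :
    curU D g k (x + y) f = curU D g k x f + curU D g k y f := by
  rw [curU, curU, curU, ← map_add]
  exact congrArg _ (Prod.ext (TensorProduct.tmul_add f x y) (add_zero (0 : A)).symm)

lemma curU_smul_left {A K : Type*} [CommRing A] [CommRing K] [Algebra A K] [Algebra ℂ A]
    [Algebra ℂ K] [IsScalarTower ℂ A K] (D : ResidueData A K) (c : ℂ) (x : g) (f : K) :
    curU D g k (c • x) f = algebraMap ℂ A c • curU D g k x f := by
  rw [← curU_smul, algebraMap_smul, curU, curU]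
  exact congrArg _ (Prod.ext (TensorProduct.smul_tmul c f x).symm rfl)

/-- The fields `X̂`, as elements of `V^k_{K_n}(g)`. -/
def hatVec : g →ₗ[ℂ] VKn n g k where
  toFun x := ⟨hatField n g k x, hatClosure_le_VKn n g k (hatField_mem n g k x)⟩
  map_add' x y := Subtype.ext <| KField.ext fun f => by
    rw [hatField_apply, curU_add_left, UniformSpace.Completion.coe_add]
    rfl
  map_smul' c x := Subtype.ext <| KField.ext fun f => by
    rw [hatField_apply, curU_smul_left, UniformSpace.Completion.coe_smul]
    rfl

variable {n}

/-- The Killing form of a simple Lie algebra is nondegenerate, and simple Lie algebras are nonzero.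
-/
lemma levelForm_ne_zero [Module.Finite ℂ g] [LieAlgebra.IsSimple ℂ g] (hk : k ≠ 0) :
    ∃ x y, levelForm g k x y ≠ 0 := by
  by_contra! h
  have : LieAlgebra.IsKilling ℂ g := inferInstance
  have hker := LieAlgebra.IsKilling.ker_killingForm_eq_bot ℂ g
  have : Subsingleton g := by
    refine subsingleton_of_forall_eq 0 fun x => ?_
    rw [← Submodule.mem_bot ℂ, ← hker, LinearMap.mem_ker]
    refine LinearMap.ext fun y => ?_
    exact (mul_eq_zero.1 (h x y)).resolve_left hk
  exact LieAlgebra.IsSimple.non_abelian ℂ (L := g) ⟨fun x y => Subsingleton.elim _ _⟩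

/-- `X̂_(1) Ŷ = κ(X, Y) 𝟏`. -/
lemma nProd_one_hatField (hn : 0 < n) (x y : g) : nProd 1 (hatField n g k x) (hatField n g k y) =
    levelForm g k x y • oneField n (UTilde n g k) := by
  have h := (affineRel_hatField n g k x y).commutator 1 (-1) (oneField n _)
  have h0 : nProd (-1) (hatField n g k y) (0 : KField n (UTilde n g k)) = 0 := by
    have := nProd_smul_right (-1) 0 (hatField n g k y) (0 : KField n (UTilde n g k))
    rwa [zero_smul, zero_smul] at this
  rw [nProd_oneField_right_neg_one hn, nProd_oneField_right_nonneg (by norm_num), h0, sub_zero,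
    nProd_oneField_right_nonneg (by norm_num), zero_add, Int.cast_one, one_smul,
    KField.complex_smul_eq, nProd_smul_left, nProd_oneField_left hn, if_pos (by norm_num),
    ← KField.complex_smul_eq] at h
  exact h

lemma oneField_mem_hatClosure [Module.Finite ℂ g] [LieAlgebra.IsSimple ℂ g] (hn : 0 < n)
    (hk : k ≠ 0) : oneField n (UTilde n g k) ∈ hatClosure n g k := by
  obtain ⟨x, y, h⟩ := levelForm_ne_zero g k hk
  rw [← Submodule.smul_mem_iff _ h, ← nProd_one_hatField g k hn]
  exact nProd_mem_hatClosure n g k (hatField_mem n g k x) (hatField_mem n g k y) 1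

variable {g k} (hn : 0 < n)

/-- The modes of the fields `X̂` form a smooth representation of level `k`. -/
lemma isSmooth_fieldMode : IsSmooth k fun m => fieldMode g k hn m ∘ₗ hatVec n g k where
  smooth x v := by
    obtain ⟨r, hr⟩ := isLocal_VKn n g k (hatVec n g k x).2 v.2
    exact ⟨r, fun m hm => Subtype.ext (nProd_eq_zero_of_isLocalOfOrder hr hm)⟩
  comm p q x y v := by
    refine Subtype.ext ?_
    refine ((affineRel_hatField n g k x y).commutator p q v.1).trans ?_
    rw [KField.complex_smul_eq, nProd_smul_left, nProd_oneField_left hn, Submodule.coe_add,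
      Submodule.coe_smul, KField.complex_smul_eq, map_mul, mul_smul]
    refine congrArg _ ?_
    by_cases h : p + q = 0
    · rw [if_pos (by omega), if_pos h, map_intCast, smul_comm]
    · rw [if_neg (by omega), if_neg h, map_zero, zero_smul, smul_zero, smul_zero]

/-- The map `V^k(g) → V^k_{K_n}(g)` given by the action of the modes of the fields `X̂` on `𝟏`. -/
def canMap : Vac g k →ₗ[ℂ] VKn n g k :=
  (isSmooth_fieldMode hn).lift (fieldVacuum g k n)
    fun _ hm x => fieldMode_vacuum_right_nonneg g k hn hm (hatVec n g k x)

lemma canMap_vacVec : canMap (g := g) (k := k) hn (vacVec g k) = fieldVacuum g k n :=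
  (isSmooth_fieldMode hn).lift_vacVec _ _

lemma canMap_act (x : g) (m : ℤ) (v : Vac g k) :
    canMap hn (act g k x m v) = fieldMode g k hn m (hatVec n g k x) (canMap hn v) :=
  (isSmooth_fieldMode hn).lift_act _ _ x m v

lemma canMap_act_vacVec (x : g) :
    canMap hn (act g k x (-1) (vacVec g k)) = hatVec n g k x := by
  rw [canMap_act, canMap_vacVec, fieldMode_vacuum_right_neg_one]

/-- The image of the vacuum module contains `𝟏` and the fields `X̂` and is closed under translation
and products. -/
lemma canMap_surjective : Function.Surjective (canMap (g := g) (k := k) hn) := by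
  have h0 : canMap (g := g) (k := k) hn (vacVec g k) = (fieldVertexAlgebra g k hn).vac :=
    canMap_vacVec hn
  have hact : ∀ x m v, canMap (g := g) (k := k) hn (act g k x m v) =
      ((fieldVertexAlgebra g k hn).Y (hatVec n g k x)).ncoeff m (canMap hn v) := fun x m v => by
    rw [ncoeff_fieldVertexAlgebra, canMap_act]
  have hle : VKn n g k ≤ (LinearMap.range (canMap (g := g) (k := k) hn)).map
      (VKn n g k).subtype := by
    refine sup_le (hatClosure_le n g k (fun x => ⟨_, ⟨_, canMap_act_vacVec hn x⟩, rfl⟩)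
      ⟨?_, ?_⟩) (Submodule.span_le.2 (Set.singleton_subset_iff.2 ⟨_, ⟨_, canMap_vacVec hn⟩, rfl⟩))
    · rintro _ ⟨a, ha, rfl⟩ _ ⟨b, hb, rfl⟩ m c hc
      rw [isNProd_iff.1 hc]
      refine ⟨_, ncoeff_mem_range h0 hact ha hb m, ?_⟩
      rw [ncoeff_fieldVertexAlgebra]
      rfl
    · rintro _ ⟨a, ha, rfl⟩
      exact ⟨_, translation_mem_range h0 hact a ha, rfl⟩
  intro a
  obtain ⟨b, ⟨v, hv⟩, hb⟩ := hle a.2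
  exact ⟨v, hv.trans (Subtype.ext hb)⟩

end CanonicalMap

/-! ### Specialization at `a = 0` -/

section Spec

variable (n : ℕ)

/-- Reduction `A_n[[z]] → ℂ[[t]]`, `a_i ↦ 0`, `z ↦ t`. -/
def specR : Rn n →+* PowerSeries ℂ := PowerSeries.map MvPowerSeries.constantCoeff

lemma map_constantCoeff_phi :
    (phi n).map (MvPowerSeries.constantCoeff : An n →+* ℂ) = X ^ n := by
  rw [phi, Polynomial.map_prod]
  simp

lemma specR_coe (p : (An n)[X]) : specR n (p : Rn n) =
    (p.map (MvPowerSeries.constantCoeff : An n →+* ℂ) : ℂ[X]) :=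
  Polynomial.polynomial_map_coe.symm

lemma specR_phi : specR n (phi n : Rn n) = PowerSeries.X ^ n := by
  rw [specR_coe, map_constantCoeff_phi, Polynomial.coe_pow, Polynomial.coe_X]

lemma isUnit_tpow (m : ℤ) : IsUnit (Lt.tpow m) :=
  IsUnit.of_mul_eq_one (Lt.tpow (-m)) (by rw [tpow_mul, add_neg_cancel, tpow_zero])

/-- The specialization `K_n → ℂ((t))`, `a_i ↦ 0`, `z ↦ t`. -/
def spec : Kn n →+* Lt :=
  IsLocalization.Away.lift (phi n : Rn n)
    (g := (algebraMap (PowerSeries ℂ) Lt).comp (specR n)) (by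
      rw [RingHom.comp_apply, specR_phi, ← Lt.tpow_natCast]
      exact isUnit_tpow _)

lemma spec_algebraMap (r : Rn n) :
    spec n (algebraMap (Rn n) (Kn n) r) = algebraMap (PowerSeries ℂ) Lt (specR n r) :=
  IsLocalization.Away.lift_eq _ _ _

lemma spec_phiK : spec n (phiK n) = Lt.tpow n := by
  rw [phiK, spec_algebraMap, specR_phi, Lt.tpow_natCast]

lemma spec_zK : spec n (zK n) = Lt.tpow 1 := by
  rw [zK, spec_algebraMap, specR, PowerSeries.map_X, ← Nat.cast_one, Lt.tpow_natCast, pow_one]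

lemma tpow_pow (m : ℤ) (j : ℕ) : Lt.tpow m ^ j = Lt.tpow (m * j) := by
  induction j with
  | zero => rw [pow_zero, Nat.cast_zero, mul_zero, tpow_zero]
  | succ j ih => rw [pow_succ, ih, tpow_mul, Nat.cast_succ, mul_add, mul_one]

lemma spec_phiInv : spec n (phiInv n) = Lt.tpow (-n) := by
  have h := congrArg (spec n) (phiK_mul_phiInv (n := n))
  rw [map_mul, spec_phiK, map_one] at h
  calc spec n (phiInv n) = Lt.tpow (-n) * (Lt.tpow n * spec n (phiInv n)) := by
        rw [← mul_assoc, tpow_mul, neg_add_cancel, tpow_zero, one_mul]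
    _ = _ := by rw [h, mul_one]

lemma spec_smul (a : An n) (f : Kn n) :
    spec n (a • f) = MvPowerSeries.constantCoeff a • spec n f := by
  rw [← algebraMap_smul (Rn n) a f, Algebra.smul_def, map_mul, spec_algebraMap,
    Algebra.smul_def, IsScalarTower.algebraMap_apply ℂ (PowerSeries ℂ) Lt]
  congr 2
  exact PowerSeries.map_C _ _

lemma spec_complex_smul (c : ℂ) (f : Kn n) : spec n (c • f) = c • spec n f := by
  rw [← algebraMap_smul (An n) c f, spec_smul, MvPowerSeries.algebraMap_apply,
    MvPowerSeries.constantCoeff_C]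
  rfl

lemma spec_mem {f : Kn n} (hf : f ∈ Jn n 0) : spec n f ∈ LtNhd 0 := by
  obtain ⟨r, rfl⟩ := hf
  refine ⟨specR n r, ?_⟩
  rw [pow_zero, one_mul, spec_algebraMap, tpow_zero, one_mul]

/-- Specialization commutes with the derivations: this holds on `R_n`, and a derivation of a
localization is determined by its values on the numerators. -/
lemma spec_dK (f : Kn n) : spec n (dK n f) = dLaurent (spec n f) := by
  have hR : ∀ r : Rn n,
      spec n (dK n (algebraMap _ _ r)) = dLaurent (spec n (algebraMap _ _ r)) := by
    intro r
    rw [dK_algebraMap, spec_algebraMap, spec_algebraMap, dLaurent_algebraMap]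
    congr 1
    ext m
    rw [specR, PowerSeries.coeff_map, PowerSeries.coeff_derivative, PowerSeries.coeff_derivative,
      PowerSeries.coeff_map, map_mul, map_add, map_natCast, map_one]
  obtain ⟨N, r, hr⟩ := exists_num n f
  have h := hR r
  have h2 := hR ((phi n : Rn n) ^ N)
  rw [map_pow] at h2
  change spec n (dK n (phiK n ^ N)) = dLaurent (spec n (phiK n ^ N)) at h2
  rw [← hr, Derivation.leibniz, map_add, smul_eq_mul, smul_eq_mul, map_mul, map_mul, map_mul,
    Derivation.leibniz, h2, smul_eq_mul, smul_eq_mul] at h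
  have hu : IsUnit (spec n (phiK n ^ N)) := ((isUnit_phiK n).pow N).map _
  exact hu.mul_left_cancel (add_left_cancel h)

/-- At `a = 0` all the points `a_i` collide at `0`, and the sum of the residues at these points
becomes the residue at `t = 0`. -/
lemma constantCoeff_residue (f : Kn n) :
    MvPowerSeries.constantCoeff (residue n f) = resLaurent (spec n f) := by
  obtain ⟨N, r, hr⟩ := exists_num n f
  obtain ⟨q, hq⟩ := remPhi_spec n N r
  -- the residue of `r / φ ^ N` is a coefficient of the remainder of `r` modulo `φ ^ N`, and `φ ^ N`
  -- specializes to `t ^ (N n)`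
  rw [residue_eq n hr, resNum, resLaurent_apply, ← Lt.coeff_mul_tpow (-1) ((N * n : ℕ) : ℤ)]
  have h := congrArg (spec n) hr
  have e : Lt.tpow ((N * n : ℕ) : ℤ) = spec n (phiK n ^ N) := by
    rw [map_pow, spec_phiK, tpow_pow, Nat.cast_mul, mul_comm]
  rw [map_mul, spec_algebraMap] at h
  rw [e, h, hq, map_add, map_mul, map_pow, specR_phi, specR_coe, map_add, Lt.coeff_add,
    ← pow_mul, mul_comm n, map_mul, ← Lt.tpow_natCast,
    coeff_eq_zero_of_mem_LtNhd (M := ((N * n : ℕ) : ℤ)) ⟨_, rfl⟩ (by omega), zero_add, ← hq]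
  rcases Nat.eq_zero_or_pos (N * n) with h0 | h0
  · have hd := remPhi_degree n N r
    rw [h0] at hd
    have : remPhi n N r = 0 := Polynomial.degree_eq_bot.1 (Nat.WithBot.lt_zero_iff.1 hd)
    rw [this, Polynomial.coeff_zero, map_zero, Polynomial.map_zero, Polynomial.coe_zero, map_zero]
    exact (coeff_eq_zero_of_mem_LtNhd (M := (N * n : ℕ)) (zero_mem _) (by omega)).symm
  · rw [show (-1 : ℤ) + ((N * n : ℕ) : ℤ) = ((N * n - 1 : ℕ) : ℤ) by omega, Lt.coeff_algebraMap,
      Polynomial.coeff_coe, Polynomial.coeff_map]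

variable {n}

/-- A functional on `K_n` that factors through the specialization `a = 0` does not distinguish
`φ_n` from `z ^ n`. -/
lemma map_phiK_mul {M : Type*} [AddCommGroup M] [Module ℂ M] (ℓ : Kn n →+ M)
    (hℓ : ∀ (a : An n) f, ℓ (a • f) = MvPowerSeries.constantCoeff a • ℓ f) (f : Kn n) :
    ℓ (phiK n * f) = ℓ (zK n ^ n * f) := by
  have h : ∀ p : (An n)[X], p.map (MvPowerSeries.constantCoeff : An n →+* ℂ) = 0 →
      ℓ (Polynomial.aeval (zK n) p * f) = 0 := by
    intro p hp
    rw [Polynomial.aeval_eq_sum_range, Finset.sum_mul, map_sum]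
    refine Finset.sum_eq_zero fun j _ => ?_
    rw [smul_mul_assoc, hℓ, ← Polynomial.coeff_map, hp, Polynomial.coeff_zero, zero_smul]
  have h2 := h (phi n - X ^ n) (by
    rw [Polynomial.map_sub, map_constantCoeff_phi, Polynomial.map_pow, Polynomial.map_X, sub_self])
  rw [map_sub, aeval_phi, map_pow, Polynomial.aeval_X, sub_mul, map_sub] at h2
  exact sub_eq_zero.1 h2

end Spec

section SpecU

variable (n : ℕ) (g : Type*) [LieRing g] [LieAlgebra ℂ g] (k : ℂ)

/-- `U'_k(ĝ)` as an algebra over `A_n`, by `a_i ↦ 0`. -/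
abbrev laurentAlgebra : Algebra (An n) (UPrime dataLaurent g k) :=
  Algebra.compHom _ (MvPowerSeries.constantCoeff : An n →+* ℂ)

attribute [local instance] laurentAlgebra

lemma laurent_algebraMap (a : An n) : algebraMap (An n) (UPrime dataLaurent g k) a =
    algebraMap ℂ (UPrime dataLaurent g k) (MvPowerSeries.constantCoeff a) := rfl

/-- The `A_n`-structure obtained by specialization restricts to the given `ℂ`-structure. -/
instance : IsScalarTower ℂ (An n) (UPrime dataLaurent g k) :=
  IsScalarTower.of_algebraMap_eq fun c => by
    rw [laurent_algebraMap, MvPowerSeries.algebraMap_apply, MvPowerSeries.constantCoeff_C]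
    rfl

/-- The elements `x f`, `f ∈ K_n`, of `U'_k(ĝ)` obtained by specialization. -/
def specCurrent : Kn n →ₗ[ℂ] g →ₗ[ℂ] UPrime dataLaurent g k :=
  LinearMap.mk₂ ℂ (fun f x => curU dataLaurent g k x (spec n f))
    (fun f h x => by rw [map_add, curU_add])
    (fun c f x => by rw [spec_complex_smul, curU_smul])
    (fun f x y => curU_add_left g k _ x y _)
    (fun c f x => curU_smul_left g k _ c x _)

lemma isCurrent_specCurrent : IsCurrent (dataKn n) g k (specCurrent n g k) where
  smul a f x := by
    change curU dataLaurent g k x (spec n (a • f)) = _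
    rw [spec_smul, curU_smul]
    rfl
  comm f h x y := by
    change curU dataLaurent g k x (spec n f) * curU dataLaurent g k y (spec n h) -
      curU dataLaurent g k y (spec n h) * curU dataLaurent g k x (spec n f) =
        curU dataLaurent g k ⁅x, y⁆ (spec n (f * h)) + _
    rw [curU_mul_curU, map_mul (spec n) f h, laurent_algebraMap, add_assoc, add_sub_cancel_left]
    refine congrArg₂ (· + ·) rfl (congrArg (algebraMap ℂ (UPrime dataLaurent g k)) ?_)
    change levelForm g k x y * resLaurent (spec n h * dLaurent (spec n f)) =
      MvPowerSeries.constantCoeff (levelForm g k x y • residue n (h * dK n f))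
    rw [← spec_dK, ← map_mul, ← constantCoeff_residue, MvPowerSeries.constantCoeff_smul,
      smul_eq_mul]

/-- The homomorphism of enveloping algebras `U'_k(ĝ_n) → U'_k(ĝ)` given by specialization. -/
def specU : UPrime (dataKn n) g k →+* UPrime dataLaurent g k :=
  (isCurrent_specCurrent n g k).lift.toRingHom

lemma specU_curU (x : g) (f : Kn n) :
    specU n g k (curU (dataKn n) g k x f) = curU dataLaurent g k x (spec n f) :=
  (isCurrent_specCurrent n g k).lift_curU x f

lemma specU_algebraMap (a : An n) : specU n g k (algebraMap _ _ a) =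
    algebraMap ℂ _ (MvPowerSeries.constantCoeff a) :=
  (isCurrent_specCurrent n g k).lift.commutes a

end SpecU

section SpecVac

variable {n : ℕ} {g : Type*} [LieRing g] [LieAlgebra ℂ g] {k : ℂ}

lemma specU_smul_vacVec {u : UPrime (dataKn n) g k} (hu : u ∈ leftIdeal n g k 0) :
    specU n g k u • vacVec g k = 0 := by
  induction hu using Submodule.span_induction with
  | zero => rw [map_zero, zero_smul]
  | add u u' _ _ h h' => rw [map_add, add_smul, h, h', add_zero]
  | smul a u _ h => rw [smul_eq_mul, map_mul, mul_smul, h, smul_zero]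
  | mem u hu =>
    obtain ⟨x, f, hf, rfl⟩ := hu
    rw [specU_curU]
    exact curU_smul_vacVec x (spec_mem n hf)

lemma exists_red_coe_eq (N : ℕ) (q : UTilde n g k ⧸ leftIdealHat n g k N) :
    ∃ u : UPrime (dataKn n) g k, red n N (u : UTilde n g k) = q := by
  obtain ⟨v, rfl⟩ := Submodule.Quotient.mk_surjective _ q
  have h : {w | w - v ∈ leftIdealHat n g k N} ∈ nhds v := by
    have ht : Filter.Tendsto (fun w => w - v) (nhds v) (nhds (0 : UTilde n g k)) := by
      have := (continuous_sub_right v).tendsto v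
      rwa [sub_self] at this
    exact ht (LeftLinear.hasBasis.mem_of_mem (i := N) trivial)
  obtain ⟨_, hw, u, rfl⟩ := mem_closure_iff_nhds.1
    (UniformSpace.Completion.denseRange_coe (α := UPrime (dataKn n) g k) v) _ h
  exact ⟨u, (Submodule.Quotient.eq _).2 hw⟩

/-- The left ideals are open, hence closed, so that completion adds no elements of `U'_k` to them.
-/
lemma mem_leftIdeal_of_coe_mem {N : ℕ} {u : UPrime (dataKn n) g k}
    (hu : (u : UTilde n g k) ∈ leftIdealHat n g k N) : u ∈ leftIdeal n g k N := by
  have ho : IsOpen ((leftIdeal n g k N).toAddSubgroup : Set (UPrime (dataKn n) g k)) :=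
    AddSubgroup.isOpen_of_mem_nhds _
      ((leftIdeal_basis n g k).hasBasis_nhds_zero.mem_of_mem (i := N) trivial)
  have hc := AddSubgroup.isClosed_of_isOpen _ ho
  have hi := (UniformSpace.Completion.isUniformInducing_coe
    (UPrime (dataKn n) g k)).isInducing.closure_eq_preimage_closure_image
      ((leftIdeal n g k N).toAddSubgroup : Set (UPrime (dataKn n) g k))
  rw [hc.closure_eq] at hi
  change u ∈ ((leftIdeal n g k N).toAddSubgroup : Set (UPrime (dataKn n) g k))
  rw [hi]
  exact hu

/-- Two elements of `U'_k` with the same class specialize to the same vector. -/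
lemma specU_smul_vacVec_eq {u v : UPrime (dataKn n) g k}
    (h : red n 0 (u : UTilde n g k) = red n 0 (v : UTilde n g k)) :
    specU n g k u • vacVec g k = specU n g k v • vacVec g k := by
  rw [← sub_eq_zero, ← sub_smul, ← map_sub]
  refine specU_smul_vacVec (mem_leftIdeal_of_coe_mem ?_)
  rw [UniformSpace.Completion.coe_sub]
  exact (Submodule.Quotient.eq _).1 h

/-- The specialization of the vacuum module over `K_n` to the vacuum module. -/
def specVac : (UTilde n g k ⧸ leftIdealHat n g k 0) →+ Vac g k :=
  AddMonoidHom.mk' (fun q => specU n g k (exists_red_coe_eq 0 q).choose • vacVec g k)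
    fun q q' => by
      rw [← add_smul, ← map_add]
      refine specU_smul_vacVec_eq ?_
      rw [UniformSpace.Completion.coe_add, map_add, (exists_red_coe_eq 0 q).choose_spec,
        (exists_red_coe_eq 0 q').choose_spec, (exists_red_coe_eq 0 (q + q')).choose_spec]

lemma specVac_coe (u : UPrime (dataKn n) g k) :
    specVac (red n 0 (u : UTilde n g k)) = specU n g k u • vacVec g k :=
  specU_smul_vacVec_eq (exists_red_coe_eq 0 _).choose_spec

lemma specVac_mul (u : UPrime (dataKn n) g k) (v : UTilde n g k) :
    specVac (red n 0 ((u : UTilde n g k) * v)) = specU n g k u • specVac (red n 0 v) := by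
  obtain ⟨w, hw⟩ := exists_red_coe_eq 0 (red n 0 v)
  rw [← leftMul_red, ← hw, leftMul_red, ← UniformSpace.Completion.coe_mul, specVac_coe,
    specVac_coe, map_mul, mul_smul]

lemma specVac_smul (a : An n) (q : UTilde n g k ⧸ leftIdealHat n g k 0) :
    specVac (a • q) = MvPowerSeries.constantCoeff a • specVac q := by
  obtain ⟨u, rfl⟩ := exists_red_coe_eq 0 q
  rw [← map_smul, Algebra.smul_def, ← coe_algebraMap_UTilde, specVac_mul, specU_algebraMap,
    algebraMap_smul]

end SpecVac

/-! ### Injectivity of the canonical map -/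

section Injective

variable {n : ℕ} {g : Type*} [LieRing g] [LieAlgebra ℂ g] {k : ℂ}

lemma duo_hatField_mem_vanishAt (x : g) {c : KField n (UTilde n g k)}
    (hc : ∀ f ∈ Jn n 0, c f ∈ leftIdealHat n g k 0) :
    duo 0 (hatField n g k x) c ∈ vanishAt 1 0 := fun y hy => by
  rw [duo_apply, red_eq_zero]
  exact (leftIdealHat n g k 0).mul_mem_left _ (hc _ hy)

/-- The left ideal generated by `g ⊗ R_n` contains `c(h) X̂(f)` for `f ∈ R_n`. -/
lemma duoSwap_hatField_mem_vanishAt (x : g) (c : KField n (UTilde n g k)) :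
    duoSwap 0 (hatField n g k x) c ∈ vanishAt 0 0 := fun y hy => by
  rw [duoSwap_apply, red_eq_zero]
  exact (leftIdealHat n g k 0).mul_mem_left _
    (subset_closure ⟨_, Ideal.subset_span ⟨x, _, hy, rfl⟩, rfl⟩)

lemma one_mem_Jn : (1 : Kn n) ∈ Jn n 0 := ⟨1, by rw [pow_zero, map_one, mul_one]⟩

/-- Modulo the left ideal generated by `g ⊗ R_n`, only the product in the order `X̂ c` contributes
to `X̂_(m) c`. -/
lemma red_nProd_hatField (x : g) (c : KField n (UTilde n g k)) (m : ℤ) (f : Kn n) :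
    red n 0 (nProd m (hatField n g k x) c f) =
      zPow 0 1 1 m (duo 0 (hatField n g k x) c) ![1, f] := by
  have h := zPow_mem_vanishAt (zero_ne_one (α := Fin 2)) (Or.inl rfl) m
    (duoSwap_hatField_mem_vanishAt x c) ![1, f] one_mem_Jn
  rw [red_nProd, h, sub_zero]

variable (hn : 0 < n)

/-- The fields in the image of the vacuum module map `R_n` to the left ideal generated by
`g ⊗ R_n`. -/
lemma canMap_apply_mem (v : Vac g k) {f : Kn n} (hf : f ∈ Jn n 0) :
    (canMap hn v : KField n (UTilde n g k)) f ∈ leftIdealHat n g k 0 := by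
  let G : Submodule ℂ (Vac g k) :=
    { carrier := {v | ∀ f ∈ Jn n 0,
        (canMap hn v : KField n (UTilde n g k)) f ∈ leftIdealHat n g k 0}
      add_mem' := fun hv hw f hf => by
        rw [map_add, Submodule.coe_add, KField.add_apply]
        exact add_mem (hv f hf) (hw f hf)
      zero_mem' := fun f _ => by
        rw [map_zero, Submodule.coe_zero, KField.zero_apply]
        exact zero_mem _
      smul_mem' := fun c v hv f hf => by
        rw [map_smul, Submodule.coe_smul, KField.complex_smul_eq, KField.smul_apply]
        exact nhd_smul_mem _ (hv f hf) }
  refine Vac.mem_of_act_mem (W := G) ?_ (fun x m v hv f hf => ?_) v f hf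
  · rintro _ ⟨r, rfl⟩
    rw [canMap_vacVec, fieldVacuum_coe, oneField_apply, pow_zero, one_mul, residue_Rn, map_zero]
    exact zero_mem _
  · refine (red_eq_zero (n := n)).1 ?_
    rw [canMap_act, fieldMode_coe]
    refine (red_nProd_hatField x _ m f).trans ?_
    exact zPow_mem_vanishAt zero_ne_one (Or.inr rfl) m (duo_hatField_mem_vanishAt x hv) ![1, f] hf

/-- The test function `z ^ (n - 1) / φ_n`, which specializes to `t⁻¹`. -/
def testFunction (n : ℕ) : Kn n := zK n ^ (n - 1) * phiInv n

/-- The left inverse `c ↦ c(z ^ (n - 1) / φ_n)` of the canonical map. -/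
def evalVac : VKn n g k →ₗ[ℂ] Vac g k where
  toFun c := specVac (red n 0 ((c : KField n (UTilde n g k)) (testFunction n)))
  map_add' c c' := by
    rw [Submodule.coe_add, KField.add_apply, map_add, map_add]
  map_smul' a c := by
    rw [Submodule.coe_smul, KField.complex_smul_eq, KField.smul_apply, map_smul, specVac_smul,
      MvPowerSeries.algebraMap_apply, MvPowerSeries.constantCoeff_C]
    rfl

lemma evalVac_apply (c : VKn n g k) :
    evalVac c = specVac (red n 0 ((c : KField n (UTilde n g k)) (testFunction n))) := rfl

lemma evalVac_vacuum (hn : 0 < n) : evalVac (fieldVacuum g k n) = vacVec g k := by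
  have h := residue_pow_mul_phiInv_pow hn (a := n - 1) (by omega) 0
  rw [if_pos ⟨rfl, by omega⟩, zero_add, pow_one] at h
  rw [evalVac_apply, fieldVacuum_coe, oneField_apply, testFunction, h, map_one]
  have h1 := specVac_coe (g := g) (k := k) (n := n) 1
  rwa [UniformSpace.Completion.coe_one, map_one (specU n g k), one_smul] at h1

/-- At `a = 0` the operator `X̂_(m)` becomes `X_m`: as `c` kills `R_n` and `z f₀` lies in `R_n` up
to terms that vanish at `a = 0`, only the powers of `z` in the expansion of `(z - w) ^ m`
contribute. -/
lemma evalVac_fieldMode (x : g) (m : ℤ) (c : VKn n g k)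
    (hc : ∀ f ∈ Jn n 0, (c : KField n (UTilde n g k)) f ∈ leftIdealHat n g k 0) :
    evalVac (fieldMode g k hn m (hatVec n g k x) c) = act g k x m (evalVac c) := by
  set F : Func n (Fin 2) (UTilde n g k ⧸ leftIdealHat n g k 0) :=
    duo 0 (hatField n g k x) (c : KField n (UTilde n g k))
  have hF : F ∈ expDom 0 1 1 := duo_mem_expDom _ _ _
  -- the expansion of `(z - w) ^ m`, as a functional of the second and of the first variable
  let ℓ : ℤ → Kn n → Kn n →+ Vac g k := fun m f => AddMonoidHom.mk'
    (fun h => specVac (zPow 0 1 1 m F ![f, h])) fun h h' => by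
      have := (zPow 0 1 1 m F).map_update_add ![f, 0] 1 h h'
      simp only [update_fin_two_one] at this
      rw [← map_add]
      exact congrArg specVac this
  let b : ℤ → Kn n →+ Vac g k := fun m => AddMonoidHom.mk'
    (fun f => ℓ m f (testFunction n)) fun f f' => by
      have := (zPow 0 1 1 m F).map_update_add ![0, testFunction n] 0 f f'
      simp only [update_fin_two_zero] at this
      change specVac _ = specVac _ + specVac _
      rw [← map_add]
      exact congrArg specVac this
  have hℓ : ∀ m f (a : An n) h, ℓ m f (a • h) = MvPowerSeries.constantCoeff a • ℓ m f h := by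
    intro m f a h
    have := (zPow 0 1 1 m F).map_update_smul ![f, 0] 1 a h
    simp only [update_fin_two_one] at this
    change specVac _ = _ • specVac _
    rw [← specVac_smul]
    exact congrArg specVac this
  have hb : ∀ m (a : An n) f, b m (a • f) = MvPowerSeries.constantCoeff a • b m f := by
    intro m a f
    have := (zPow 0 1 1 m F).map_update_smul ![0, testFunction n] 0 a f
    simp only [update_fin_two_zero] at this
    change specVac _ = _ • specVac _
    rw [← specVac_smul]
    exact congrArg specVac this
  -- at `a = 0`, `z` times the test function is `1`, which `c` maps to the left ideal
  have hz : ∀ m f, ℓ m f (zK n * testFunction n) = 0 := by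
    intro m f
    rw [testFunction, ← mul_assoc, ← pow_succ', Nat.sub_add_cancel hn, ← map_phiK_mul _ (hℓ m f),
      phiK_mul_phiInv]
    change specVac _ = 0
    rw [zPow_mem_vanishAt zero_ne_one (Or.inr rfl) m (duo_hatField_mem_vanishAt x hc) ![f, 1]
      one_mem_Jn, map_zero]
  -- hence the powers of `w` in the expansion of `(z - w) ^ m` do not contribute
  have hb1 : ∀ m f, b (m + 1) f = b m (zK n * f) := by
    intro m f
    have h := congrArg (fun G => G ![f, testFunction n])
      (zDiff_zPow (zero_ne_one (α := Fin 2)) (Or.inr rfl) m hF)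
    simp only [zDiff_apply, sub_apply, mulSlot_apply, Matrix.cons_val_zero, Matrix.cons_val_one,
      update_fin_two_zero, update_fin_two_one] at h
    change specVac _ = specVac _
    rw [← h, map_sub]
    exact sub_eq_self.2 (hz m f)
  have hb2 : ∀ (j : ℕ) m f, b (m + j) f = b m (zK n ^ j * f) := by
    intro j
    induction j with
    | zero => intro m f; rw [Nat.cast_zero, add_zero, pow_zero, one_mul]
    | succ j ih =>
      intro m f
      rw [Nat.cast_succ, ← add_assoc, hb1, ih, ← mul_assoc, pow_succ]
  have hb3 : ∀ (N : ℕ) m f, b m (phiK n ^ N * f) = b (m + N * n) f := by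
    intro N
    induction N with
    | zero => intro m f; rw [Nat.cast_zero, zero_mul, add_zero, pow_zero, one_mul]
    | succ N ih =>
      intro m f
      rw [pow_succ', mul_assoc, map_phiK_mul _ (hb m), ← hb2, ih]
      congr 2
      push_cast
      ring
  have hb0 : ∀ f, b 0 f = curU dataLaurent g k x (spec n f) • evalVac c := by
    intro f
    change specVac (zPow 0 1 1 0 F ![f, testFunction n]) = _
    rw [zPow_zero hF, duo_apply]
    refine (specVac_mul (curU (dataKn n) g k x f) _).trans ?_
    rw [specU_curU]
    rfl
  obtain ⟨j, hj⟩ : ∃ j : ℕ, m + (m.natAbs : ℤ) * n = j := by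
    refine ⟨(m + (m.natAbs : ℤ) * n).toNat, (Int.toNat_of_nonneg ?_).symm⟩
    have : (m.natAbs : ℤ) * 1 ≤ m.natAbs * n := by gcongr; exact_mod_cast hn
    omega
  have key : evalVac (fieldMode g k hn m (hatVec n g k x) c) = b m 1 :=
    congrArg specVac (red_nProd_hatField x (c : KField n (UTilde n g k)) m (testFunction n))
  -- for negative `m`, write `1 = φ ^ |m| φ ^ (-|m|)` to reduce to nonnegative exponents
  have h1 := hb3 m.natAbs m (phiInv n ^ m.natAbs)
  rw [← mul_pow, phiK_mul_phiInv, one_pow, hj, ← zero_add (j : ℤ), hb2, hb0] at h1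
  rw [key, h1, act, map_mul, map_pow, map_pow, spec_zK, spec_phiInv, tpow_pow, tpow_pow, tpow_mul]
  congr 3
  rw [one_mul, ← hj]
  ring

/-- The composition fixes `|0⟩` and commutes with the operators `x_m`, which generate the vacuum
module. -/
lemma evalVac_canMap (v : Vac g k) : evalVac (canMap hn v) = v := by
  refine LinearMap.congr_fun (f := evalVac ∘ₗ canMap hn) (g := LinearMap.id)
    (Vac.ext_of_act (X := fun m x v => act g k x m v) ?_ (fun x m v => ?_) (fun _ _ _ => rfl)) v
  · rw [LinearMap.comp_apply, canMap_vacVec, evalVac_vacuum hn, LinearMap.id_apply]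
  · rw [LinearMap.comp_apply, canMap_act, evalVac_fieldMode hn x m _
      fun f hf => canMap_apply_mem hn v hf]
    rfl

/-- The canonical isomorphism. -/
def canEquiv : Vac g k ≃ₗ[ℂ] VKn n g k :=
  LinearEquiv.ofBijective (canMap hn)
    ⟨Function.LeftInverse.injective (evalVac_canMap hn), canMap_surjective hn⟩

end Injective

/-! ### Transport of the vertex algebra structure -/
section Structure

variable {n : ℕ} {g : Type*} [LieRing g] [LieAlgebra ℂ g] {k : ℂ} (hn : 0 < n)

lemma IsFieldStructure.ncoeff_eq {W : VertexAlgebra (VKn n g k)} (hW : IsFieldStructure n g k W)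
    (a b : VKn n g k) (m : ℤ) : (W.Y a).ncoeff m b = fieldMode g k hn m a b :=
  Subtype.ext (isNProd_iff.1 (hW.mode a b m))

lemma isAffineStructure_comap :
    IsAffineStructure g k ((fieldVertexAlgebra g k hn).comap (canEquiv hn)) where
  vac := (LinearEquiv.symm_apply_eq _).2 (canMap_vacVec hn).symm
  mode x m v := by
    have e : canEquiv hn (act g k x (-1) (vacVec g k)) = hatVec n g k x := canMap_act_vacVec hn x
    rw [VertexAlgebra.ncoeff_comap, e, LinearEquiv.symm_apply_eq, ncoeff_fieldVertexAlgebra]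
    exact (canMap_act hn x m v).symm

/-- The canonical map as an isomorphism of vertex algebras. -/
def canIso {S : VertexAlgebra (Vac g k)} {W : VertexAlgebra (VKn n g k)}
    (hS : IsAffineStructure g k S) (hW : IsFieldStructure n g k W) : S.Iso W :=
  have h0 : canMap (g := g) (k := k) hn (vacVec g k) = W.vac :=
    (canMap_vacVec hn).trans (Subtype.ext hW.vac.symm)
  have hact : ∀ x m v, canMap (g := g) (k := k) hn (act g k x m v) =
      (W.Y (hatVec n g k x)).ncoeff m (canMap hn v) := fun x m v => by
    rw [hW.ncoeff_eq hn, canMap_act]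
  { toLinearEquiv := canEquiv hn
    map_vac := by
      change canMap hn S.vac = W.vac
      rw [hS.vac, h0]
    map_T := fun a => by
      change canMap hn (S.T a) = W.T (canMap hn a)
      exact map_translation hS h0 hact a
    map_mode := fun a m b => by
      change canMap hn ((S.Y a).ncoeff m b) = (W.Y (canMap hn a)).ncoeff m (canMap hn b)
      exact map_ncoeff hS h0 hact a m b }

end Structure

end KnFields

end

theorem mainTheorem6 (n : ℕ) (hn : 0 < n) (g : Type*) [LieRing g] [LieAlgebra ℂ g]
    [Module.Finite ℂ g] [LieAlgebra.IsSimple ℂ g] (k : ℂ) :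
    (k ≠ 0 → oneField n (UTilde n g k) ∈ hatClosure n g k) ∧
    (∃ S : VertexAlgebra (Vac g k), IsAffineStructure g k S) ∧
    (∃ W : VertexAlgebra (VKn n g k), IsFieldStructure n g k W) ∧
    ∀ (S : VertexAlgebra (Vac g k)) (W : VertexAlgebra (VKn n g k)),
      IsAffineStructure g k S → IsFieldStructure n g k W →
        ∃ Ycan : S.Iso W, ∀ x : g,
          (Ycan.toLinearEquiv (act g k x (-1) (vacVec g k)) : KField n (UTilde n g k)) =
            hatField n g k x := by
  refine ⟨fun hk => oneField_mem_hatClosure g k hn hk, ⟨_, isAffineStructure_comap hn⟩,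
    ⟨_, isFieldStructure_fieldVertexAlgebra g k hn⟩, fun S W hS hW =>
      ⟨canIso hn hS hW, fun x => congrArg Subtype.val (canMap_act_vacVec hn x)⟩⟩
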